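/- Let $d\ge 1$ and $n\ge 2$ be integers, and let $\mathbb{T}^d=\mathbb{R}^d/\mathbb{Z}^d$ with its Euclidean metric. For a finite Borel measure $\mu$ on $\mathbb{T}^d$ put $\widehat\mu(\xi)=\int e^{-2\pi i\xi\cdot x}\,d\mu(x)$ for $\xi\in\mathbb{Z}^d$ and $\|\mu\|_{M(\lambda)}=\sup_{\xi\in\mathbb{Z}^d}|\widehat\mu(\xi)|\,|\xi|^{\lambda/2}$. The Fourier dimension $\dim_{\mathbb F}(\mu)$ is the supremum of all $s\in[0,d]$ with $\|\mu\|_{M(s)}<\infty$; the Fourier dimension $\dim_{\mathbb F}(E)$ of a Borel set $E\subset\mathbb{T}^d$ is the supremum of $\dim_{\mathbb F}(\mu)$ over all Borel probability measures $\mu$ with $\operatorname{supp}(\mu)\subset E$; and $E$ is a Salem set if its Fourier dimension equals its Hausdorff dimension. For $0<\beta\le d$, let $M(\beta)$ be the set of finite Borel measures $\mu$ on $\mathbb{T}^d$ with $\|\mu\|_{M(\lambda)}<\infty$ for all $\lambda\in[0,\beta)$, with the topology given by the distances $\|\mu-\nu\|_{M(\lambda)}$, $\lambda\in[0,\beta)$.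 Let $\mathcal{X}_\beta$ be the space of all pairs $(E,\mu)$ where $E\subset\mathbb{T}^d$ is compact and $\mu\in M(\beta)$ is a probability measure with $\operatorname{supp}(\mu)\subset E$, with the product of the topology of the Hausdorff distance and the topology of $M(\beta)$. Let $V\subset\mathbb{T}^{d(n-1)}=(\mathbb{T}^d)^{n-1}$ be open, and let $f:V\to\mathbb{T}^d$ be a smooth function such that for each $k\in\{1,\dots,n-1\}$ the $d\times d$ matrix $$D_{x_k}f(x_1,\dots,x_{n-1})=\left(\frac{\partial f_i}{\partial (x_k)_j}\right)_{1\le i,j\le d}$$ is invertible whenever $(x_1,\dots,x_{n-1})\in V$ and $x_1,\dots,x_{n-1}$ are distinct. Set $$\beta_0=\begin{cases} d & \text{if } n=2,\\ d/(n-3/4) & \text{if } n\ge 3.\end{cases}$$ Then there exists a compact Salem set $E\subset\mathbb{T}^d$ of (Fourier and Hausdorff) dimension $\beta_0$ such that for any distinct points $x_1,\dots,x_n\in E$ with $(x_1,\dots,x_{n-1})\in V$, $$x_n\ne f(x_1,\dots,x_{n-1}).$$ Moreover, for every $\beta$ with $0<\beta\le\beta_0$, the family of all pairs $(E,\mu)\in\mathcal{X}_\beta$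 such that $E$ is Salem and $x_n\ne f(x_1,\dots,x_{n-1})$ for all distinct $x_1,\dots,x_n\in E$ with $(x_1,\dots,x_{n-1})\in V$ is comeager in $\mathcal{X}_\beta$ (that is, its complement is of first category). -/

import Mathlib

open Set Filter Topology MeasureTheory
open scoped ENNReal ContDiff

noncomputable section

namespace SalemAvoid

/-- The torus `𝕋^d = ℝ^d / ℤ^d`. -/
abbrev Torus (d : ℕ) : Type := UnitAddTorus (Fin d)

/-- The projection `ℝ^d → 𝕋^d`. -/
def proj {d : ℕ} (a : Fin d → ℝ) : Torus d := fun i => (a i : UnitAddCircle)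

/-- The projection `(ℝ^d)^m → (𝕋^d)^m`. -/
def projTuple {m d : ℕ} (a : Fin m → Fin d → ℝ) : Fin m → Torus d := fun k => proj (a k)

/-! ### Smooth maps between tori and their partial Jacobians -/

/-- `F` is a smooth lift of `f : (𝕋^d)^m → 𝕋^d` near the point `a ∈ (ℝ^d)^m`, i.e. the expression
of `f` in the coordinates of `ℝ^d` near `projTuple a`. Two such lifts differ near `a` by a constant
vector of `ℤ^d`, so derivatives do not depend on the choice. -/
def IsSmoothLiftAt {m d : ℕ} (f : (Fin m → Torus d) → Torus d) (a : Fin m → Fin d → ℝ)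
    (F : (Fin m → Fin d → ℝ) → Fin d → ℝ) : Prop :=
  ∃ U ∈ 𝓝 a, ContDiffOn ℝ ∞ F U ∧ ∀ y ∈ U, proj (F y) = f (projTuple y)

/-- `f` is smooth on the open set `V ⊆ (𝕋^d)^m`; only the values of `f` on `V` matter. -/
def IsSmoothOn {m d : ℕ} (f : (Fin m → Torus d) → Torus d) (V : Set (Fin m → Torus d)) : Prop :=
  ∀ a, projTuple a ∈ V → ∃ F, IsSmoothLiftAt f a F

/-- The `d × d` matrix of partial derivatives `∂F_i / ∂(x_k)_j` at `a`. -/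
def partialJacobian {m d : ℕ} (F : (Fin m → Fin d → ℝ) → Fin d → ℝ) (a : Fin m → Fin d → ℝ)
    (k : Fin m) : Matrix (Fin d) (Fin d) ℝ :=
  Matrix.of fun i j => fderiv ℝ F a (Pi.single k (Pi.single j 1)) i

/-- `D_{x_k} f` is invertible at every point of `V` with distinct entries, for every `k`. -/
def PartialJacobiansInvertibleOn {m d : ℕ} (f : (Fin m → Torus d) → Torus d)
    (V : Set (Fin m → Torus d)) : Prop :=
  ∀ a, projTuple a ∈ V → Function.Injective (projTuple a) →
    ∀ F, IsSmoothLiftAt f a F → ∀ k, IsUnit (partialJacobian F a k)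

/-! ### Fourier dimension, Hausdorff dimension, Salem sets -/

/-- The Euclidean norm `|ξ|` of a frequency. -/
def freqNorm {d : ℕ} (ξ : Fin d → ℤ) : ℝ := √(∑ i, (ξ i : ℝ) ^ 2)

/-- `μ̂(ξ) = ∫ exp(-2πi ξ·x) dμ(x)`. -/
def fourierCoeff {d : ℕ} (μ : Measure (Torus d)) (ξ : Fin d → ℤ) : ℂ :=
  ∫ x, UnitAddTorus.mFourier (-ξ) x ∂μ

/-- The weighted Fourier transform `ξ ↦ |ξ|^{s/2} μ̂(ξ)`. -/
def weightedCoeff {d : ℕ} (s : ℝ) (μ : Measure (Torus d)) (ξ : Fin d → ℤ) : ℂ :=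
  ((freqNorm ξ ^ (s / 2) : ℝ) : ℂ) * fourierCoeff μ ξ

/-- `sup_ξ |μ̂(ξ)| |ξ|^{s/2} < ∞`. -/
def HasFourierDecay {d : ℕ} (s : ℝ) (μ : Measure (Torus d)) : Prop :=
  BddAbove (range fun ξ : Fin d → ℤ => ‖weightedCoeff s μ ξ‖)

/-- The Fourier dimension of a measure: the supremum of all `s ∈ [0,d]` with
`sup_ξ |μ̂(ξ)| |ξ|^{s/2} < ∞`. -/
def fourierDimMeasure {d : ℕ} (μ : Measure (Torus d)) : ℝ≥0∞ :=
  ⨆ s ∈ {s : ℝ | s ∈ Icc (0 : ℝ) d ∧ HasFourierDecay s μ}, ENNReal.ofReal s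

/-- The Fourier dimension of a set: the supremum of the Fourier dimensions of the Borel
probability measures whose support is contained in it. -/
def fourierDim {d : ℕ} (E : Set (Torus d)) : ℝ≥0∞ :=
  ⨆ μ ∈ {μ : ProbabilityMeasure (Torus d) | (μ : Measure (Torus d)).support ⊆ E},
    fourierDimMeasure (μ : Measure (Torus d))

/-- The Hausdorff dimension for the Euclidean metric
`d(x,y) = (|x_1 - y_1|^2 + ... + |x_d - y_d|^2)^{1/2}` of `𝕋^d`. -/
def hausdorffDim {d : ℕ} (E : Set (Torus d)) : ℝ≥0∞ :=
  dimH ((WithLp.ofLp : PiLp 2 (fun _ : Fin d => UnitAddCircle) → Torus d) ⁻¹' E)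

/-- A Salem set: Fourier and Hausdorff dimension agree. -/
def IsSalem {d : ℕ} (E : Set (Torus d)) : Prop := fourierDim E = hausdorffDim E

/-! ### The spaces `M(β)` and `𝒳_β` -/

/-- The finite Borel measures on `𝕋^d` with `‖μ‖_{M(s)} = sup_ξ |μ̂(ξ)| |ξ|^{s/2} < ∞` for all
`s ∈ [0,β)`. -/
structure DecayMeasure (d : ℕ) (β : ℝ) where
  /-- the underlying measure -/
  toMeasure : Measure (Torus d)
  isFinite : IsFiniteMeasure toMeasure
  decay : ∀ s ∈ Ico (0 : ℝ) β, HasFourierDecay s toMeasure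

/-- The topology of the family of (semi)norm distances
`‖μ - ν‖_{M(s)} = sup_ξ |μ̂(ξ) - ν̂(ξ)| |ξ|^{s/2}`, `s ∈ [0,β)`: for each `s`, the functions
`ξ ↦ |ξ|^{s/2} μ̂(ξ)` are compared uniformly in `ξ`. -/
instance (d : ℕ) (β : ℝ) : TopologicalSpace (DecayMeasure d β) :=
  ⨅ s : Ico (0 : ℝ) β, TopologicalSpace.induced
    (fun μ : DecayMeasure d β => UniformFun.ofFun (weightedCoeff (s : ℝ) μ.toMeasure)) inferInstance

/-- `𝒳_β`: pairs `(E, μ)` of a compact set `E` and a probability measure `μ ∈ M(β)` with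
`supp μ ⊆ E`, as a subspace of the product of the compact sets with the Hausdorff distance and
`M(β)`. The set `E` is nonempty automatically, since it supports a probability measure. -/
abbrev PairSpace (d : ℕ) (β : ℝ) : Type :=
  {p : TopologicalSpace.NonemptyCompacts (Torus d) × DecayMeasure d β //
    IsProbabilityMeasure p.2.toMeasure ∧ p.2.toMeasure.support ⊆ (p.1 : Set (Torus d))}

/-! ### The pattern -/

/-- `E` contains no distinct points `x_1, …, x_m, y` with `(x_1, …, x_m) ∈ V` and
`y = f(x_1, …, x_m)`. -/
def Avoids {m d : ℕ} (f : (Fin m → Torus d) → Torus d) (V : Set (Fin m → Torus d))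
    (E : Set (Torus d)) : Prop :=
  ∀ (x : Fin m → Torus d) (y : Torus d), (∀ k, x k ∈ E) → y ∈ E →
    Function.Injective x → (∀ k, x k ≠ y) → x ∈ V → y ≠ f x

/-- The critical dimension: `d` if `n = 2`, and `d / (n - 3/4)` if `n ≥ 3`. -/
def criticalDim (d n : ℕ) : ℝ := if n = 2 then (d : ℝ) else (d : ℝ) / ((n : ℝ) - 3 / 4)

end SalemAvoid

end

open Set Filter Topology MeasureTheory
open scoped ENNReal ContDiff

noncomputable section

namespace SalemAvoid

open UnitAddTorus

/-! ### The torus -/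

/-! The argument is Baire category. The space of pairs embeds, through its weighted Fourier
coefficients, as a closed subset of a complete space (`baireSpace_pairSpace`), and both required
properties contain countable intersections of dense open conditions.

For the Salem property the condition is `IsThin`: a finite cover by small balls of small total
β-size. If it holds at every scale, the Hausdorff dimension is at most β. The measure of the pair
gives Fourier dimension at least β, and `fourierDim_le_hausdorffDim` closes the circle. For
avoidance, the configurations (x, y) with distinct entries and x in V are covered by countably many
products of small closed balls. On each of them f is continuous, so having no solution there is an
open condition on E.

Density is reduced by `ApproximatesDensities.exists_close` to approximating a smooth density ρ.
Given (E, μ), a little of the uniform measure of a fine net of E is added to μ, and the result is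
smoothed. A measure close to ρ in Fourier space, with support near that of ρ, then has support
Hausdorff close to E.

The approximants are random. About N points are drawn uniformly, weighted so that their mean is ρ,
and convolved with a bump of radius r = N^(-1/s'), where s < s' < β. A bounded differences
inequality gives fluctuations of size N^(-1/2+γ) at polynomially many frequencies. The bump removes
frequencies beyond 1/r, so the weight |ξ|^(s/2) costs at most N^(s/(2s')), which is below N^(1/2)
(`exists_sample`, `exists_random_measure`). This alone gives thin supports (`exists_thin_measure`).

To avoid the pattern near (x, y), with m = n - 1 variables, ρ is split into pieces near the x_k and
a remainder h. Each piece is replaced by N random points. The remainder is kept as a density but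
multiplied by a weight W that vanishes within O(r) of f at each of the N^m tuples of sampled points
(`exists_avoiding_measure`). Points of the support near x lie close to such a tuple, and their image
under f falls where W vanishes. Moving one sampled point changes W by O(1/N) in L^1, so
concentration still applies.

It remains to see that the mean of W h is close to h (`eventually_mean_close`). Bonferroni gives E W
= 1 - N^m q + O((N^m r^d)^2), where q is the probability that one tuple hits. Invertible partial
Jacobians enter twice. By nonstationary phase the coefficients of q decay rapidly, with a factor
r^d, so the linear term only needs N^m r^d to tend to 0. And f expands in each variable, so two
different tuples hit the same place with probability O(r^(2d)). The quadratic error is known only in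
sup norm and pays the full N^(s/(2s')). It is negligible when 2(m - d/s') + 1/2 < 0, that is, s' <
d/(n - 3/4). For n = 2 the tuples are independent, E W = (1 - q)^N exactly, no rough error arises,
and s' < d is enough. -/

instance : IsProbabilityMeasure (volume : Measure UnitAddCircle) :=
  ⟨UnitAddCircle.measure_univ⟩

instance (d : ℕ) : IsProbabilityMeasure (volume : Measure (Torus d)) :=
  inferInstanceAs (IsProbabilityMeasure (Measure.pi fun _ : Fin d => (volume : Measure UnitAddCircle)))

instance (m d : ℕ) : BorelSpace (Fin m → Torus d) := Pi.borelSpace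

instance {ι : Type*} [Fintype ι] (d : ℕ) : IsProbabilityMeasure (volume : Measure (ι → Torus d)) :=
  inferInstanceAs (IsProbabilityMeasure (Measure.pi fun _ : ι => (volume : Measure (Torus d))))

lemma mFourier_proj {d : ℕ} (ξ : Fin d → ℤ) (a : Fin d → ℝ) :
    mFourier ξ (proj a) = Complex.exp (2 * Real.pi * Complex.I * (∑ i, (ξ i : ℝ) * a i : ℝ)) := by
  simp only [mFourier, ContinuousMap.coe_mk, proj, fourier_coe_apply]
  rw [← Complex.exp_sum]
  congr 1
  push_cast
  rw [Finset.mul_sum]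
  refine Finset.sum_congr rfl fun i _ => ?_
  simp
  ring

@[simp] lemma norm_mFourier {d : ℕ} (ξ : Fin d → ℤ) (x : Torus d) : ‖mFourier ξ x‖ = 1 := by
  simp [mFourier, norm_prod, Circle.norm_coe]

lemma mFourier_add_apply {d : ℕ} (ξ : Fin d → ℤ) (x y : Torus d) :
    mFourier ξ (x + y) = mFourier ξ x * mFourier ξ y := by
  simp [mFourier, Finset.prod_mul_distrib, fourier_apply, AddCircle.toCircle_add]

lemma mFourier_neg_apply {d : ℕ} (ξ : Fin d → ℤ) (x : Torus d) :
    mFourier ξ (-x) = mFourier (-ξ) x := by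
  simp [mFourier, fourier_apply]

lemma continuous_proj {d : ℕ} : Continuous (proj : (Fin d → ℝ) → Torus d) :=
  continuous_pi fun i => (AddCircle.continuous_mk' 1).comp (continuous_apply i)

lemma proj_add {d : ℕ} (a b : Fin d → ℝ) : proj (a + b) = proj a + proj b := by
  ext i; simp [proj]

lemma proj_sub {d : ℕ} (a b : Fin d → ℝ) : proj (a - b) = proj a - proj b := by
  ext i; simp [proj]

lemma norm_proj_le {d : ℕ} (a : Fin d → ℝ) : ‖proj a‖ ≤ ‖a‖ := by
  refine (pi_norm_le_iff_of_nonneg (norm_nonneg _)).2 fun i => ?_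
  refine le_trans ?_ (norm_le_pi_norm a i)
  exact QuotientAddGroup.norm_mk_le_norm

lemma norm_proj_of_le {d : ℕ} {a : Fin d → ℝ} (ha : ‖a‖ ≤ 1 / 2) : ‖proj a‖ = ‖a‖ := by
  refine le_antisymm (norm_proj_le a) ?_
  refine (pi_norm_le_iff_of_nonneg (norm_nonneg _)).2 fun i => ?_
  refine le_trans (le_of_eq ?_) (norm_le_pi_norm (proj a) i)
  have : |a i| ≤ 1 / 2 := (norm_le_pi_norm a i).trans ha
  rw [Real.norm_eq_abs]
  exact ((AddCircle.norm_coe_eq_abs_iff 1 one_ne_zero).2 (by simpa using this)).symm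

lemma exists_proj_eq {d : ℕ} (u : Torus d) : ∃ v : Fin d → ℝ, proj v = u ∧ ‖v‖ = ‖u‖ := by
  have h : ∀ i, ∃ t : ℝ, (t : UnitAddCircle) = u i ∧ |t| = ‖u i‖ := by
    intro i
    obtain ⟨t, ht⟩ := QuotientAddGroup.mk_surjective (u i)
    -- The representative nearest to zero realises the quotient norm.
    refine ⟨t - round t, ?_, ?_⟩
    · rw [← ht]
      have : ((round t : ℤ) : ℝ) = (round t : ℤ) • (1 : ℝ) := by simp
      rw [AddCircle.coe_sub, this, AddCircle.coe_zsmul, AddCircle.coe_period]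
      simp
    · rw [← ht]
      exact (UnitAddCircle.norm_eq (x := t)).symm
  choose v hv hn using h
  refine ⟨v, funext hv, ?_⟩
  have : (fun i => ‖v i‖) = fun i => ‖u i‖ := funext fun i => hn i
  have h2 : ∀ i, ‖v i‖₊ = ‖u i‖₊ := fun i => NNReal.eq (hn i)
  simp [Pi.norm_def, h2]

lemma exists_proj_near {d : ℕ} (a : Fin d → ℝ) (u : Torus d) :
    ∃ v : Fin d → ℝ, proj v = u ∧ dist v a = dist u (proj a) := by
  obtain ⟨v, hv, hn⟩ := exists_proj_eq (u - proj a)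
  refine ⟨a + v, ?_, ?_⟩
  · rw [proj_add, hv]; abel
  · rw [dist_eq_norm, dist_eq_norm, ← hn]; simp

lemma dist_proj_le {d : ℕ} (a b : Fin d → ℝ) : dist (proj a) (proj b) ≤ dist a b := by
  rw [dist_eq_norm, dist_eq_norm, ← proj_sub]; exact norm_proj_le _

lemma dist_proj_of_le {d : ℕ} {a b : Fin d → ℝ} (h : dist a b ≤ 1 / 2) :
    dist (proj a) (proj b) = dist a b := by
  rw [dist_eq_norm] at h ⊢
  rw [dist_eq_norm, ← proj_sub]; exact norm_proj_of_le h

lemma norm_mFourier_sub_one_le {d : ℕ} (ξ : Fin d → ℤ) (x : Torus d) :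
    ‖mFourier ξ x - 1‖ ≤ 2 * Real.pi * d * ‖ξ‖ * ‖x‖ := by
  obtain ⟨v, rfl, hn⟩ := exists_proj_eq x
  rw [mFourier_proj, ← hn]
  have h1 : 2 * (Real.pi : ℂ) * Complex.I * ((∑ i, (ξ i : ℝ) * v i : ℝ) : ℂ)
      = Complex.I * ((2 * Real.pi * ∑ i, (ξ i : ℝ) * v i : ℝ) : ℂ) := by push_cast; ring
  rw [h1]
  refine (Real.norm_exp_I_mul_ofReal_sub_one_le).trans ?_
  rw [Real.norm_eq_abs, abs_mul, abs_of_pos (by positivity : 0 < 2 * Real.pi)]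
  have h2 : |∑ i, (ξ i : ℝ) * v i| ≤ ∑ i : Fin d, ‖ξ‖ * ‖v‖ := by
    refine (Finset.abs_sum_le_sum_abs _ _).trans (Finset.sum_le_sum fun i _ => ?_)
    rw [abs_mul]
    gcongr
    · rw [← Int.norm_eq_abs]; exact norm_le_pi_norm ξ i
    · exact norm_le_pi_norm v i
  rw [Finset.sum_const, Finset.card_univ, Fintype.card_fin, nsmul_eq_mul] at h2
  calc 2 * Real.pi * |∑ i, (ξ i : ℝ) * v i| ≤ 2 * Real.pi * (d * (‖ξ‖ * ‖v‖)) := by gcongr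
    _ = _ := by ring

lemma volume_closedBall_le {d : ℕ} (x : Torus d) {r : ℝ} (hr : 0 ≤ r) :
    volume (Metric.closedBall x r) ≤ ENNReal.ofReal ((2 * r) ^ d) := by
  rw [closedBall_pi _ hr, volume_pi_pi, ENNReal.ofReal_pow (by positivity)]
  refine (Finset.prod_le_pow_card _ _ (ENNReal.ofReal (2 * r)) fun i _ => ?_).trans (by simp)
  rw [AddCircle.volume_closedBall]
  exact ENNReal.ofReal_le_ofReal (min_le_right _ _)

lemma measureReal_closedBall_le {d : ℕ} (x : Torus d) {r : ℝ} (hr : 0 ≤ r) :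
    volume.real (Metric.closedBall x r) ≤ (2 * r) ^ d :=
  ENNReal.toReal_le_of_le_ofReal (by positivity) (volume_closedBall_le x hr)

/-! ### Frequencies -/

/-- The weight `1 + |ξ|` with the maximum norm. -/
def freqWeight {d : ℕ} (ξ : Fin d → ℤ) : ℝ := 1 + ‖ξ‖

lemma one_le_freqWeight {d : ℕ} (ξ : Fin d → ℤ) : 1 ≤ freqWeight ξ := by
  simp [freqWeight]

lemma freqWeight_pos {d : ℕ} (ξ : Fin d → ℤ) : 0 < freqWeight ξ :=
  zero_lt_one.trans_le (one_le_freqWeight ξ)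

@[simp] lemma freqWeight_neg {d : ℕ} (ξ : Fin d → ℤ) : freqWeight (-ξ) = freqWeight ξ := by
  simp [freqWeight]

lemma norm_le_freqWeight {d : ℕ} (ξ : Fin d → ℤ) : ‖ξ‖ ≤ freqWeight ξ := by
  simp [freqWeight]

/-- Submultiplicativity is what lets polynomial decay survive a convolution of coefficient
sequences, in `norm_fnCoeff_mul_le`. -/
lemma freqWeight_add_le {d : ℕ} (ξ η : Fin d → ℤ) :
    freqWeight (ξ + η) ≤ freqWeight ξ * freqWeight η := by
  have := norm_add_le ξ η
  have := mul_nonneg (norm_nonneg ξ) (norm_nonneg η)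
  simp only [freqWeight]; nlinarith

lemma freqNorm_nonneg {d : ℕ} (ξ : Fin d → ℤ) : 0 ≤ freqNorm ξ := Real.sqrt_nonneg _

lemma norm_le_freqNorm {d : ℕ} (ξ : Fin d → ℤ) : ‖ξ‖ ≤ freqNorm ξ := by
  refine (pi_norm_le_iff_of_nonneg (Real.sqrt_nonneg _)).2 fun i => ?_
  refine Real.le_sqrt_of_sq_le ?_
  have : ‖ξ i‖ ^ 2 = (ξ i : ℝ) ^ 2 := by rw [Int.norm_eq_abs, sq_abs]
  rw [this]
  exact Finset.single_le_sum (f := fun i => (ξ i : ℝ) ^ 2) (fun j _ => sq_nonneg _)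
    (Finset.mem_univ i)

lemma freqNorm_le {d : ℕ} (ξ : Fin d → ℤ) : freqNorm ξ ≤ d * ‖ξ‖ := by
  refine Real.sqrt_le_iff.2 ⟨by positivity, ?_⟩
  have : ∑ i, (ξ i : ℝ) ^ 2 ≤ ∑ _i : Fin d, ‖ξ‖ ^ 2 := by
    refine Finset.sum_le_sum fun i _ => ?_
    rw [← sq_abs, ← Int.norm_eq_abs]
    gcongr
    exact norm_le_pi_norm ξ i
  refine this.trans ?_
  rw [Finset.sum_const, Finset.card_univ, Fintype.card_fin, nsmul_eq_mul, mul_pow]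
  gcongr
  exact_mod_cast Nat.le_self_pow two_ne_zero d

lemma one_le_norm {d : ℕ} {ξ : Fin d → ℤ} (h : ξ ≠ 0) : 1 ≤ ‖ξ‖ := by
  obtain ⟨i, hi⟩ := Function.ne_iff.1 h
  refine le_trans ?_ (norm_le_pi_norm ξ i)
  rw [Int.norm_eq_abs]
  exact_mod_cast Int.one_le_abs hi

lemma freqNorm_rpow_le {d : ℕ} {s : ℝ} (hs : 0 ≤ s) (ξ : Fin d → ℤ) :
    freqNorm ξ ^ s ≤ (d : ℝ) ^ s * freqWeight ξ ^ s := by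
  rw [← Real.mul_rpow (by positivity) (freqWeight_pos ξ).le]
  refine Real.rpow_le_rpow (Real.sqrt_nonneg _) ((freqNorm_le ξ).trans ?_) hs
  gcongr
  exact norm_le_freqWeight ξ

lemma freqWeight_rpow_le {d : ℕ} {s : ℝ} (hs : 0 ≤ s) {ξ : Fin d → ℤ} (h : ξ ≠ 0) :
    freqWeight ξ ^ s ≤ (2 : ℝ) ^ s * freqNorm ξ ^ s := by
  rw [← Real.mul_rpow (by positivity) (freqNorm_nonneg ξ)]
  refine Real.rpow_le_rpow (freqWeight_pos ξ).le ?_ hs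
  have h1 := one_le_norm h
  have h2 := norm_le_freqNorm ξ
  simp only [freqWeight]; linarith

/-- The maximum norm dominates every coordinate and s is negative, so the term is at most a product
of d one-dimensional terms with exponent s/d < -1. The sum of the products over a finite set is
bounded by a product of convergent series. -/
lemma summable_freqWeight_rpow {d : ℕ} {s : ℝ} (hs : s < -d) :
    Summable fun ξ : Fin d → ℤ => freqWeight ξ ^ s := by
  have h : Summable fun ξ : Fin d → ℤ => ∏ i, (1 + ‖ξ i‖) ^ (s / d) := by
    rcases Nat.eq_zero_or_pos d with rfl | hd
    · exact Summable.of_finite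
    have hd' : (0 : ℝ) < d := by exact_mod_cast hd
    have h1 : Summable fun k : ℤ => (1 + ‖k‖) ^ (s / d) := by
      have hsd : s / d < -1 := by rw [div_lt_iff₀ hd']; linarith
      have : Summable fun n : ℕ => ((1 : ℝ) + n) ^ (s / d) := by
        have := (summable_nat_add_iff 1).2 (Real.summable_nat_rpow.2 hsd)
        simpa [add_comm] using this
      refine Summable.of_nat_of_neg ?_ ?_
      · simpa using this
      · simpa using this
    refine summable_of_sum_le (c := ∏ _i : Fin d, ∑' k : ℤ, (1 + ‖k‖) ^ (s / d))
      (fun ξ => Finset.prod_nonneg fun i _ => by positivity) fun u => ?_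
    classical
    have hsub : u ⊆ Fintype.piFinset fun i : Fin d => u.image fun ξ => ξ i := by
      intro ξ hξ
      rw [Fintype.mem_piFinset]
      exact fun i => Finset.mem_image_of_mem _ hξ
    refine (Finset.sum_le_sum_of_subset_of_nonneg hsub
      fun ξ _ _ => Finset.prod_nonneg fun i _ => by positivity).trans ?_
    rw [← Finset.prod_univ_sum (fun i : Fin d => u.image fun ξ => ξ i)
      fun _ k => (1 + ‖k‖) ^ (s / d)]
    refine Finset.prod_le_prod (fun i _ => Finset.sum_nonneg fun k _ => by positivity) fun i _ => ?_
    exact h1.sum_le_tsum _ fun k _ => by positivity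
  refine Summable.of_nonneg_of_le (fun ξ => Real.rpow_nonneg (freqWeight_pos ξ).le _)
    (fun ξ => ?_) h
  rcases Nat.eq_zero_or_pos d with rfl | hd
  · simp only [freqWeight, Finset.univ_eq_empty, Finset.prod_empty]
    have : ‖ξ‖ = 0 := by simp [Subsingleton.elim ξ 0]
    simp [this]
  have hd' : (0 : ℝ) < d := by exact_mod_cast hd
  have : freqWeight ξ ^ s = ∏ _i : Fin d, freqWeight ξ ^ (s / d) := by
    rw [Finset.prod_const, Finset.card_univ, Fintype.card_fin, ← Real.rpow_natCast,
      ← Real.rpow_mul (freqWeight_pos ξ).le]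
    congr 1; field_simp
  rw [this]
  refine Finset.prod_le_prod (fun i _ => Real.rpow_nonneg (freqWeight_pos ξ).le _) fun i _ => ?_
  refine Real.rpow_le_rpow_of_nonpos (by positivity) ?_ ?_
  · simp only [freqWeight]; gcongr; exact norm_le_pi_norm ξ i
  · exact div_nonpos_of_nonpos_of_nonneg (by linarith) hd'.le

lemma norm_fourierCoeff_le {d : ℕ} (μ : Measure (Torus d)) [IsFiniteMeasure μ] (ξ : Fin d → ℤ) :
    ‖fourierCoeff μ ξ‖ ≤ μ.real univ := by
  refine (norm_integral_le_integral_norm _).trans ?_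
  simp

lemma integrable_mFourier {d : ℕ} (μ : Measure (Torus d)) [IsFiniteMeasure μ] (ξ : Fin d → ℤ) :
    Integrable (fun x => mFourier ξ x) μ :=
  (integrable_const (1 : ℝ)).mono' (mFourier ξ).continuous.aestronglyMeasurable
    (Eventually.of_forall fun x => by simp)

lemma fourierCoeff_zero {d : ℕ} (μ : Measure (Torus d)) : fourierCoeff μ 0 = (μ.real univ : ℂ) := by
  simp [fourierCoeff, mFourier_zero]

end SalemAvoid

end

open Set Filter Topology MeasureTheory
open scoped ENNReal ContDiff

noncomputable section

namespace SalemAvoid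

open UnitAddTorus

/-! ### The Fourier dimension is at most the Hausdorff dimension -/

lemma fourierCoeff_neg {d : ℕ} (μ : Measure (Torus d)) (ξ : Fin d → ℤ) :
    fourierCoeff μ (-ξ) = (starRingEnd ℂ) (fourierCoeff μ ξ) := by
  rw [fourierCoeff, fourierCoeff, ← integral_conj]
  refine integral_congr_ae (Eventually.of_forall fun x => ?_)
  simp only [← mFourier_neg]

lemma integral_prod_mFourier_sub {d : ℕ} (ν : Measure (Torus d)) [IsFiniteMeasure ν]
    (ξ : Fin d → ℤ) :
    ∫ p, mFourier ξ (p.1 - p.2) ∂(ν.prod ν) = ((‖fourierCoeff ν ξ‖ ^ 2 : ℝ) : ℂ) := by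
  have h : ∀ p : Torus d × Torus d,
      mFourier ξ (p.1 - p.2) = mFourier ξ p.1 * mFourier (-ξ) p.2 := fun p => by
    rw [sub_eq_add_neg, mFourier_add_apply, mFourier_neg_apply]
  simp_rw [h]
  rw [integral_prod_mul (fun x => mFourier ξ x) (fun x => mFourier (-ξ) x)]
  have h1 : ∫ x, mFourier ξ x ∂ν = (starRingEnd ℂ) (fourierCoeff ν ξ) := by
    rw [← fourierCoeff_neg, fourierCoeff, neg_neg]
  rw [h1]
  change (starRingEnd ℂ) (fourierCoeff ν ξ) * fourierCoeff ν ξ = _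
  rw [mul_comm, Complex.mul_conj, Complex.normSq_eq_norm_sq]

/-- The frequencies of maximum norm at most `n`. -/
def freqBox (d n : ℕ) : Finset (Fin d → ℤ) := Fintype.piFinset fun _ => Finset.Icc (-n : ℤ) n

lemma mem_freqBox {d n : ℕ} {ξ : Fin d → ℤ} : ξ ∈ freqBox d n ↔ ‖ξ‖ ≤ n := by
  rw [pi_norm_le_iff_of_nonneg (by positivity), freqBox, Fintype.mem_piFinset]
  refine forall_congr' fun i => ?_
  rw [Finset.mem_Icc, ← abs_le, Int.norm_eq_abs]
  exact_mod_cast Iff.rfl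

lemma card_freqBox (d n : ℕ) : (freqBox d n).card = (2 * n + 1) ^ d := by
  simp only [freqBox, Fintype.card_piFinset, Int.card_Icc, Finset.prod_const, Finset.card_univ,
    Fintype.card_fin]
  congr 1
  omega

/-- A measure gives little mass to pairs of nearby points when its Fourier coefficients are
square-summably small. -/
lemma prod_measure_near_diagonal_le {d : ℕ} (ν : Measure (Torus d)) [IsFiniteMeasure ν]
    {n : ℕ} (hn : 1 ≤ n) {r : ℝ} (hr : 16 * d * n * r ≤ 1) :
    (ν.prod ν).real {p | dist p.1 p.2 ≤ r} * n ^ d ≤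
      4 * ∑ ξ ∈ freqBox d n, ‖fourierCoeff ν ξ‖ ^ 2 := by
  -- The kernel is |S|^2 for the exponential sum S over B. It is nonnegative, of size n^(2d) near
  -- the diagonal, and its frequencies are the differences of B. Those lie in the box of radius n,
  -- each with multiplicity at most n^d.
  set B : Finset (Fin d → ℤ) := Fintype.piFinset fun _ => Finset.Ico (0 : ℤ) n with hB
  have hcard : (B.card : ℝ) = n ^ d := by simp [hB, Fintype.card_piFinset]
  have hBn : ∀ l ∈ B, ‖l‖ ≤ n := by
    intro l hl
    refine (pi_norm_le_iff_of_nonneg (by positivity)).2 fun i => ?_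
    have := Finset.mem_Ico.1 (Fintype.mem_piFinset.1 hl i)
    rw [Int.norm_eq_abs, abs_of_nonneg (by exact_mod_cast this.1)]
    exact_mod_cast this.2.le
  set S : Torus d × Torus d → ℂ := fun p => ∑ l ∈ B, mFourier l (p.1 - p.2) with hS
  have hn0 : (0 : ℝ) < n := by exact_mod_cast hn
  have hnd : (0 : ℝ) < (n : ℝ) ^ d := by positivity
  -- Since π < 4, each character is within 8dnr ≤ 1/2 of 1 at such points, so no cancellation occurs
  -- in S.
  have hlow : ∀ p : Torus d × Torus d, dist p.1 p.2 ≤ r → (n : ℝ) ^ d / 2 ≤ ‖S p‖ := by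
    intro p hp
    have h1 : ‖S p - (n : ℂ) ^ d‖ ≤ (n : ℝ) ^ d / 2 := by
      have : S p - (n : ℂ) ^ d = ∑ l ∈ B, (mFourier l (p.1 - p.2) - 1) := by
        rw [Finset.sum_sub_distrib, Finset.sum_const, nsmul_eq_mul, mul_one]
        congr 1
        exact_mod_cast hcard.symm
      rw [this]
      refine (norm_sum_le _ _).trans ?_
      rw [← hcard, div_eq_mul_inv, ← nsmul_eq_mul]
      refine Finset.sum_le_card_nsmul _ _ _ fun l hl => ?_
      refine (norm_mFourier_sub_one_le l _).trans ?_
      rw [dist_eq_norm] at hp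
      have hpi := Real.pi_lt_four
      have h16 : 2 * Real.pi * d * ‖l‖ * ‖p.1 - p.2‖ ≤ 2 * 4 * d * n * r := by
        gcongr
        · exact hBn l hl
      linarith
    have h2 : ‖(n : ℂ) ^ d‖ = (n : ℝ) ^ d := by simp
    have h3 := norm_sub_norm_le ((n : ℂ) ^ d) (S p)
    rw [norm_sub_rev, h2] at h3
    linarith
  have hScont : Continuous S := continuous_finsetSum _ fun l _ =>
    (mFourier l).continuous.comp (continuous_fst.sub continuous_snd)
  have hSint : ∫ p, (‖S p‖ ^ 2 : ℝ) ∂(ν.prod ν) =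
      ∑ l ∈ B, ∑ l' ∈ B, ‖fourierCoeff ν (l - l')‖ ^ 2 := by
    have h1 : ∀ p, ((‖S p‖ ^ 2 : ℝ) : ℂ) = ∑ l ∈ B, ∑ l' ∈ B, mFourier (l - l') (p.1 - p.2) := by
      intro p
      rw [← Complex.normSq_eq_norm_sq, ← Complex.mul_conj, hS]
      simp only [map_sum, Finset.sum_mul_sum, ← mFourier_neg, ← mFourier_add, sub_eq_add_neg]
    have h2 : ((∫ p, (‖S p‖ ^ 2 : ℝ) ∂(ν.prod ν) : ℝ) : ℂ) =
        ((∑ l ∈ B, ∑ l' ∈ B, ‖fourierCoeff ν (l - l')‖ ^ 2 : ℝ) : ℂ) := by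
      have hInt : ∀ η : Fin d → ℤ,
          Integrable (fun p : Torus d × Torus d => mFourier η (p.1 - p.2)) (ν.prod ν) := fun η =>
        (integrable_const (1 : ℝ)).mono'
          ((mFourier η).continuous.comp (continuous_fst.sub continuous_snd)).aestronglyMeasurable
          (Eventually.of_forall fun x => by simp)
      rw [← integral_complex_ofReal]
      simp_rw [h1]
      rw [integral_finsetSum _ fun l _ => integrable_finsetSum _ fun l' _ => hInt _]
      push_cast
      refine Finset.sum_congr rfl fun l _ => ?_
      rw [integral_finsetSum _ fun l' _ => hInt _]
      refine Finset.sum_congr rfl fun l' _ => ?_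
      rw [integral_prod_mFourier_sub]
      push_cast; rfl
    exact_mod_cast h2
  have hup : ∑ l ∈ B, ∑ l' ∈ B, ‖fourierCoeff ν (l - l')‖ ^ 2 ≤
      n ^ d * ∑ ξ ∈ freqBox d n, ‖fourierCoeff ν ξ‖ ^ 2 := by
    rw [← hcard, ← nsmul_eq_mul]
    refine Finset.sum_le_card_nsmul _ _ _ fun l hl => ?_
    have hinj : Set.InjOn (fun l' => l - l') (B : Set (Fin d → ℤ)) := fun a _ b _ h => by
      simpa using h
    rw [← Finset.sum_image (f := fun ξ => ‖fourierCoeff ν ξ‖ ^ 2) hinj]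
    refine Finset.sum_le_sum_of_subset_of_nonneg ?_ fun _ _ _ => by positivity
    intro ξ hξ
    obtain ⟨l', hl', rfl⟩ := Finset.mem_image.1 hξ
    rw [freqBox, Fintype.mem_piFinset]
    intro i
    have h1 := Finset.mem_Ico.1 (Fintype.mem_piFinset.1 hl i)
    have h2 := Finset.mem_Ico.1 (Fintype.mem_piFinset.1 hl' i)
    rw [Finset.mem_Icc, Pi.sub_apply]
    omega
  have hD : MeasurableSet {p : Torus d × Torus d | dist p.1 p.2 ≤ r} :=
    (isClosed_le continuous_dist continuous_const).measurableSet
  have hmk : (ν.prod ν).real {p | dist p.1 p.2 ≤ r} * ((n : ℝ) ^ d / 2) ^ 2 ≤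
      ∫ p, (‖S p‖ ^ 2 : ℝ) ∂(ν.prod ν) := by
    have hSi : Integrable (fun p => (‖S p‖ ^ 2 : ℝ)) (ν.prod ν) :=
      (hScont.norm.pow 2).integrable_of_hasCompactSupport (HasCompactSupport.of_compactSpace _)
    calc _ = ∫ p in {p : Torus d × Torus d | dist p.1 p.2 ≤ r}, ((n : ℝ) ^ d / 2) ^ 2
          ∂(ν.prod ν) := by simp [mul_comm]
      _ ≤ ∫ p in {p : Torus d × Torus d | dist p.1 p.2 ≤ r}, (‖S p‖ ^ 2 : ℝ) ∂(ν.prod ν) := by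
        refine setIntegral_mono_on (integrableOn_const (by finiteness)) hSi.integrableOn hD fun p hp => ?_
        exact pow_le_pow_left₀ (by positivity) (hlow p hp) 2
      _ ≤ _ := setIntegral_le_integral hSi (Eventually.of_forall fun p => by positivity)
  rw [hSint] at hmk
  have h := hmk.trans hup
  have h' : n ^ d * ((ν.prod ν).real {p | dist p.1 p.2 ≤ r} * n ^ d) ≤
      n ^ d * (4 * ∑ ξ ∈ freqBox d n, ‖fourierCoeff ν ξ‖ ^ 2) := by nlinarith
  exact le_of_mul_le_mul_left h' hnd

/-- Each step adds a dyadic shell of at most 5^d 2^(kd) frequencies, which contribute at most C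
2^(-ks) each. The factor k + 1 counts the shells and keeps the bound valid up to s = d. It is
harmless later, because only exponents t < s are claimed. -/
lemma sum_freqBox_sq_le {d : ℕ} {ν : Measure (Torus d)} [IsProbabilityMeasure ν] {s C : ℝ}
    (hs0 : 0 ≤ s) (hsd : s ≤ d)
    (hC : ∀ ξ : Fin d → ℤ, ξ ≠ 0 → ‖fourierCoeff ν ξ‖ ^ 2 ≤ C * ‖ξ‖ ^ (-s)) (hC0 : 0 ≤ C) (k : ℕ) :
    ∑ ξ ∈ freqBox d (2 ^ k), ‖fourierCoeff ν ξ‖ ^ 2 ≤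
      5 ^ d * (1 + C) * (k + 1) * ((2 : ℝ) ^ (d - s)) ^ k := by
  induction k with
  | zero =>
    have h1 : ∑ ξ ∈ freqBox d (2 ^ 0), ‖fourierCoeff ν ξ‖ ^ 2 ≤ (freqBox d (2 ^ 0)).card • (1 : ℝ) := by
      refine Finset.sum_le_card_nsmul _ _ _ fun ξ _ => ?_
      have := norm_fourierCoeff_le ν ξ
      rw [probReal_univ] at this
      exact pow_le_one₀ (norm_nonneg _) this
    refine h1.trans ?_
    rw [card_freqBox]
    simp only [pow_zero, mul_one, nsmul_eq_mul, Nat.cast_pow, CharP.cast_eq_zero, zero_add]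
    push_cast
    calc (3 : ℝ) ^ d ≤ 5 ^ d := by gcongr; norm_num
      _ ≤ 5 ^ d * (1 + C) := le_mul_of_one_le_right (by positivity) (by linarith)
  | succ k ih =>
    have hA : (1 : ℝ) ≤ (2 : ℝ) ^ (d - s) := Real.one_le_rpow (by norm_num) (by linarith)
    classical
    have hsplit : ∑ ξ ∈ freqBox d (2 ^ (k + 1)), ‖fourierCoeff ν ξ‖ ^ 2 ≤
        ∑ ξ ∈ freqBox d (2 ^ k), ‖fourierCoeff ν ξ‖ ^ 2 +
        ∑ ξ ∈ freqBox d (2 ^ (k + 1)), C * ((2 : ℝ) ^ k) ^ (-s) := by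
      rw [← Finset.sum_filter_add_sum_filter_not (freqBox d (2 ^ (k + 1)))
        (fun ξ => ξ ∈ freqBox d (2 ^ k)) fun ξ => ‖fourierCoeff ν ξ‖ ^ 2]
      gcongr ?_ + ?_
      · exact Finset.sum_le_sum_of_subset_of_nonneg
          (fun ξ hξ => (Finset.mem_filter.1 hξ).2) fun _ _ _ => by positivity
      · refine (Finset.sum_le_sum (g := fun _ => C * ((2 : ℝ) ^ k) ^ (-s)) fun ξ hξ => ?_).trans
          (Finset.sum_le_sum_of_subset_of_nonneg (Finset.filter_subset _ _)
            fun _ _ _ => by positivity)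
        have h2 := (Finset.mem_filter.1 hξ).2
        rw [mem_freqBox, not_le] at h2
        push_cast at h2
        have hne : ξ ≠ 0 := by
          rintro rfl
          rw [norm_zero] at h2
          exact absurd h2 (not_lt.2 (by positivity))
        refine (hC ξ hne).trans ?_
        gcongr 1
        exact Real.rpow_le_rpow_of_nonpos (by positivity) h2.le (by linarith)
    refine hsplit.trans ?_
    rw [Finset.sum_const, card_freqBox, nsmul_eq_mul]
    have hcard : (((2 * 2 ^ (k + 1) + 1) ^ d : ℕ) : ℝ) ≤ 5 ^ d * ((2 : ℝ) ^ k) ^ d := by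
      rw [← mul_pow]; push_cast
      gcongr
      have : (1 : ℝ) ≤ 2 ^ k := one_le_pow₀ (by norm_num)
      rw [pow_succ]; linarith
    have hpow : ((2 : ℝ) ^ k) ^ d * ((2 : ℝ) ^ k) ^ (-s) = ((2 : ℝ) ^ (d - s)) ^ k := by
      have h2k : (0 : ℝ) < 2 ^ k := by positivity
      rw [← Real.rpow_natCast (_ ^ k) d, ← Real.rpow_add h2k, ← sub_eq_add_neg,
        ← Real.rpow_natCast 2 k, ← Real.rpow_natCast _ k, ← Real.rpow_mul (by norm_num),
        ← Real.rpow_mul (by norm_num), mul_comm]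
    calc _ ≤ 5 ^ d * (1 + C) * (k + 1) * ((2 : ℝ) ^ (d - s)) ^ k +
          5 ^ d * ((2 : ℝ) ^ k) ^ d * (C * ((2 : ℝ) ^ k) ^ (-s)) := by gcongr
      _ = 5 ^ d * (1 + C) * (k + 1) * ((2 : ℝ) ^ (d - s)) ^ k +
          5 ^ d * C * ((2 : ℝ) ^ (d - s)) ^ k := by rw [← hpow]; ring
      _ ≤ 5 ^ d * (1 + C) * (k + 1) * ((2 : ℝ) ^ (d - s)) ^ k +
          5 ^ d * (1 + C) * ((2 : ℝ) ^ (d - s)) ^ k := by gcongr; linarith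
      _ = 5 ^ d * (1 + C) * ((k + 1 : ℕ) + 1) * ((2 : ℝ) ^ (d - s)) ^ k := by push_cast; ring
      _ ≤ _ := by
        gcongr
        omega

end SalemAvoid

end

open Set Filter Topology MeasureTheory
open scoped ENNReal ContDiff

noncomputable section

namespace SalemAvoid

open UnitAddTorus

/-! ### Mass distribution and the comparison of the two dimensions -/

lemma exists_fourierCoeff_sq_le {d : ℕ} {ν : Measure (Torus d)} [IsProbabilityMeasure ν] {s : ℝ}
    (hs0 : 0 ≤ s) (h : HasFourierDecay s ν) :
    ∃ C, 0 ≤ C ∧ ∀ ξ : Fin d → ℤ, ξ ≠ 0 → ‖fourierCoeff ν ξ‖ ^ 2 ≤ C * ‖ξ‖ ^ (-s) := by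
  obtain ⟨K, hK⟩ := h
  refine ⟨K ^ 2, sq_nonneg K, fun ξ hξ => ?_⟩
  have h1 : ‖weightedCoeff s ν ξ‖ ≤ K := hK ⟨ξ, rfl⟩
  have hf := one_le_norm hξ
  have hpos : 0 < ‖ξ‖ := by linarith
  rw [weightedCoeff, norm_mul, Complex.norm_real, Real.norm_eq_abs,
    abs_of_nonneg (Real.rpow_nonneg (freqNorm_nonneg ξ) _)] at h1
  have h2 : ‖ξ‖ ^ (s / 2) * ‖fourierCoeff ν ξ‖ ≤ K := by
    refine le_trans ?_ h1
    gcongr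
    exact norm_le_freqNorm ξ
  have h3 : (‖ξ‖ ^ (s / 2) * ‖fourierCoeff ν ξ‖) ^ 2 ≤ K ^ 2 := by gcongr
  rw [mul_pow, ← Real.rpow_natCast (‖ξ‖ ^ (s / 2)), ← Real.rpow_mul hpos.le] at h3
  rw [Real.rpow_neg hpos.le, ← div_eq_mul_inv, le_div_iff₀ (Real.rpow_pos_of_pos hpos _), mul_comm]
  simpa using h3

/-- A mass distribution principle for measures with Fourier decay. -/
lemma hausdorffMeasure_support_ne_zero {d : ℕ} (hd : 1 ≤ d) {ν : Measure (Torus d)}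
    [IsProbabilityMeasure ν] {s : ℝ} (hsd : s ≤ d) (h : HasFourierDecay s ν) {t : ℝ} (ht : 0 < t)
    (hts : t < s) : μH[t] ν.support ≠ 0 := by
  have hs0 : 0 ≤ s := by linarith
  obtain ⟨C, hC0, hC⟩ := exists_fourierCoeff_sq_le hs0 h
  have hd0 : (0 : ℝ) < d := by exact_mod_cast hd
  set r : ℕ → ℝ := fun k => (16 * d * 2 ^ k)⁻¹ with hr
  have hrpos : ∀ k, 0 < r k := fun k => by positivity
  set K : ℝ := 4 * (5 ^ d * (1 + C)) with hK
  have hpair : ∀ k : ℕ, (ν.prod ν).real {p | dist p.1 p.2 ≤ r k} ≤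
      K * (k + 1) * ((2 : ℝ) ^ (-s)) ^ k := by
    intro k
    have h1 := prod_measure_near_diagonal_le ν (n := 2 ^ k) Nat.one_le_two_pow (r := r k)
      (by push_cast; exact (mul_inv_cancel₀ (by positivity)).le)
    have h2 := sum_freqBox_sq_le hs0 hsd hC hC0 k
    have h3 : (0 : ℝ) < ((2 ^ k : ℕ) : ℝ) ^ d := by positivity
    rw [← mul_le_mul_iff_left₀ h3]
    refine (h1.trans (mul_le_mul_of_nonneg_left h2 (by norm_num))).trans (le_of_eq ?_)
    have h4 : ((2 : ℝ) ^ (d - s)) ^ k = ((2 : ℝ) ^ (-s)) ^ k * ((2 ^ k : ℕ) : ℝ) ^ d := by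
      push_cast
      rw [← pow_mul, mul_comm k d, pow_mul, ← mul_pow, ← Real.rpow_natCast 2 d,
        ← Real.rpow_add (by norm_num)]
      ring_nf
    rw [h4, hK]; ring
  -- A dyadic substitute for the t-potential of ν. By the bound on pairs its integral is at most a
  -- constant times the sum of (k + 1) 2^((t-s)k), finite because t < s. A bound on g(x) gives a
  -- Frostman bound for all balls around x.
  set g : Torus d → ℝ≥0∞ := fun x =>
    ∑' k : ℕ, ENNReal.ofReal (((2 : ℝ) ^ t) ^ k) * ν (Metric.closedBall x (r k)) with hg
  have hmeas : ∀ k, Measurable fun x => ν (Metric.closedBall x (r k)) := by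
    intro k
    have hD : MeasurableSet {p : Torus d × Torus d | dist p.1 p.2 ≤ r k} :=
      (isClosed_le continuous_dist continuous_const).measurableSet
    have := measurable_measure_prodMk_left (ν := ν) hD
    convert this using 3 with x
    ext y; simp [dist_comm]
  have hgm : Measurable g := Measurable.tsum fun k => (hmeas k).const_mul _
  have hgint : ∫⁻ x, g x ∂ν ≠ ⊤ := by
    rw [hg, lintegral_tsum fun k => ((hmeas k).const_mul _).aemeasurable]
    have hk : ∀ k : ℕ, ∫⁻ x, ENNReal.ofReal (((2 : ℝ) ^ t) ^ k) * ν (Metric.closedBall x (r k)) ∂ν ≤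
        ENNReal.ofReal (K * ((k + 1) * ((2 : ℝ) ^ (t - s)) ^ k)) := by
      intro k
      rw [lintegral_const_mul _ (hmeas k)]
      have hD : MeasurableSet {p : Torus d × Torus d | dist p.1 p.2 ≤ r k} :=
        (isClosed_le continuous_dist continuous_const).measurableSet
      have h1 : ∫⁻ x, ν (Metric.closedBall x (r k)) ∂ν = (ν.prod ν) {p | dist p.1 p.2 ≤ r k} := by
        rw [Measure.prod_apply hD]
        refine lintegral_congr fun x => ?_
        congr 1; ext y; simp [dist_comm]
      rw [h1, ← ofReal_measureReal, ← ENNReal.ofReal_mul (by positivity)]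
      refine ENNReal.ofReal_le_ofReal ?_
      refine (mul_le_mul_of_nonneg_left (hpair k) (by positivity)).trans (le_of_eq ?_)
      have : ((2 : ℝ) ^ (t - s)) ^ k = ((2 : ℝ) ^ t) ^ k * ((2 : ℝ) ^ (-s)) ^ k := by
        rw [← mul_pow, ← Real.rpow_add (by norm_num), sub_eq_add_neg]
      rw [this]; ring
    have hsum : Summable fun k : ℕ => K * (((k : ℝ) + 1) * ((2 : ℝ) ^ (t - s)) ^ k) := by
      refine Summable.mul_left _ ?_
      have hlt : ‖(2 : ℝ) ^ (t - s)‖ < 1 := by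
        rw [Real.norm_eq_abs, abs_of_pos (by positivity)]
        exact Real.rpow_lt_one_of_one_lt_of_neg (by norm_num) (by linarith)
      have h1 := summable_pow_mul_geometric_of_norm_lt_one 1 hlt
      have h2 := summable_pow_mul_geometric_of_norm_lt_one 0 hlt
      simpa [add_mul] using h1.add h2
    refine ne_top_of_le_ne_top ?_ (ENNReal.tsum_le_tsum hk)
    rw [← ENNReal.ofReal_tsum_of_nonneg (fun k => by positivity) hsum]
    exact ENNReal.ofReal_ne_top
  have hfin : ∀ᵐ x ∂ν, g x < ⊤ := ae_lt_top hgm hgint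
  obtain ⟨M, hM⟩ : ∃ M : ℕ, ν {x | g x ≤ M} ≠ 0 := by
    by_contra! hcon
    have h0 : ν (⋃ M : ℕ, {x | g x ≤ M}) = 0 := measure_iUnion_null hcon
    have : ∀ᵐ x ∂ν, x ∉ ⋃ M : ℕ, {x | g x ≤ M} := measure_eq_zero_iff_ae_notMem.1 h0
    obtain ⟨x, hx1, hx2⟩ := (hfin.and this).exists
    obtain ⟨M, hM⟩ := ENNReal.exists_nat_gt hx1.ne
    exact hx2 (mem_iUnion.2 ⟨M, hM.le⟩)
  set A := {x | g x ≤ M} with hA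
  have hAm : MeasurableSet A := measurableSet_le hgm measurable_const
  have hball : ∀ x ∈ A, ∀ k, ν (Metric.closedBall x (r k)) ≤
      M * ENNReal.ofReal (((2 : ℝ) ^ (-t)) ^ k) := by
    intro x hx k
    have h1 : ENNReal.ofReal (((2 : ℝ) ^ t) ^ k) * ν (Metric.closedBall x (r k)) ≤ M :=
      (ENNReal.le_tsum k).trans hx
    have h2 : ENNReal.ofReal (((2 : ℝ) ^ (-t)) ^ k) * ENNReal.ofReal (((2 : ℝ) ^ t) ^ k) = 1 := by
      rw [← ENNReal.ofReal_mul (by positivity), ← mul_pow, ← Real.rpow_add (by norm_num)]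
      simp
    calc ν (Metric.closedBall x (r k)) = ENNReal.ofReal (((2 : ℝ) ^ (-t)) ^ k) *
          (ENNReal.ofReal (((2 : ℝ) ^ t) ^ k) * ν (Metric.closedBall x (r k))) := by
            rw [← mul_assoc, h2, one_mul]
      _ ≤ ENNReal.ofReal (((2 : ℝ) ^ (-t)) ^ k) * M := by gcongr
      _ = _ := mul_comm _ _
  -- A set of diameter in (r (k+1), r k] has restricted mass at most M 2^(-tk), and 2^(-k) = 32 d r
  -- (k+1). Using M + 1 keeps the constant nonzero when M = 0.
  set c : ℝ≥0∞ := (M + 1) * ENNReal.ofReal ((32 * d) ^ t) with hc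
  have hc0 : c ≠ 0 := by
    refine mul_ne_zero (by positivity) ?_
    rw [Ne, ENNReal.ofReal_eq_zero, not_le]; positivity
  have hct : c ≠ ⊤ := by finiteness
  have hle : c⁻¹ • ν.restrict A ≤ μH[t] := by
    refine Measure.le_hausdorffMeasure t _ (ENNReal.ofReal (r 0))
      (ENNReal.ofReal_pos.2 (hrpos 0)) fun S hS => ?_
    rw [Measure.smul_apply, smul_eq_mul, Measure.restrict_apply' hAm]
    rw [mul_comm, ← div_eq_mul_inv]
    refine ENNReal.div_le_of_le_mul ?_
    rcases (S ∩ A).eq_empty_or_nonempty with hemp | ⟨x, hxS, hxA⟩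
    · rw [hemp, measure_empty]; exact zero_le
    have hdiam : Metric.ediam S ≠ ⊤ := ne_top_of_le_ne_top ENNReal.ofReal_ne_top hS
    set δ := (Metric.ediam S).toReal with hδ
    have hSd : Metric.ediam S = ENNReal.ofReal δ := (ENNReal.ofReal_toReal hdiam).symm
    have hδr : δ ≤ r 0 := by
      rw [hSd] at hS
      exact (ENNReal.ofReal_le_ofReal_iff (hrpos 0).le).1 hS
    have hsub : ∀ k, δ ≤ r k → ν (S ∩ A) ≤ M * ENNReal.ofReal (((2 : ℝ) ^ (-t)) ^ k) := by
      intro k hk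
      refine (measure_mono ?_).trans (hball x hxA k)
      rintro y ⟨hy, -⟩
      rw [Metric.mem_closedBall]
      refine le_trans ?_ hk
      have := Metric.edist_le_ediam_of_mem hy hxS
      rw [hSd, edist_dist] at this
      exact (ENNReal.ofReal_le_ofReal_iff ENNReal.toReal_nonneg).1 this
    -- Diameter zero fits below every scale, so the Frostman bound tends to 0. Otherwise the first
    -- scale below the diameter is used.
    rcases (ENNReal.toReal_nonneg : 0 ≤ δ).eq_or_lt with h0 | hpos
    · have hz : ν (S ∩ A) ≤ 0 := by
        have hlim : Tendsto (fun k : ℕ => (M : ℝ≥0∞) * ENNReal.ofReal (((2 : ℝ) ^ (-t)) ^ k))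
            atTop (𝓝 (M * ENNReal.ofReal 0)) := by
          refine ENNReal.Tendsto.const_mul (ENNReal.tendsto_ofReal ?_) (Or.inr (by finiteness))
          exact tendsto_pow_atTop_nhds_zero_of_lt_one (by positivity)
            (Real.rpow_lt_one_of_one_lt_of_neg (by norm_num) (by linarith))
        simp only [ENNReal.ofReal_zero, mul_zero] at hlim
        exact ge_of_tendsto' hlim fun k => hsub k (by rw [hδ, ← h0]; exact (hrpos k).le)
      exact hz.trans zero_le
    · have hex : ∃ k, r k < δ := by
        obtain ⟨k, hk⟩ := exists_pow_lt_of_lt_one hpos (by norm_num : (1 / 2 : ℝ) < 1)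
        refine ⟨k, lt_of_le_of_lt ?_ hk⟩
        rw [hr, one_div, inv_pow]
        refine inv_anti₀ (by positivity) (le_mul_of_one_le_left (by positivity) ?_)
        have : (1 : ℝ) ≤ d := by exact_mod_cast hd
        linarith
      classical
      obtain ⟨k, hk⟩ : ∃ k, Nat.find hex = k + 1 := by
        refine Nat.exists_eq_succ_of_ne_zero fun h0 => ?_
        have := Nat.find_spec hex
        rw [h0] at this
        linarith
      have h1 : δ ≤ r k := not_lt.1 (Nat.find_min hex (by omega))
      have h2 : r (k + 1) < δ := hk ▸ Nat.find_spec hex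
      refine (hsub k h1).trans ?_
      rw [hSd, hc, ENNReal.ofReal_rpow_of_pos hpos]
      rw [mul_comm (ENNReal.ofReal (δ ^ t)), mul_assoc, ← ENNReal.ofReal_mul (by positivity)]
      gcongr
      · exact le_self_add
      · have h3 : ((2 : ℝ) ^ (-t)) ^ k = (32 * d) ^ t * (r (k + 1)) ^ t := by
          rw [← Real.mul_rpow (by positivity) (hrpos _).le, hr]
          have : 32 * (d : ℝ) * (16 * (d : ℝ) * 2 ^ (k + 1))⁻¹ = ((2 : ℝ) ^ k)⁻¹ := by
            rw [pow_succ]; field_simp; norm_num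
          rw [this, ← Real.rpow_natCast, ← Real.rpow_mul (by norm_num), Real.inv_rpow (by positivity),
            ← Real.rpow_natCast, ← Real.rpow_mul (by norm_num), ← Real.rpow_neg (by norm_num)]
          ring_nf
        rw [h3]
        gcongr
  intro h0
  have h1 : (c⁻¹ • ν.restrict A) ν.support = 0 := le_antisymm ((hle _).trans h0.le) zero_le
  rw [Measure.smul_apply, smul_eq_mul, mul_eq_zero, ENNReal.inv_eq_zero] at h1
  have h2 := h1.resolve_left hct
  rw [Measure.restrict_apply' hAm] at h2
  refine hM (le_antisymm ?_ zero_le)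
  calc ν A ≤ ν (ν.support ∩ A ∪ ν.supportᶜ) := measure_mono fun x hx => by
        by_cases h : x ∈ ν.support
        · exact Or.inl ⟨h, hx⟩
        · exact Or.inr h
    _ ≤ ν (ν.support ∩ A) + ν ν.supportᶜ := measure_union_le _ _
    _ = 0 := by rw [h2, Measure.measure_compl_support, add_zero]

lemma dimH_le_hausdorffDim {d : ℕ} (E : Set (Torus d)) : dimH E ≤ hausdorffDim E := by
  have h : E = (WithLp.ofLp : PiLp 2 (fun _ : Fin d => UnitAddCircle) → Torus d) ''
      ((WithLp.ofLp : PiLp 2 (fun _ : Fin d => UnitAddCircle) → Torus d) ⁻¹' E) := by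
    rw [image_preimage_eq]
    exact fun x => ⟨WithLp.toLp 2 x, rfl⟩
  conv_lhs => rw [h]
  exact (PiLp.lipschitzWith_ofLp 2 _).dimH_image_le _

lemma hausdorffDim_le_dimH {d : ℕ} (E : Set (Torus d)) : hausdorffDim E ≤ dimH E :=
  (PiLp.antilipschitzWith_ofLp 2 fun _ : Fin d => UnitAddCircle).dimH_preimage_le E

/-- The Euclidean and maximum metrics are bi-Lipschitz equivalent, so the rest of the proof can work
with the maximum metric. -/
lemma hausdorffDim_eq_dimH {d : ℕ} (E : Set (Torus d)) : hausdorffDim E = dimH E :=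
  le_antisymm (hausdorffDim_le_dimH E) (dimH_le_hausdorffDim E)

theorem fourierDim_le_hausdorffDim {d : ℕ} (hd : 1 ≤ d) (E : Set (Torus d)) :
    fourierDim E ≤ hausdorffDim E := by
  rw [hausdorffDim_eq_dimH]
  refine iSup₂_le fun ν hν => iSup₂_le fun s hs => ?_
  refine le_of_forall_lt fun c hc => ?_
  obtain ⟨t, hct, hts⟩ := ENNReal.lt_iff_exists_nnreal_btwn.1 hc
  refine hct.trans_le (le_trans ?_ (dimH_mono hν))
  have ht0 : (0 : ℝ) < t := by
    have := (zero_le).trans_lt hct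
    exact_mod_cast this
  have hts' : (t : ℝ) < s := by
    rw [ENNReal.lt_ofReal_iff_toReal_lt (by simp)] at hts
    simpa using hts
  exact le_dimH_of_hausdorffMeasure_ne_zero
    (hausdorffMeasure_support_ne_zero hd hs.1.2 hs.2 ht0 hts')

end SalemAvoid

end

open Set Filter Topology MeasureTheory
open scoped ENNReal ContDiff

noncomputable section

namespace SalemAvoid

open UnitAddTorus TopologicalSpace
open scoped Uniformity

/-! ### The space of pairs is a Baire space -/

lemma weightedCoeff_sub {d : ℕ} (s : ℝ) (μ ν : Measure (Torus d)) (ξ : Fin d → ℤ) :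
    ‖weightedCoeff s μ ξ - weightedCoeff s ν ξ‖ =
      freqNorm ξ ^ (s / 2) * ‖fourierCoeff μ ξ - fourierCoeff ν ξ‖ := by
  rw [weightedCoeff, weightedCoeff, ← mul_sub, norm_mul, Complex.norm_real, Real.norm_eq_abs,
    abs_of_nonneg (Real.rpow_nonneg (freqNorm_nonneg ξ) _)]

lemma norm_weightedCoeff {d : ℕ} (s : ℝ) (μ : Measure (Torus d)) (ξ : Fin d → ℤ) :
    ‖weightedCoeff s μ ξ‖ = freqNorm ξ ^ (s / 2) * ‖fourierCoeff μ ξ‖ := by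
  rw [weightedCoeff, norm_mul, Complex.norm_real, Real.norm_eq_abs,
    abs_of_nonneg (Real.rpow_nonneg (freqNorm_nonneg ξ) _)]

lemma freqNorm_zero {d : ℕ} : freqNorm (0 : Fin d → ℤ) = 0 := by simp [freqNorm]

/-- Nonzero frequencies have norm at least 1. Positivity of s matters at ξ = 0, where the weight is
0^0 = 1 for s = 0 and vanishes for s > 0. -/
lemma freqNorm_rpow_mono {d : ℕ} {s s' : ℝ} (hs : 0 < s) (hss : s ≤ s') (ξ : Fin d → ℤ) :
    freqNorm ξ ^ (s / 2) ≤ freqNorm ξ ^ (s' / 2) := by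
  rcases eq_or_ne ξ 0 with rfl | h
  · rw [freqNorm_zero, Real.zero_rpow (by positivity)]
    exact Real.rpow_nonneg le_rfl _
  · exact Real.rpow_le_rpow_of_exponent_le ((one_le_norm h).trans (norm_le_freqNorm ξ))
      (by linarith)

lemma tendsto_decayMeasure_iff {d : ℕ} {β : ℝ} {ι : Type*} {l : Filter ι}
    {u : ι → DecayMeasure d β} {μ : DecayMeasure d β} :
    Tendsto u l (𝓝 μ) ↔ ∀ s ∈ Ico (0 : ℝ) β, ∀ ε > 0, ∀ᶠ i in l, ∀ ξ,
      ‖weightedCoeff s μ.toMeasure ξ - weightedCoeff s (u i).toMeasure ξ‖ < ε := by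
  rw [nhds_iInf, tendsto_iInf, Subtype.forall]
  refine forall₂_congr fun s hs => ?_
  rw [nhds_induced, tendsto_comap_iff, UniformFun.tendsto_iff_tendstoUniformly,
    Metric.tendstoUniformly_iff]
  simp only [dist_eq_norm]
  rfl

lemma tendsto_pairSpace_iff {d : ℕ} {β : ℝ} {ι : Type*} {l : Filter ι}
    {u : ι → PairSpace d β} {p : PairSpace d β} :
    Tendsto u l (𝓝 p) ↔ Tendsto (fun i => (u i).1.1) l (𝓝 p.1.1) ∧
      ∀ s ∈ Ico (0 : ℝ) β, ∀ ε > 0, ∀ᶠ i in l, ∀ ξ,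
      ‖weightedCoeff s p.1.2.toMeasure ξ - weightedCoeff s (u i).1.2.toMeasure ξ‖ < ε := by
  obtain ⟨⟨E, μ⟩, hp⟩ := p
  rw [tendsto_subtype_rng, nhds_prod_eq, tendsto_prod_iff', tendsto_decayMeasure_iff]

/-- An increasing sequence of exponents starting at `0` and converging to `β`. -/
def expSeq (β : ℝ) (j : ℕ) : ℝ := β * (1 - 1 / (j + 1))

lemma expSeq_mem {β : ℝ} (hβ : 0 < β) (j : ℕ) : expSeq β j ∈ Ico (0 : ℝ) β := by
  have h1 : (0 : ℝ) < 1 / (j + 1) := by positivity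
  have h2 : 1 / ((j : ℝ) + 1) ≤ 1 := by
    rw [div_le_one (by positivity)]; linarith [(Nat.cast_nonneg j : (0 : ℝ) ≤ j)]
  constructor
  · exact mul_nonneg hβ.le (by linarith)
  · rw [expSeq]; nlinarith

lemma exists_le_expSeq {β s : ℝ} (hs : s < β) : ∀ᶠ j in atTop, s ≤ expSeq β j := by
  have h : Tendsto (expSeq β) atTop (𝓝 (β * (1 - 0))) :=
    (tendsto_const_nhds.sub tendsto_one_div_add_atTop_nhds_zero_nat).const_mul β
  rw [sub_zero, mul_one] at h
  exact h.eventually (eventually_ge_nhds hs)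

/-- The weighted Fourier transforms along the exponents `expSeq β`. -/
def coeffEmbedding (d : ℕ) (β : ℝ) (p : PairSpace d β) :
    NonemptyCompacts (Torus d) × (ℕ → UniformFun (Fin d → ℤ) ℂ) :=
  (p.1.1, fun j => UniformFun.ofFun (weightedCoeff (expSeq β j) p.1.2.toMeasure))

lemma tendsto_coeffEmbedding_iff {d : ℕ} {β : ℝ} {ι : Type*} {l : Filter ι}
    {u : ι → PairSpace d β} {y : NonemptyCompacts (Torus d) × (ℕ → UniformFun (Fin d → ℤ) ℂ)} :
    Tendsto (fun i => coeffEmbedding d β (u i)) l (𝓝 y) ↔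
      Tendsto (fun i => (u i).1.1) l (𝓝 y.1) ∧ ∀ j, ∀ ε > 0, ∀ᶠ i in l, ∀ ξ,
        ‖UniformFun.toFun (y.2 j) ξ - weightedCoeff (expSeq β j) (u i).1.2.toMeasure ξ‖ < ε := by
  obtain ⟨y₁, y₂⟩ := y
  rw [nhds_prod_eq, tendsto_prod_iff']
  refine and_congr Iff.rfl ?_
  rw [tendsto_pi_nhds]
  refine forall_congr' fun j => ?_
  rw [UniformFun.tendsto_iff_tendstoUniformly, Metric.tendstoUniformly_iff]
  simp only [dist_eq_norm]
  rfl

/-- Larger exponents control smaller positive ones, so a sequence increasing to β suffices. The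
exponent 0 is a member of that sequence because it alone sees the frequency 0. -/
lemma isInducing_coeffEmbedding {d : ℕ} {β : ℝ} (hβ : 0 < β) :
    IsInducing (coeffEmbedding d β) := by
  rw [isInducing_iff_nhds]
  intro p
  refine le_antisymm ?_ ?_
  · rw [← tendsto_iff_comap]
    have hid : Tendsto (id : PairSpace d β → _) (𝓝 p) (𝓝 p) := tendsto_id
    rw [tendsto_pairSpace_iff] at hid
    exact tendsto_coeffEmbedding_iff.2 ⟨hid.1, fun j => hid.2 _ (expSeq_mem hβ j)⟩
  · have hc : Tendsto (fun q => coeffEmbedding d β q)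
        (comap (coeffEmbedding d β) (𝓝 (coeffEmbedding d β p))) (𝓝 (coeffEmbedding d β p)) :=
      tendsto_comap
    rw [tendsto_coeffEmbedding_iff] at hc
    suffices h : Tendsto (id : PairSpace d β → _)
        (comap (coeffEmbedding d β) (𝓝 (coeffEmbedding d β p))) (𝓝 p) from h
    rw [tendsto_pairSpace_iff]
    refine ⟨hc.1, fun s hs ε hε => ?_⟩
    rcases hs.1.eq_or_lt with rfl | hs0
    · have h0 : expSeq β 0 = 0 := by simp [expSeq]
      have := hc.2 0 ε hε
      rw [h0] at this
      filter_upwards [this] with q hq ξ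
      have := hq ξ
      simp only [coeffEmbedding, UniformFun.toFun_ofFun, h0] at this
      exact this
    · obtain ⟨j, hj⟩ := (exists_le_expSeq hs.2).exists
      filter_upwards [hc.2 j ε hε] with q hq ξ
      refine lt_of_le_of_lt ?_ (hq ξ)
      simp only [coeffEmbedding, UniformFun.toFun_ofFun, id]
      rw [weightedCoeff_sub, weightedCoeff_sub]
      exact mul_le_mul_of_nonneg_right (freqNorm_rpow_mono hs0 hj ξ) (norm_nonneg _)

lemma HasFourierDecay.mono {d : ℕ} {μ : Measure (Torus d)} {s s' : ℝ}
    (h : HasFourierDecay s' μ) (hs : 0 < s) (hss : s ≤ s') : HasFourierDecay s μ := by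
  obtain ⟨K, hK⟩ := h
  refine ⟨K, ?_⟩
  rintro _ ⟨ξ, rfl⟩
  refine le_trans ?_ (hK ⟨ξ, rfl⟩)
  simp only [norm_weightedCoeff]
  refine mul_le_mul_of_nonneg_right ?_ (norm_nonneg _)
  exact freqNorm_rpow_mono hs hss ξ

lemma hasFourierDecay_zero {d : ℕ} (μ : Measure (Torus d)) [IsFiniteMeasure μ] :
    HasFourierDecay 0 μ := by
  refine ⟨μ.real univ, ?_⟩
  rintro _ ⟨ξ, rfl⟩
  simpa [norm_weightedCoeff] using norm_fourierCoeff_le μ ξ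

/-- Probability measures on the torus are weakly compact, so along an ultrafilter the measures
converge weakly. Characters are continuous, hence coefficients converge pointwise, and the uniform
limits must be the weighted coefficients of the weak limit. -/
lemma isClosed_range_coeffEmbedding {d : ℕ} {β : ℝ} (hβ : 0 < β) :
    IsClosed (range (coeffEmbedding d β)) := by
  refine isClosed_of_closure_subset fun y hy => ?_
  have hne : (comap (coeffEmbedding d β) (𝓝 y)).NeBot := by
    rw [comap_neBot_iff_frequently]
    exact mem_closure_iff_frequently.1 hy
  set 𝓕 : Ultrafilter (PairSpace d β) := Ultrafilter.of (comap (coeffEmbedding d β) (𝓝 y)) with h𝓕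
  have hc : Tendsto (fun q => coeffEmbedding d β q) 𝓕 (𝓝 y) :=
    tendsto_comap.mono_left (Ultrafilter.of_le _)
  rw [tendsto_coeffEmbedding_iff] at hc
  set P : PairSpace d β → ProbabilityMeasure (Torus d) := fun q => ⟨q.1.2.toMeasure, q.2.1⟩ with hP
  obtain ⟨μ, hμ⟩ : ∃ μ, Tendsto P 𝓕 (𝓝 μ) := by
    obtain ⟨μ, -, hμ⟩ := isCompact_univ.ultrafilter_le_nhds (𝓕.map P) (by simp)
    exact ⟨μ, hμ⟩
  have hcoeff : ∀ ξ, Tendsto (fun q : PairSpace d β => fourierCoeff q.1.2.toMeasure ξ) 𝓕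
      (𝓝 (fourierCoeff (μ : Measure (Torus d)) ξ)) := by
    intro ξ
    have := (ProbabilityMeasure.tendsto_iff_forall_integral_rclike_tendsto ℂ).1 hμ
      (BoundedContinuousFunction.mkOfCompact (mFourier (-ξ)))
    simpa [hP, fourierCoeff] using this
  have hlim : ∀ j ξ, UniformFun.toFun (y.2 j) ξ =
      weightedCoeff (expSeq β j) (μ : Measure (Torus d)) ξ := by
    intro j ξ
    have h1 : Tendsto (fun q : PairSpace d β => weightedCoeff (expSeq β j) q.1.2.toMeasure ξ) 𝓕
        (𝓝 (UniformFun.toFun (y.2 j) ξ)) := by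
      rw [Metric.tendsto_nhds]
      intro ε hε
      filter_upwards [hc.2 j ε hε] with q hq
      rw [dist_comm, dist_eq_norm]
      exact hq ξ
    exact tendsto_nhds_unique h1 ((hcoeff ξ).const_mul _)
  -- A single measure of the family at weighted distance less than 1 from the limit transfers its
  -- decay.
  have hdecay : ∀ j, HasFourierDecay (expSeq β j) (μ : Measure (Torus d)) := by
    intro j
    obtain ⟨q, hq⟩ := (hc.2 j 1 one_pos).exists
    obtain ⟨K, hK⟩ := q.1.2.decay _ (expSeq_mem hβ j)
    refine ⟨1 + K, ?_⟩
    rintro _ ⟨ξ, rfl⟩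
    have h1 := hq ξ
    rw [hlim] at h1
    have h2 : ‖weightedCoeff (expSeq β j) q.1.2.toMeasure ξ‖ ≤ K := hK ⟨ξ, rfl⟩
    have h3 := norm_sub_norm_le (weightedCoeff (expSeq β j) (μ : Measure (Torus d)) ξ)
      (weightedCoeff (expSeq β j) q.1.2.toMeasure ξ)
    simp only
    linarith
  have hdecay' : ∀ s ∈ Ico (0 : ℝ) β, HasFourierDecay s (μ : Measure (Torus d)) := by
    intro s hs
    rcases hs.1.eq_or_lt with rfl | hs0
    · exact hasFourierDecay_zero _
    · obtain ⟨j, hj⟩ := (exists_le_expSeq hs.2).exists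
      exact (hdecay j).mono hs0 hj
  -- A point off the limit set is separated from it by open sets U and W. Eventually the compact
  -- sets lie in W, so their measures vanish on U, and so does the weak limit by the portmanteau
  -- inequality for open sets.
  have hsupp : (μ : Measure (Torus d)).support ⊆ (y.1 : Set (Torus d)) := by
    intro x hx
    by_contra hxE
    obtain ⟨U, W, hU, hW, hxU, hyW, hUW⟩ : SeparatedNhds {x} (y.1 : Set (Torus d)) :=
      SeparatedNhds.of_isCompact_isCompact isCompact_singleton y.1.isCompact
        (disjoint_singleton_left.2 hxE)
    rw [singleton_subset_iff] at hxU
    have hev : ∀ᶠ q : PairSpace d β in 𝓕, (P q : Measure (Torus d)) U = 0 := by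
      filter_upwards [hc.1.eventually ((NonemptyCompacts.isOpen_subsets_of_isOpen hW).mem_nhds hyW)]
        with q hq
      refine measure_mono_null ?_ (Measure.measure_compl_support (μ := q.1.2.toMeasure))
      exact fun z hz hz' => hUW.le_bot ⟨hz, hq (q.2.2 hz')⟩
    have h1 := ProbabilityMeasure.le_liminf_measure_open_of_tendsto hμ hU
    have h2 : liminf (fun q => (P q : Measure (Torus d)) U) 𝓕 = 0 := by
      rw [liminf_congr (v := fun _ => (0 : ℝ≥0∞)) hev]
      simp
    rw [h2] at h1
    have h3 := (Measure.mem_support_iff_forall x).1 hx U (hU.mem_nhds hxU)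
    exact absurd h1 (not_le.2 h3)
  refine ⟨⟨(y.1, ⟨μ, inferInstance, hdecay'⟩), ⟨inferInstance, hsupp⟩⟩, ?_⟩
  refine Prod.ext rfl (funext fun j => ?_)
  exact (funext fun ξ => (hlim j ξ).symm : _)

instance {α : Type*} : IsCountablyGenerated (𝓤 (UniformFun α ℂ)) := by
  obtain ⟨V, hV⟩ := (𝓤 ℂ).exists_antitone_basis
  exact (UniformFun.hasBasis_uniformity_of_basis α ℂ hV.1).isCountablyGenerated

theorem baireSpace_pairSpace {d : ℕ} {β : ℝ} (hβ : 0 < β) : BaireSpace (PairSpace d β) := by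
  -- The uniformity is pulled back along the embedding, and its topology is replaced by the given
  -- one so that the Baire property is about the latter. Injectivity of the embedding is not needed.
  let u : UniformSpace (PairSpace d β) :=
    (UniformSpace.comap (coeffEmbedding d β) inferInstance).replaceTopology
      (isInducing_coeffEmbedding hβ).eq_induced
  have hui : IsUniformInducing (coeffEmbedding d β) := ⟨rfl⟩
  have : CompleteSpace (PairSpace d β) :=
    hui.completeSpace (isClosed_range_coeffEmbedding hβ).isComplete
  have : IsCountablyGenerated (𝓤 (PairSpace d β)) := by
    rw [← hui.comap_uniformity]
    infer_instance
  infer_instance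

end SalemAvoid

end

open Set Filter Topology MeasureTheory
open scoped ENNReal ContDiff

noncomputable section

namespace SalemAvoid

/-! ### The bounded differences inequality -/

/-- Hoeffding's lemma on the interval [a - c, a + c], whose half length is c. -/
lemma integral_exp_sub_mean_le {Ω : Type*} [MeasurableSpace Ω] (μ : Measure Ω)
    [IsProbabilityMeasure μ] {X : Ω → ℝ} (hX : Measurable X) {a c : ℝ} (hc : 0 ≤ c)
    (h : ∀ u, |X u - a| ≤ c) (t : ℝ) :
    ∫ u, Real.exp (t * (X u - ∫ v, X v ∂μ)) ∂μ ≤ Real.exp (c ^ 2 * t ^ 2 / 2) := by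
  have h1 := (ProbabilityTheory.hasSubgaussianMGF_of_mem_Icc (μ := μ) (a := a - c) (b := a + c)
    hX.aemeasurable (Eventually.of_forall fun u => by
      have := abs_le.1 (h u); constructor <;> linarith)).mgf_le t
  have h2 : (((‖a + c - (a - c)‖₊ / 2) ^ 2 : NNReal) : ℝ) = c ^ 2 := by
    have : a + c - (a - c) = 2 * c := by ring
    rw [this]
    simp [abs_of_nonneg hc]
  rw [h2] at h1
  exact h1

lemma integrable_of_measurable_of_abs_le {Ω : Type*} [MeasurableSpace Ω] {μ : Measure Ω}
    [IsFiniteMeasure μ] {X : Ω → ℝ} (hX : Measurable X) {K : ℝ} (h : ∀ u, |X u| ≤ K) :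
    Integrable X μ :=
  (integrable_const K).mono' hX.aestronglyMeasurable (Eventually.of_forall h)

lemma abs_integral_le_of_abs_le {Ω : Type*} [MeasurableSpace Ω] {μ : Measure Ω}
    [IsProbabilityMeasure μ] {X : Ω → ℝ} {K : ℝ} (h : ∀ u, |X u| ≤ K) : |∫ u, X u ∂μ| ≤ K := by
  have := norm_integral_le_of_norm_le_const (μ := μ) (C := K) (f := X) (Eventually.of_forall h)
  simpa using this

/-- Integrate out the first coordinate. The conditional mean H inherits the bounded differences, and
with the other coordinates fixed G - H is centred and G varies by at most c from a reference value.
Hoeffding's lemma then contributes one factor exp(c²t²/2), and the induction hypothesis handles H.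
-/
lemma integral_exp_bounded_differences_fin {Ω : Type*} [MeasurableSpace Ω] (μ : Measure Ω)
    [IsProbabilityMeasure μ] {c : ℝ} (hc : 0 ≤ c) (t K : ℝ) (n : ℕ) :
    ∀ G : (Fin n → Ω) → ℝ, Measurable G → (∀ x, |G x| ≤ K) →
      (∀ x i u, |G (Function.update x i u) - G x| ≤ c) →
      ∫ x, Real.exp (t * (G x - ∫ y, G y ∂(Measure.pi fun _ => μ))) ∂(Measure.pi fun _ => μ) ≤
        Real.exp (n * (c ^ 2 * t ^ 2 / 2)) := by
  induction n with
  | zero =>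
    intro G _ _ _
    have h : ∀ x y : Fin 0 → Ω, G x = G y := fun x y => by rw [Subsingleton.elim x y]
    have h2 : ∀ x : Fin 0 → Ω, ∫ y, G y ∂(Measure.pi fun _ => μ) = G x := fun x => by
      simp_rw [fun y => h y x]; simp
    have h3 : ∀ x : Fin 0 → Ω,
        Real.exp (t * (G x - ∫ y, G y ∂(Measure.pi fun _ => μ))) = 1 := fun x => by
      rw [h2 x]; simp
    simp_rw [h3]; simp
  | succ n ih =>
    intro G hG hK hd
    have hmp := (measurePreserving_piFinSuccAbove (fun _ : Fin (n + 1) => μ) 0).symm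
    have hcons : ∀ p : Ω × (Fin n → Ω),
        (MeasurableEquiv.piFinSuccAbove (fun _ : Fin (n + 1) => Ω) 0).symm p = Fin.cons p.1 p.2 :=
      fun p => by simp [MeasurableEquiv.piFinSuccAbove, Fin.insertNthEquiv]
    have hInt : ∀ F : (Fin (n + 1) → Ω) → ℝ, Measurable F → (∃ C, ∀ x, |F x| ≤ C) →
        ∫ x, F x ∂(Measure.pi fun _ => μ) =
          ∫ x : Fin n → Ω, ∫ u, F (Fin.cons u x) ∂μ ∂(Measure.pi fun _ => μ) := by
      intro F hF ⟨C, hC⟩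
      rw [← hmp.integral_comp' F]
      simp_rw [hcons]
      rw [integral_prod_symm]
      refine integrable_of_measurable_of_abs_le (K := C) ?_ fun p => hC _
      simp_rw [← hcons]
      exact hF.comp (MeasurableEquiv.measurable _)
    have hGc : Measurable fun p : (Fin n → Ω) × Ω => G (Fin.cons p.2 p.1) := by
      have : Measurable fun p : Ω × (Fin n → Ω) => G (Fin.cons p.1 p.2) := by
        simp_rw [← hcons]
        exact hG.comp (MeasurableEquiv.measurable _)
      exact this.comp measurable_swap
    set H : (Fin n → Ω) → ℝ := fun x => ∫ u, G (Fin.cons u x) ∂μ with hH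
    have hHm : Measurable H := hGc.stronglyMeasurable.integral_prod_right.measurable
    have hK0 : 0 ≤ K := by
      obtain ⟨u⟩ : Nonempty Ω := nonempty_of_isProbabilityMeasure μ
      exact (abs_nonneg _).trans (hK fun _ => u)
    have hslice : ∀ x, Measurable fun u => G (Fin.cons u x) := fun x =>
      hGc.comp measurable_prodMk_left
    have hHK : ∀ x, |H x| ≤ K := fun x => abs_integral_le_of_abs_le fun u => hK _
    have hHd : ∀ x i u, |H (Function.update x i u) - H x| ≤ c := fun x i u => by
      rw [hH]
      simp only
      rw [← integral_sub (integrable_of_measurable_of_abs_le (hslice _) fun u => hK _)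
        (integrable_of_measurable_of_abs_le (hslice _) fun u => hK _)]
      have := norm_integral_le_of_norm_le_const (μ := μ) (C := c)
        (f := fun v => G (Fin.cons v (Function.update x i u)) - G (Fin.cons v x))
        (Eventually.of_forall fun v => by
          have := hd (Fin.cons v x) i.succ u
          rwa [← Fin.cons_update] at this)
      simpa using this
    have hEG : ∫ y, G y ∂(Measure.pi fun _ => μ) = ∫ y, H y ∂(Measure.pi fun _ => μ) :=
      hInt G hG ⟨K, hK⟩
    set m := ∫ y, H y ∂(Measure.pi fun _ : Fin n => μ) with hm
    have hmK : |m| ≤ K := abs_integral_le_of_abs_le hHK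
    rw [hEG, hInt _ ((((hG.sub_const _).const_mul t)).exp)
      ⟨Real.exp (|t| * (K + K)), fun x => by
        rw [abs_of_pos (Real.exp_pos _)]
        refine Real.exp_le_exp.2 ((le_abs_self _).trans ?_)
        rw [abs_mul]
        gcongr
        exact (abs_sub _ _).trans (add_le_add (hK x) hmK)⟩]
    have hb : ∀ x : Fin n → Ω, ∫ u, Real.exp (t * (G (Fin.cons u x) - m)) ∂μ ≤
        Real.exp (c ^ 2 * t ^ 2 / 2) * Real.exp (t * (H x - m)) := by
      intro x
      have h1 : ∀ u, Real.exp (t * (G (Fin.cons u x) - m)) =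
          Real.exp (t * (G (Fin.cons u x) - H x)) * Real.exp (t * (H x - m)) := fun u => by
        rw [← Real.exp_add]; ring_nf
      simp_rw [h1]
      rw [integral_mul_const]
      gcongr
      obtain ⟨v⟩ : Nonempty Ω := nonempty_of_isProbabilityMeasure μ
      refine integral_exp_sub_mean_le μ (hslice x) (a := G (Fin.cons v x)) hc (fun u => ?_) t
      have := hd (Fin.cons v x) 0 u
      rwa [Fin.update_cons_zero] at this
    have hHexp : Measurable fun x => Real.exp (t * (H x - m)) :=
      ((hHm.sub_const _).const_mul t).exp
    have hbd : ∀ x, |Real.exp (t * (H x - m))| ≤ Real.exp (|t| * (K + K)) := fun x => by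
      rw [abs_of_pos (Real.exp_pos _)]
      refine Real.exp_le_exp.2 ((le_abs_self _).trans ?_)
      rw [abs_mul]
      gcongr
      exact (abs_sub _ _).trans (add_le_add (hHK x) hmK)
    calc ∫ x : Fin n → Ω, ∫ u, Real.exp (t * (G (Fin.cons u x) - m)) ∂μ ∂(Measure.pi fun _ => μ)
        ≤ ∫ x : Fin n → Ω, Real.exp (c ^ 2 * t ^ 2 / 2) * Real.exp (t * (H x - m))
            ∂(Measure.pi fun _ => μ) := by
          refine integral_mono_of_nonneg (Eventually.of_forall fun x =>
            integral_nonneg fun u => (Real.exp_pos _).le)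
            ((integrable_of_measurable_of_abs_le hHexp hbd).const_mul _)
            (Eventually.of_forall hb)
      _ ≤ Real.exp (c ^ 2 * t ^ 2 / 2) * Real.exp (n * (c ^ 2 * t ^ 2 / 2)) := by
          rw [integral_const_mul]
          gcongr
          exact ih H hHm hHK hHd
      _ = _ := by
          rw [← Real.exp_add]; push_cast; ring_nf

variable {ι : Type*} [Fintype ι] [DecidableEq ι]

lemma integral_exp_bounded_differences {Ω : Type*} [MeasurableSpace Ω]
    (μ : Measure Ω) [IsProbabilityMeasure μ] {c : ℝ} (hc : 0 ≤ c) (t K : ℝ) {G : (ι → Ω) → ℝ}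
    (hG : Measurable G) (hK : ∀ x, |G x| ≤ K)
    (hd : ∀ x i u, |G (Function.update x i u) - G x| ≤ c) :
    ∫ x, Real.exp (t * (G x - ∫ y, G y ∂(Measure.pi fun _ => μ))) ∂(Measure.pi fun _ => μ) ≤
      Real.exp (Fintype.card ι * (c ^ 2 * t ^ 2 / 2)) := by
  let e := Fintype.equivFin ι
  have hmp := measurePreserving_arrowCongr' (fun _ : Fin (Fintype.card ι) => μ) (fun _ : ι => μ)
    e.symm (MeasurableEquiv.refl Ω) fun _ => MeasurePreserving.id μ
  set Φ := MeasurableEquiv.arrowCongr' e.symm (MeasurableEquiv.refl Ω) with hΦ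
  have hΦa : ∀ x, Φ x = x ∘ e := fun x => rfl
  have h := integral_exp_bounded_differences_fin μ hc t K (Fintype.card ι) (fun x => G (Φ x))
    (hG.comp Φ.measurable) (fun x => hK _) (fun x i u => by
      have := hd (Φ x) (e.symm i) u
      have heq : Φ (Function.update x i u) = Function.update (Φ x) (e.symm i) u := by
        rw [hΦa, hΦa]
        exact Function.update_comp_equiv x e.symm.symm i u
      rw [heq]; exact this)
  rw [hmp.integral_comp' (g := G)] at h
  rw [← hmp.integral_comp' (g := fun x => Real.exp (t * (G x - ∫ y, G y ∂(Measure.pi fun _ => μ))))]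
  exact h

lemma measure_bounded_differences_ge_le {Ω : Type*} [MeasurableSpace Ω]
    (μ : Measure Ω) [IsProbabilityMeasure μ] {c : ℝ} (hc : 0 < c) {K : ℝ} {G : (ι → Ω) → ℝ}
    (hG : Measurable G) (hK : ∀ x, |G x| ≤ K)
    (hd : ∀ x i u, |G (Function.update x i u) - G x| ≤ c) [Nonempty ι] {a : ℝ} (ha : 0 ≤ a) :
    (Measure.pi fun _ : ι => μ).real {x | a ≤ G x - ∫ y, G y ∂(Measure.pi fun _ => μ)} ≤
      Real.exp (-(a ^ 2 / (2 * (Fintype.card ι * c ^ 2)))) := by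
  set P : Measure (ι → Ω) := Measure.pi fun _ => μ with hP
  set m := ∫ y, G y ∂P with hm
  have hmK : |m| ≤ K := abs_integral_le_of_abs_le hK
  have hcard : (0 : ℝ) < Fintype.card ι := by exact_mod_cast Fintype.card_pos
  -- The minimiser of the Chernoff exponent -ta + |ι|c²t²/2.
  set t := a / (Fintype.card ι * c ^ 2) with ht
  have ht0 : 0 ≤ t := by positivity
  have h1 := ProbabilityTheory.measure_ge_le_exp_mul_mgf (μ := P) (X := fun x => G x - m) a ht0
    (integrable_of_measurable_of_abs_le (K := Real.exp (|t| * (K + K)))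
      ((hG.sub_const _).const_mul t).exp fun x => by
        rw [abs_of_pos (Real.exp_pos _)]
        refine Real.exp_le_exp.2 ((le_abs_self _).trans ?_)
        rw [abs_mul]
        gcongr
        exact (abs_sub _ _).trans (add_le_add (hK x) hmK))
  refine h1.trans ?_
  have h2 : ProbabilityTheory.mgf (fun x => G x - m) P t ≤
      Real.exp (Fintype.card ι * (c ^ 2 * t ^ 2 / 2)) :=
    integral_exp_bounded_differences μ hc.le t K hG hK hd
  calc _ ≤ Real.exp (-t * a) * Real.exp (Fintype.card ι * (c ^ 2 * t ^ 2 / 2)) := by gcongr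
    _ = _ := by
      rw [← Real.exp_add, ht]
      congr 1
      field_simp
      ring

/-- Simultaneous concentration of finitely many complex functions with bounded differences. -/
lemma exists_forall_norm_sub_integral_le {Ω : Type*} [MeasurableSpace Ω]
    (μ : Measure Ω) [IsProbabilityMeasure μ] [Nonempty ι] {κ : Type*} (S : Finset κ) {c K a : ℝ}
    (hc : 0 < c) (ha : 0 ≤ a) {G : κ → (ι → Ω) → ℂ} (hG : ∀ k, Measurable (G k))
    (hK : ∀ k x, ‖G k x‖ ≤ K)
    (hd : ∀ k x i u, ‖G k (Function.update x i u) - G k x‖ ≤ c)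
    (hS : S.card * (4 * Real.exp (-(a ^ 2 / (8 * (Fintype.card ι * c ^ 2))))) < 1) :
    ∃ x, ∀ k ∈ S, ‖G k x - ∫ y, G k y ∂(Measure.pi fun _ => μ)‖ ≤ a := by
  set P : Measure (ι → Ω) := Measure.pi fun _ => μ with hP
  set b := Real.exp (-(a ^ 2 / (8 * (Fintype.card ι * c ^ 2)))) with hb
  -- Real and imaginary parts are controlled separately at threshold a/2, which turns the 2 in the
  -- exponent into 8. Two parts with two tails each account for the factor 4 in the union bound.
  have hb' : b = Real.exp (-((a / 2) ^ 2 / (2 * (Fintype.card ι * c ^ 2)))) := by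
    rw [hb]; congr 2; rw [div_pow, div_div]; ring_nf
  have htail : ∀ F : (ι → Ω) → ℝ, Measurable F → (∀ x, |F x| ≤ K) →
      (∀ x i u, |F (Function.update x i u) - F x| ≤ c) →
      P.real {x | a / 2 ≤ |F x - ∫ y, F y ∂P|} ≤ 2 * b := by
    intro F hF hFK hFd
    have h1 := measure_bounded_differences_ge_le μ hc hF hFK hFd (by positivity : 0 ≤ a / 2)
    have h2 := measure_bounded_differences_ge_le μ hc (G := fun x => -F x) hF.neg
      (fun x => by rw [abs_neg]; exact hFK x)
      (fun x i u => by rw [← abs_neg]; convert hFd x i u using 2; ring) (by positivity : 0 ≤ a / 2)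
    rw [← hb'] at h1 h2
    calc P.real {x | a / 2 ≤ |F x - ∫ y, F y ∂P|}
        ≤ P.real ({x | a / 2 ≤ F x - ∫ y, F y ∂P} ∪ {x | a / 2 ≤ -F x - ∫ y, -F y ∂P}) := by
          refine measureReal_mono fun x hx => ?_
          rcases le_abs.1 (show a / 2 ≤ |F x - ∫ y, F y ∂P| from hx) with h | h
          · exact Or.inl h
          · refine Or.inr ?_
            rw [mem_ofPred_eq, integral_neg]
            linarith
      _ ≤ _ := (measureReal_union_le _ _).trans (by linarith)
  by_contra! hcon
  have hcov : (univ : Set (ι → Ω)) ⊆ ⋃ k ∈ S,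
      ({x | a / 2 ≤ |(G k x).re - ∫ y, (G k y).re ∂P|} ∪
        {x | a / 2 ≤ |(G k x).im - ∫ y, (G k y).im ∂P|}) := by
    intro x _
    obtain ⟨k, hk, hx⟩ := hcon x
    refine mem_biUnion hk ?_
    have hInt : Integrable (G k) P := (integrable_const K).mono' (hG k).aestronglyMeasurable
      (Eventually.of_forall (hK k))
    have hre : ∫ y, (G k y).re ∂P = (∫ y, G k y ∂P).re := integral_re hInt
    have him : ∫ y, (G k y).im ∂P = (∫ y, G k y ∂P).im := integral_im hInt
    have h1 := Complex.norm_le_abs_re_add_abs_im (G k x - ∫ y, G k y ∂P)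
    rw [Complex.sub_re, Complex.sub_im, ← hre, ← him] at h1
    by_contra hnot
    rw [mem_union, not_or, mem_ofPred_eq, mem_ofPred_eq] at hnot
    have h2 := not_le.1 hnot.1
    have h3 := not_le.1 hnot.2
    linarith
  have h1 : (1 : ℝ) ≤ ∑ k ∈ S, (2 * b + 2 * b) := by
    calc (1 : ℝ) = P.real univ := by simp
      _ ≤ _ := measureReal_mono hcov (measure_ne_top _ _)
      _ ≤ _ := measureReal_biUnion_finset_le _ _
      _ ≤ _ := Finset.sum_le_sum fun k _ => by
        refine (measureReal_union_le _ _).trans (add_le_add ?_ ?_)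
        · refine htail (fun x => (G k x).re) (Complex.measurable_re.comp (hG k))
            (fun x => (Complex.abs_re_le_norm _).trans (hK k x)) fun x i u => ?_
          rw [← Complex.sub_re]
          exact (Complex.abs_re_le_norm _).trans (hd k x i u)
        · refine htail (fun x => (G k x).im) (Complex.measurable_im.comp (hG k))
            (fun x => (Complex.abs_im_le_norm _).trans (hK k x)) fun x i u => ?_
          rw [← Complex.sub_im]
          exact (Complex.abs_im_le_norm _).trans (hd k x i u)
  rw [Finset.sum_const, nsmul_eq_mul] at h1
  linarith

end SalemAvoid

end

open Set Filter Topology MeasureTheory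
open scoped ENNReal ContDiff

noncomputable section

namespace SalemAvoid

/-! ### Oscillatory integrals without stationary points -/

section NonstationaryPhase

variable {E : Type*} {d : ℕ}

/-- The oscillating factor `exp(-2πi ζ·F(z))`. -/
def oscillation (F : E → Fin d → ℝ) (ζ : Fin d → ℝ) (z : E) : ℂ :=
  Complex.exp (-(2 * Real.pi * Complex.I) * (∑ i, ζ i * F z i : ℝ))

lemma norm_oscillation (F : E → Fin d → ℝ) (ζ : Fin d → ℝ) (z : E) :
    ‖oscillation F ζ z‖ = 1 := by
  rw [oscillation]
  have : -(2 * (Real.pi : ℂ) * Complex.I) * ((∑ i, ζ i * F z i : ℝ) : ℂ) =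
      ((-(2 * Real.pi) * ∑ i, ζ i * F z i : ℝ) : ℂ) * Complex.I := by push_cast; ring
  rw [this, Complex.norm_exp_ofReal_mul_I]

lemma hasFDerivAt_oscillation [NormedAddCommGroup E] [NormedSpace ℝ E] {F : E → Fin d → ℝ} {z : E} (hF : DifferentiableAt ℝ F z)
    (ζ : Fin d → ℝ) (e : E) :
    DifferentiableAt ℝ (oscillation F ζ) z ∧ fderiv ℝ (oscillation F ζ) z e =
      oscillation F ζ z * (-(2 * Real.pi * Complex.I) * (∑ i, ζ i * fderiv ℝ F z e i : ℝ)) := by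
  have h1 : HasFDerivAt (fun z => ∑ i, ζ i * F z i)
      (∑ i, ζ i • (ContinuousLinearMap.proj i).comp (fderiv ℝ F z)) z := by
    refine HasFDerivAt.fun_sum fun i _ => ?_
    exact ((hasFDerivAt_apply i (F z)).comp z hF.hasFDerivAt).const_mul (ζ i)
  have h2 : HasFDerivAt (fun z => ((∑ i, ζ i * F z i : ℝ) : ℂ))
      (Complex.ofRealCLM.comp (∑ i, ζ i • (ContinuousLinearMap.proj i).comp (fderiv ℝ F z))) z :=
    Complex.ofRealCLM.hasFDerivAt.comp z h1
  have h3 := (h2.const_mul (-(2 * Real.pi * Complex.I))).cexp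
  refine ⟨h3.differentiableAt, ?_⟩
  change fderiv ℝ (fun z => Complex.exp (-(2 * Real.pi * Complex.I) *
    ((∑ i, ζ i * F z i : ℝ) : ℂ))) z e = _
  rw [h3.fderiv]
  simp [oscillation]

lemma contDiffOn_oscillation [NormedAddCommGroup E] [NormedSpace ℝ E]
    {F : E → Fin d → ℝ} {U : Set E} (hF : ContDiffOn ℝ ∞ F U)
    (ζ : Fin d → ℝ) : ContDiffOn ℝ ∞ (oscillation F ζ) U := by
  have h1 : ContDiffOn ℝ ∞ (fun z => ∑ i, ζ i * F z i) U :=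
    ContDiffOn.sum fun i _ => contDiffOn_const.mul (contDiffOn_pi.1 hF i)
  have h2 : ContDiffOn ℝ ∞ (fun z => ((∑ i, ζ i * F z i : ℝ) : ℂ)) U :=
    Complex.ofRealCLM.contDiff.comp_contDiffOn h1
  exact (contDiffOn_const.mul h2).cexp

lemma integrable_of_continuousOn_compact [TopologicalSpace E] [T2Space E] [MeasurableSpace E]
    [BorelSpace E] (μ : Measure E) [IsFiniteMeasureOnCompacts μ] {K : Set E} (hK : IsCompact K)
    {g : E → ℂ}
    (hg : ContinuousOn g K) (h0 : ∀ z ∉ K, g z = 0) : Integrable g μ := by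
  rw [← integrableOn_iff_integrable_of_support_subset (s := K)]
  · exact hg.integrableOn_compact hK
  · intro z hz
    by_contra h
    exact hz (h0 z h)

/-- **Nonstationary phase**: if constant-coefficient combinations of the derivatives of `F`
along smooth vector fields reproduce the coordinate vectors near the support of `a`, then
`∫ a exp(-2πi ζ·F)` decays faster than any power of `ζ`. -/
theorem exists_norm_integral_oscillation_le [NormedAddCommGroup E] [NormedSpace ℝ E]
    [FiniteDimensional ℝ E] [MeasurableSpace E] [BorelSpace E] (μ : Measure E)
    [μ.IsAddHaarMeasure] {F : E → Fin d → ℝ} {U : Set E} (hU : IsOpen U)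
    (hF : ContDiffOn ℝ ∞ F U) {J : Type*} [Fintype J] (e : J → E) (v : Fin d → J → E → ℝ)
    (hv : ∀ i j, ContDiffOn ℝ ∞ (v i j) U)
    (hvF : ∀ i, ∀ z ∈ U, ∑ j, v i j z • fderiv ℝ F z (e j) = Pi.single i 1)
    {K : Set E} (hK : IsCompact K) (hKU : K ⊆ U) (M : ℕ) :
    ∀ a : E → ℂ, ContDiff ℝ ∞ a → (∀ z ∉ K, a z = 0) →
      ∃ C, ∀ ζ : Fin d → ℝ, ‖ζ‖ ^ M * ‖∫ z, a z * oscillation F ζ z ∂μ‖ ≤ C := by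
  induction M with
  | zero =>
    intro a ha h0
    refine ⟨∫ z, ‖a z‖ ∂μ, fun ζ => ?_⟩
    rw [pow_zero, one_mul]
    refine (norm_integral_le_integral_norm _).trans (le_of_eq ?_)
    simp_rw [norm_mul, norm_oscillation, mul_one]
  | succ M ih =>
    intro a ha h0
    have htsupp : ∀ {g : E → ℂ}, (∀ z ∉ K, g z = 0) → tsupport g ⊆ K := fun {g} hg =>
      closure_minimal (fun z hz => by_contra fun h => hz (hg z h)) hK.isClosed
    -- Integrating by parts along the i-th vector field moves the derivative onto a v_{ij}. The new
    -- amplitude T i is again smooth and vanishes off K, so the induction hypothesis applies to it.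
    set g : Fin d → J → E → ℂ := fun i j z => a z * v i j z with hgdef
    have hg0 : ∀ i j, ∀ z ∉ K, g i j z = 0 := fun i j z hz => by simp [hgdef, h0 z hz]
    have hg : ∀ i j, ContDiff ℝ ∞ (g i j) := fun i j => by
      refine contDiff_iff_contDiffAt.2 fun z => ?_
      by_cases hz : z ∈ K
      swap
      · refine (contDiffAt_const (c := (0 : ℂ))).congr_of_eventuallyEq ?_
        filter_upwards [hK.isClosed.isOpen_compl.mem_nhds hz] with w hw using hg0 i j w hw
      have hzU := hKU hz
      exact ha.contDiffAt.mul (Complex.ofRealCLM.contDiff.contDiffAt.comp z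
        ((hv i j).contDiffAt (hU.mem_nhds hzU)))
    set T : Fin d → E → ℂ := fun i z => ∑ j, fderiv ℝ (g i j) z (e j) with hT
    have hTs : ∀ i, ContDiff ℝ ∞ (T i) := fun i => ContDiff.sum fun j _ =>
      ((hg i j).fderiv_right (m := ∞) (by simp)).clm_apply contDiff_const
    have hg0' : ∀ i j, ∀ z ∉ K, fderiv ℝ (g i j) z = 0 := fun i j z hz => by
      have : g i j =ᶠ[𝓝 z] fun _ => 0 := by
        filter_upwards [hK.isClosed.isOpen_compl.mem_nhds hz] with w hw using hg0 i j w hw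
      rw [this.fderiv_eq]; simp
    have hT0 : ∀ i, ∀ z ∉ K, T i z = 0 := fun i z hz => by
      simp [hT, hg0' i _ z hz]
    choose C hC using fun i => ih (T i) (hTs i) (hT0 i)
    have hC0 : ∀ i, 0 ≤ C i := fun i =>
      (mul_nonneg (by positivity) (norm_nonneg _)).trans (hC i 0)
    refine ⟨∑ i, C i, fun ζ => ?_⟩
    rcases isEmpty_or_nonempty (Fin d) with hd | hd
    · have : ‖ζ‖ = 0 := by rw [Subsingleton.elim ζ 0, norm_zero]
      rw [this]; simp
    -- The coordinate that realises the maximum norm is used, so each integration by parts gains a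
    -- full factor of the norm of ζ.
    obtain ⟨i, hi⟩ : ∃ i, ‖ζ‖ = |ζ i| := by
      obtain ⟨i, hi⟩ := (IsGreatest.pi_norm ζ).1
      exact ⟨i, hi.symm⟩
    refine le_trans ?_ (Finset.single_le_sum (fun i _ => hC0 i) (Finset.mem_univ i))
    refine le_trans ?_ (hC i ζ)
    have hosc := contDiffOn_oscillation hF ζ
    have hparts : ∀ j, ∫ z, g i j z * fderiv ℝ (oscillation F ζ) z (e j) ∂μ =
        -∫ z, fderiv ℝ (g i j) z (e j) * oscillation F ζ z ∂μ := by
      intro j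
      refine integral_mul_fderiv_eq_neg_fderiv_mul_of_integrable ?_ ?_ ?_ ?_ ?_
      · refine integrable_of_continuousOn_compact μ hK ?_ fun z hz => by simp [hg0' i j z hz]
        exact ((((hg i j).continuous_fderiv (by simp)).clm_apply continuous_const).continuousOn).mul
          (hosc.continuousOn.mono hKU)
      · refine integrable_of_continuousOn_compact μ hK ?_ fun z hz => by simp [hg0 i j z hz]
        exact (hg i j).continuous.continuousOn.mul
          (((hosc.continuousOn_fderiv_of_isOpen hU (by simp)).mono hKU).clm_apply
            continuousOn_const)
      · refine integrable_of_continuousOn_compact μ hK ?_ fun z hz => by simp [hg0 i j z hz]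
        exact (hg i j).continuous.continuousOn.mul (hosc.continuousOn.mono hKU)
      · exact fun z _ => (hg i j).differentiable (by simp) z
      · intro z hz
        have hzU := hKU (htsupp (hg0 i j) hz)
        exact (hosc.differentiableOn (by simp)).differentiableAt (hU.mem_nhds hzU)
    -- The vector fields invert the derivative of F, so the phase has derivative exactly ζ i, up to
    -- the factor -2πi, along the i-th one.
    have hpoint : ∀ z, ∑ j, g i j z * fderiv ℝ (oscillation F ζ) z (e j) =
        -(2 * Real.pi * Complex.I) * ζ i * (a z * oscillation F ζ z) := by
      intro z
      by_cases hz : z ∈ K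
      · have hzU := hKU hz
        have hFd : DifferentiableAt ℝ F z :=
          (hF.differentiableOn (by simp)).differentiableAt (hU.mem_nhds hzU)
        simp_rw [fun j => (hasFDerivAt_oscillation hFd ζ (e j)).2]
        have h1 := hvF i z hzU
        have h2 : ∑ j, v i j z * ∑ k, ζ k * fderiv ℝ F z (e j) k = ζ i := by
          simp_rw [Finset.mul_sum]
          rw [Finset.sum_comm]
          have : ∀ k, ∑ j, v i j z * (ζ k * fderiv ℝ F z (e j) k) =
              ζ k * (Pi.single i 1 : Fin d → ℝ) k := fun k => by
            rw [← h1, Finset.sum_apply, Finset.mul_sum]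
            refine Finset.sum_congr rfl fun j _ => ?_
            simp; ring
          simp_rw [this]
          simp [Pi.single_apply]
        calc _ = a z * oscillation F ζ z * (-(2 * Real.pi * Complex.I)) *
              ((∑ j, v i j z * ∑ k, ζ k * fderiv ℝ F z (e j) k : ℝ) : ℂ) := by
              push_cast
              rw [Finset.mul_sum]
              refine Finset.sum_congr rfl fun j _ => ?_
              simp only [hgdef]; ring
          _ = _ := by rw [h2]; ring
      · simp [hg0 i _ z hz, h0 z hz]
    have hmain : -(2 * Real.pi * Complex.I) * ζ i * ∫ z, a z * oscillation F ζ z ∂μ =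
        -∫ z, T i z * oscillation F ζ z ∂μ := by
      rw [← integral_const_mul]
      simp_rw [← hpoint]
      rw [integral_finsetSum]
      · simp_rw [hparts, hT, Finset.sum_mul]
        rw [integral_finsetSum, Finset.sum_neg_distrib]
        intro j _
        refine integrable_of_continuousOn_compact μ hK ?_ fun z hz => by simp [hg0' i j z hz]
        exact ((((hg i j).continuous_fderiv (by simp)).clm_apply continuous_const).continuousOn).mul
          (hosc.continuousOn.mono hKU)
      · intro j _
        refine integrable_of_continuousOn_compact μ hK ?_ fun z hz => by simp [hg0 i j z hz]
        exact (hg i j).continuous.continuousOn.mul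
          (((hosc.continuousOn_fderiv_of_isOpen hU (by simp)).mono hKU).clm_apply
            continuousOn_const)
    have hnorm := congrArg norm hmain
    rw [norm_neg, norm_mul, norm_mul, norm_neg] at hnorm
    have h2pi : ‖(2 * Real.pi * Complex.I : ℂ)‖ = 2 * Real.pi := by
      simp [abs_of_pos Real.pi_pos]
    rw [h2pi, Complex.norm_real, Real.norm_eq_abs, ← hi] at hnorm
    rw [pow_succ, mul_assoc]
    gcongr
    rw [← hnorm]
    refine mul_le_mul_of_nonneg_right ?_ (norm_nonneg _)
    refine le_mul_of_one_le_left (norm_nonneg _) ?_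
    linarith [Real.pi_gt_three]

end NonstationaryPhase

end SalemAvoid

end

open Set Filter Topology MeasureTheory
open scoped ENNReal ContDiff

noncomputable section

namespace SalemAvoid

open UnitAddTorus

/-! ### Smooth bump functions on the torus -/

/-- A smooth bump on the circle: `1` for `|t| ≤ ρ` and `0` for `|t| ≥ R`. -/
def circleBump (ρ R : ℝ) (t : UnitAddCircle) : ℝ :=
  Real.smoothTransition (((fourier 1 t).re - Real.cos (2 * Real.pi * R)) /
    (Real.cos (2 * Real.pi * ρ) - Real.cos (2 * Real.pi * R)))

lemma re_fourier_one (t : ℝ) : (fourier 1 (t : UnitAddCircle)).re = Real.cos (2 * Real.pi * t) := by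
  rw [fourier_coe_apply]
  have : (2 * Real.pi * Complex.I * ((1 : ℤ) : ℂ) * t / ((1 : ℝ) : ℂ) : ℂ) =
      ((2 * Real.pi * t : ℝ) : ℂ) * Complex.I := by push_cast; ring
  rw [this, Complex.exp_ofReal_mul_I_re]

lemma re_fourier_one_eq (t : UnitAddCircle) : (fourier 1 t).re = Real.cos (2 * Real.pi * ‖t‖) := by
  obtain ⟨x, rfl⟩ := QuotientAddGroup.mk_surjective t
  change (fourier 1 (x : UnitAddCircle)).re = Real.cos (2 * Real.pi * ‖(x : UnitAddCircle)‖)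
  rw [re_fourier_one, UnitAddCircle.norm_eq, ← abs_of_pos Real.two_pi_pos, ← abs_mul, Real.cos_abs,
    abs_of_pos Real.two_pi_pos, mul_sub, mul_comm (2 * Real.pi) (round x : ℝ),
    Real.cos_sub_int_mul_two_pi]

lemma cos_two_pi_lt {ρ R : ℝ} (hρ : 0 ≤ ρ) (hρR : ρ < R) (hR : R ≤ 1 / 2) :
    Real.cos (2 * Real.pi * R) < Real.cos (2 * Real.pi * ρ) := by
  have := Real.pi_pos
  refine Real.cos_lt_cos_of_nonneg_of_le_pi (by positivity) (by nlinarith) ?_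
  gcongr

lemma continuous_circleBump (ρ R : ℝ) : Continuous (circleBump ρ R) :=
  Real.smoothTransition.continuous.comp
    (((Complex.continuous_re.comp (fourier 1).continuous).sub continuous_const).div_const _)

lemma contDiff_circleBump (ρ R : ℝ) : ContDiff ℝ ∞ fun t : ℝ => circleBump ρ R (t : UnitAddCircle) := by
  simp only [circleBump, re_fourier_one]
  exact Real.smoothTransition.contDiff.comp
    (((Real.contDiff_cos.comp (contDiff_const.mul contDiff_id)).sub contDiff_const).div_const _)

lemma norm_unitAddCircle_le_half (t : UnitAddCircle) : ‖t‖ ≤ 1 / 2 := by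
  simpa using AddCircle.norm_le_half_period (1 : ℝ) (x := t) one_ne_zero

lemma circleBump_eq_one {ρ R : ℝ} (hρ : 0 ≤ ρ) (hρR : ρ < R) (hR : R ≤ 1 / 2) {t : UnitAddCircle}
    (ht : ‖t‖ ≤ ρ) : circleBump ρ R t = 1 := by
  have h := cos_two_pi_lt hρ hρR hR
  refine Real.smoothTransition.one_of_one_le ?_
  rw [one_le_div (by linarith), re_fourier_one_eq]
  have := Real.pi_pos
  have h2 : Real.cos (2 * Real.pi * ρ) ≤ Real.cos (2 * Real.pi * ‖t‖) := by
    refine Real.cos_le_cos_of_nonneg_of_le_pi (by positivity) (by nlinarith) ?_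
    gcongr
  linarith

lemma circleBump_eq_zero {ρ R : ℝ} (hρ : 0 ≤ ρ) (hρR : ρ < R) (hR : R ≤ 1 / 2) {t : UnitAddCircle}
    (ht : R ≤ ‖t‖) : circleBump ρ R t = 0 := by
  have h := cos_two_pi_lt hρ hρR hR
  refine Real.smoothTransition.zero_of_nonpos ?_
  refine div_nonpos_of_nonpos_of_nonneg ?_ (by linarith)
  rw [re_fourier_one_eq]
  have := Real.pi_pos
  have h2 : Real.cos (2 * Real.pi * ‖t‖) ≤ Real.cos (2 * Real.pi * R) := by
    refine Real.cos_le_cos_of_nonneg_of_le_pi (by nlinarith)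
      (by nlinarith [norm_unitAddCircle_le_half t]) ?_
    gcongr
  linarith

/-- A smooth bump on the torus: `1` for `‖u‖ ≤ ρ` and `0` for `‖u‖ ≥ R`. -/
def torusBump {d : ℕ} (ρ R : ℝ) (u : Torus d) : ℝ := ∏ i, circleBump ρ R (u i)

lemma continuous_torusBump {d : ℕ} (ρ R : ℝ) : Continuous (torusBump (d := d) ρ R) :=
  continuous_finsetProd _ fun i _ => (continuous_circleBump ρ R).comp (continuous_apply i)

lemma contDiff_torusBump {d : ℕ} (ρ R : ℝ) :
    ContDiff ℝ ∞ fun x : Fin d → ℝ => torusBump ρ R (proj x) :=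
  contDiff_prod fun i _ => (contDiff_circleBump ρ R).comp (contDiff_apply ℝ ℝ i)

lemma torusBump_nonneg {d : ℕ} (ρ R : ℝ) (u : Torus d) : 0 ≤ torusBump ρ R u :=
  Finset.prod_nonneg fun _ _ => Real.smoothTransition.nonneg _

lemma torusBump_le_one {d : ℕ} (ρ R : ℝ) (u : Torus d) : torusBump ρ R u ≤ 1 :=
  Finset.prod_le_one (fun _ _ => Real.smoothTransition.nonneg _)
    fun _ _ => Real.smoothTransition.le_one _

lemma torusBump_eq_one {d : ℕ} {ρ R : ℝ} (hρ : 0 ≤ ρ) (hρR : ρ < R) (hR : R ≤ 1 / 2) {u : Torus d}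
    (hu : ‖u‖ ≤ ρ) : torusBump ρ R u = 1 :=
  Finset.prod_eq_one fun i _ => circleBump_eq_one hρ hρR hR ((norm_le_pi_norm u i).trans hu)

lemma torusBump_eq_zero {d : ℕ} {ρ R : ℝ} (hρ : 0 ≤ ρ) (hρR : ρ < R) (hR : R ≤ 1 / 2) {u : Torus d}
    (hu : R ≤ ‖u‖) : torusBump ρ R u = 0 := by
  have : ∃ i, R ≤ ‖u i‖ := by
    by_contra! h
    exact absurd hu (not_le.2 ((pi_norm_lt_iff (by linarith)).2 h))
  obtain ⟨i, hi⟩ := this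
  exact Finset.prod_eq_zero (Finset.mem_univ i) (circleBump_eq_zero hρ hρR hR hi)

/-! ### Lifting integrals to Euclidean space -/

lemma measurePreserving_proj {d : ℕ} (a : Fin d → ℝ) :
    MeasurePreserving (proj : (Fin d → ℝ) → Torus d)
      (Measure.pi fun i => volume.restrict (Ioc (a i) (a i + 1))) volume :=
  measurePreserving_pi _ _ fun i => UnitAddCircle.measurePreserving_mk (a i)

lemma measurePreserving_projTuple {m d : ℕ} (a : Fin m → Fin d → ℝ) :
    MeasurePreserving (projTuple : (Fin m → Fin d → ℝ) → Fin m → Torus d)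
      (volume.restrict (univ.pi fun k => univ.pi fun i => Ioc (a k i) (a k i + 1))) volume := by
  have h := measurePreserving_pi (fun k => Measure.pi fun i => volume.restrict (Ioc (a k i) (a k i + 1)))
    (fun _ => (volume : Measure (Torus d))) fun k => measurePreserving_proj (a k)
  have h2 : (Measure.pi fun k => Measure.pi fun i =>
      (volume : Measure ℝ).restrict (Ioc (a k i) (a k i + 1))) =
      (volume : Measure (Fin m → Fin d → ℝ)).restrict
        (univ.pi fun k => univ.pi fun i => Ioc (a k i) (a k i + 1)) := by
    rw [volume_pi, Measure.restrict_pi_pi]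
    congr 1
    ext1 k
    rw [volume_pi, Measure.restrict_pi_pi]
  rw [← h2]
  exact h

lemma continuous_projTuple {m d : ℕ} :
    Continuous (projTuple : (Fin m → Fin d → ℝ) → Fin m → Torus d) :=
  continuous_pi fun k => continuous_proj.comp (continuous_apply k)

lemma dist_projTuple_le {m d : ℕ} (z z' : Fin m → Fin d → ℝ) :
    dist (projTuple z) (projTuple z') ≤ dist z z' :=
  (dist_pi_le_iff dist_nonneg).2 fun k => (dist_proj_le _ _).trans (dist_le_pi_dist z z' k)

lemma dist_projTuple_of_le {m d : ℕ} {z z' : Fin m → Fin d → ℝ} (h : dist z z' ≤ 1 / 2) :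
    dist (projTuple z) (projTuple z') = dist z z' := by
  refine le_antisymm (dist_projTuple_le z z') ((dist_pi_le_iff dist_nonneg).2 fun k => ?_)
  rw [← dist_proj_of_le ((dist_le_pi_dist z z' k).trans h)]
  exact dist_le_pi_dist (projTuple z) (projTuple z') k

lemma exists_projTuple_near {m d : ℕ} (a : Fin m → Fin d → ℝ) (Z : Fin m → Torus d) :
    ∃ z, projTuple z = Z ∧ dist z a = dist Z (projTuple a) := by
  choose z hz hd using fun k => exists_proj_near (a k) (Z k)
  refine ⟨z, funext hz, le_antisymm ?_ ?_⟩
  · refine (dist_pi_le_iff dist_nonneg).2 fun k => ?_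
    rw [hd k]; exact dist_le_pi_dist Z (projTuple a) k
  · have : projTuple z = Z := funext hz
    rw [← this]; exact dist_projTuple_le z a

/-- The product of bumps around the points `proj (a k)`. -/
def tupleBump {m d : ℕ} (ρ R : ℝ) (c Z : Fin m → Torus d) : ℝ := ∏ k, torusBump ρ R (Z k - c k)

lemma tupleBump_nonneg {m d : ℕ} (ρ R : ℝ) (c Z : Fin m → Torus d) : 0 ≤ tupleBump ρ R c Z :=
  Finset.prod_nonneg fun _ _ => torusBump_nonneg _ _ _

lemma tupleBump_le_one {m d : ℕ} (ρ R : ℝ) (c Z : Fin m → Torus d) : tupleBump ρ R c Z ≤ 1 :=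
  Finset.prod_le_one (fun _ _ => torusBump_nonneg _ _ _) fun _ _ => torusBump_le_one _ _ _

lemma continuous_tupleBump {m d : ℕ} (ρ R : ℝ) (c : Fin m → Torus d) :
    Continuous (tupleBump ρ R c) :=
  continuous_finsetProd _ fun k _ =>
    (continuous_torusBump ρ R).comp ((continuous_apply k).sub continuous_const)

lemma tupleBump_eq_zero {m d : ℕ} {ρ R : ℝ} (hρ : 0 ≤ ρ) (hρR : ρ < R) (hR : R ≤ 1 / 2)
    {c Z : Fin m → Torus d} (h : R ≤ dist Z c) : tupleBump ρ R c Z = 0 := by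
  have : ∃ k, R ≤ dist (Z k) (c k) := by
    by_contra! h'
    exact absurd h (not_le.2 ((dist_pi_lt_iff (by linarith)).2 h'))
  obtain ⟨k, hk⟩ := this
  rw [dist_eq_norm] at hk
  exact Finset.prod_eq_zero (Finset.mem_univ k) (torusBump_eq_zero hρ hρR hR hk)

lemma mFourier_neg_proj_eq_oscillation {E : Type*} {d : ℕ} (F : E → Fin d → ℝ) (ξ : Fin d → ℤ)
    (z : E) : mFourier (-ξ) (proj (F z)) = oscillation F (fun i => (ξ i : ℝ)) z := by
  rw [mFourier_proj, oscillation]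
  congr 1
  push_cast
  simp [Finset.mul_sum]

lemma norm_intCast_pi {d : ℕ} (ξ : Fin d → ℤ) : ‖(fun i => (ξ i : ℝ))‖ = ‖ξ‖ := by
  have : ∀ i, ‖((ξ i : ℤ) : ℝ)‖₊ = ‖ξ i‖₊ := fun i => NNReal.eq (by simp [Int.norm_eq_abs])
  simp [Pi.norm_def, this]

/-! ### Smooth matrix inversion and rapid decay for pushed-forward bumps -/

lemma contDiffOn_det {E : Type*} [NormedAddCommGroup E] [NormedSpace ℝ E] {d : ℕ}
    {A : E → Matrix (Fin d) (Fin d) ℝ} {U : Set E}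
    (hA : ∀ i j, ContDiffOn ℝ ∞ (fun z => A z i j) U) : ContDiffOn ℝ ∞ (fun z => (A z).det) U := by
  simp only [Matrix.det_apply]
  refine ContDiffOn.sum fun σ _ => ContDiffOn.const_smul _ ?_
  exact contDiffOn_prod fun i _ => hA _ _

/-- Cramer's rule: the entries of the inverse are quotients of determinants. -/
lemma contDiffOn_matrix_inv {E : Type*} [NormedAddCommGroup E] [NormedSpace ℝ E] {d : ℕ}
    {A : E → Matrix (Fin d) (Fin d) ℝ} {U : Set E}
    (hA : ∀ i j, ContDiffOn ℝ ∞ (fun z => A z i j) U) (hu : ∀ z ∈ U, IsUnit (A z)) (i j : Fin d) :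
    ContDiffOn ℝ ∞ (fun z => (A z)⁻¹ i j) U := by
  have hdet : ∀ z ∈ U, (A z).det ≠ 0 := fun z hz =>
    ((Matrix.isUnit_iff_isUnit_det _).1 (hu z hz)).ne_zero
  simp only [Matrix.inv_def, Matrix.smul_apply, Ring.inverse_eq_inv', smul_eq_mul,
    Matrix.adjugate_apply]
  refine (ContDiffOn.inv (contDiffOn_det hA) hdet).mul (contDiffOn_det fun k l => ?_)
  by_cases hk : k = j
  · subst hk; simp only [Matrix.updateRow_self]; exact contDiffOn_const
  · simp only [Matrix.updateRow_ne hk]; exact hA k l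

/-- The Fourier coefficients of the image of a smooth bump under a map with an invertible partial
Jacobian decay rapidly. -/
theorem exists_norm_integral_tupleBump_le {m d : ℕ} {f : (Fin m → Torus d) → Torus d}
    {a : Fin m → Fin d → ℝ} {F : (Fin m → Fin d → ℝ) → Fin d → ℝ} {ρ R R' : ℝ} (hρ : 0 ≤ ρ)
    (hρR : ρ < R) (hR : R < 1 / 2) (hRR' : R < R')
    (hF : ContDiffOn ℝ ∞ F (Metric.ball a R'))
    (hFf : ∀ z ∈ Metric.ball a R', proj (F z) = f (projTuple z)) (k : Fin m)
    (hunit : ∀ z ∈ Metric.ball a R', IsUnit (partialJacobian F z k)) (M : ℕ) :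
    ∃ C, ∀ ξ : Fin d → ℤ, freqWeight ξ ^ M *
      ‖∫ Z, (tupleBump ρ R (projTuple a) Z : ℂ) * mFourier (-ξ) (f Z)‖ ≤ C := by
  classical
  set b : (Fin m → Fin d → ℝ) → ℝ := fun z => ∏ k, torusBump ρ R (proj (z k - a k)) with hb
  -- The lifted bump is periodic; b' keeps only the copy around a. It remains smooth because b
  -- vanishes on the shell R ≤ dist z a ≤ 1/2.
  set b' : (Fin m → Fin d → ℝ) → ℂ := fun z =>
    if z ∈ Metric.closedBall a R then (b z : ℂ) else 0 with hb'
  have hbt : ∀ z, tupleBump ρ R (projTuple a) (projTuple z) = b z := fun z => by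
    simp only [tupleBump, hb, projTuple, proj_sub]
  have hbz : ∀ z, R ≤ dist z a → dist z a ≤ 1 / 2 → b z = 0 := fun z h1 h2 => by
    rw [← hbt]
    refine tupleBump_eq_zero hρ hρR hR.le ?_
    rwa [dist_projTuple_of_le h2]
  have hbs : ContDiff ℝ ∞ b := contDiff_prod fun k _ =>
    (contDiff_torusBump ρ R).comp ((contDiff_apply ℝ (Fin d → ℝ) k).sub contDiff_const)
  have hb's : ContDiff ℝ ∞ b' := by
    refine contDiff_iff_contDiffAt.2 fun z => ?_
    rcases lt_or_ge (dist z a) (1 / 2) with hz | hz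
    · refine (Complex.ofRealCLM.contDiff.comp hbs).contDiffAt.congr_of_eventuallyEq ?_
      filter_upwards [Metric.isOpen_ball.mem_nhds (Metric.mem_ball.2 hz)] with w hw
      simp only [hb']
      split_ifs with h
      · rfl
      · rw [Metric.mem_closedBall, not_le] at h
        simp [hbz w h.le (Metric.mem_ball.1 hw).le]
    · refine (contDiffAt_const (c := (0 : ℂ))).congr_of_eventuallyEq ?_
      have : z ∈ (Metric.closedBall a R)ᶜ := by
        rw [mem_compl_iff, Metric.mem_closedBall]; linarith
      filter_upwards [Metric.isClosed_closedBall.isOpen_compl.mem_nhds this] with w hw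
      simp only [hb']
      rw [if_neg hw]
  have hb'0 : ∀ z ∉ Metric.closedBall a R, b' z = 0 := fun z hz => if_neg hz
  -- The i-th vector field is the i-th column of the inverse partial Jacobian, placed in the k-th
  -- block of variables. Invertibility in one block is all that is needed.
  set v : Fin d → Fin d → (Fin m → Fin d → ℝ) → ℝ :=
    fun i j z => (partialJacobian F z k)⁻¹ j i with hv
  have hJs : ∀ i j, ContDiffOn ℝ ∞ (fun z => partialJacobian F z k i j) (Metric.ball a R') := by
    intro i j
    have h1 : ContDiffOn ℝ ∞ (fderiv ℝ F) (Metric.ball a R') :=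
      hF.fderiv_of_isOpen Metric.isOpen_ball (by simp)
    exact contDiffOn_pi.1 (h1.clm_apply contDiffOn_const) i
  have hvs : ∀ i j, ContDiffOn ℝ ∞ (v i j) (Metric.ball a R') := fun i j =>
    contDiffOn_matrix_inv hJs hunit j i
  have hvF : ∀ i, ∀ z ∈ Metric.ball a R',
      ∑ j, v i j z • fderiv ℝ F z (Pi.single k (Pi.single j 1)) = Pi.single i 1 := by
    intro i z hz
    have h1 : partialJacobian F z k * (partialJacobian F z k)⁻¹ = 1 :=
      Matrix.mul_nonsing_inv _ ((Matrix.isUnit_iff_isUnit_det _).1 (hunit z hz))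
    ext l
    have h2 := congrFun (congrFun h1 l) i
    rw [Matrix.mul_apply] at h2
    rw [Finset.sum_apply]
    simp only [Pi.smul_apply, smul_eq_mul, hv]
    rw [Matrix.one_apply] at h2
    rw [Pi.single_apply, ← h2]
    exact Finset.sum_congr rfl fun j _ => mul_comm _ _
  have hmain : ∀ ξ : Fin d → ℤ,
      ∫ Z, (tupleBump ρ R (projTuple a) Z : ℂ) * mFourier (-ξ) (f Z) =
        ∫ z, b' z * oscillation F (fun i => (ξ i : ℝ)) z := by
    intro ξ
    -- The fundamental domain is the unit cube centred at a, so that the support of the bump lies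
    -- inside it.
    set a' : Fin m → Fin d → ℝ := fun k i => a k i - 1 / 2 with ha'
    set box : Set (Fin m → Fin d → ℝ) :=
      univ.pi fun k => univ.pi fun i => Ioc (a' k i) (a' k i + 1) with hbox
    have hmp := measurePreserving_projTuple a'
    have hboxm : MeasurableSet box :=
      MeasurableSet.univ_pi fun k => MeasurableSet.univ_pi fun i => measurableSet_Ioc
    have hclosed : IsClosed (Metric.closedBall (projTuple a) R) := Metric.isClosed_closedBall
    have hsubV : ∀ Z ∈ Metric.closedBall (projTuple a) R,
        ∃ z ∈ Metric.ball a R', projTuple z = Z := by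
      intro Z hZ
      obtain ⟨z, hz, hd⟩ := exists_projTuple_near a Z
      exact ⟨z, by rw [Metric.mem_ball, hd]; exact (Metric.mem_closedBall.1 hZ).trans_lt hRR', hz⟩
    -- Nothing is known about f away from the ball, but there the bump vanishes. On the ball f is
    -- continuous because it lifts to F.
    have hGmeas : AEStronglyMeasurable
        (fun Z => (tupleBump ρ R (projTuple a) Z : ℂ) * mFourier (-ξ) (f Z))
        (volume : Measure (Fin m → Torus d)) := by
      have hcont : ContinuousOn (fun Z => (tupleBump ρ R (projTuple a) Z : ℂ) *
          mFourier (-ξ) (f Z)) (Metric.closedBall (projTuple a) R) := by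
        refine (Complex.continuous_ofReal.comp (continuous_tupleBump ρ R _)).continuousOn.mul
          ((mFourier (-ξ)).continuous.comp_continuousOn ?_)
        intro Z hZ
        rw [Metric.continuousWithinAt_iff]
        intro ε hε
        obtain ⟨z, hz, rfl⟩ := hsubV Z hZ
        have hFc : ContinuousAt F z :=
          hF.continuousOn.continuousAt (Metric.isOpen_ball.mem_nhds hz)
        obtain ⟨δ, hδ, h⟩ := Metric.continuousAt_iff.1 hFc ε hε
        refine ⟨min δ (R' - dist z a), lt_min hδ (by linarith [Metric.mem_ball.1 hz]), ?_⟩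
        intro Z' _ hd
        obtain ⟨z', hz', hd'⟩ := exists_projTuple_near z Z'
        rw [← hd'] at hd
        have hz'' : z' ∈ Metric.ball a R' := by
          have h1 := dist_triangle z' z a
          have h2 := hd.trans_le (min_le_right _ _)
          rw [Metric.mem_ball]; linarith
        rw [← hz', ← hFf z hz, ← hFf z' hz'']
        exact (dist_proj_le _ _).trans_lt (h (hd.trans_le (min_le_left _ _)))
      have hm := (hcont.aestronglyMeasurable hclosed.measurableSet
        (μ := (volume : Measure (Fin m → Torus d))))
      refine ((aestronglyMeasurable_indicator_iff hclosed.measurableSet).2 hm).congr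
        (Eventually.of_forall fun Z => ?_)
      by_cases hZ : Z ∈ Metric.closedBall (projTuple a) R
      · simp [hZ]
      · rw [indicator_of_notMem hZ]
        rw [Metric.mem_closedBall, not_le] at hZ
        simp [tupleBump_eq_zero hρ hρR hR.le hZ.le]
    rw [← hmp.map_eq, integral_map hmp.measurable.aemeasurable (by rw [hmp.map_eq]; exact hGmeas)]
    rw [← integral_indicator hboxm]
    refine integral_congr_ae (Eventually.of_forall fun z => ?_)
    have hdist : z ∈ box → dist z a ≤ 1 / 2 := by
      intro hz
      refine (dist_pi_le_iff (by norm_num)).2 fun k =>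
        (dist_pi_le_iff (by norm_num)).2 fun i => ?_
      have h1 := mem_univ_pi.1 (mem_univ_pi.1 hz k) i
      rw [mem_Ioc, ha'] at h1
      rw [Real.dist_eq, abs_le]
      constructor <;> linarith [h1.1, h1.2]
    simp only
    by_cases hz : z ∈ Metric.closedBall a R
    · have hzb : z ∈ box := by
        refine mem_univ_pi.2 fun k => mem_univ_pi.2 fun i => ?_
        have h1 : dist (z k i) (a k i) ≤ R :=
          ((dist_le_pi_dist (z k) (a k) i).trans (dist_le_pi_dist z a k)).trans
            (Metric.mem_closedBall.1 hz)
        rw [Real.dist_eq, abs_le] at h1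
        rw [mem_Ioc, ha']
        constructor <;> linarith [h1.1, h1.2]
      rw [indicator_of_mem hzb, ← hFf z (Metric.closedBall_subset_ball hRR' hz),
        mFourier_neg_proj_eq_oscillation, hbt]
      simp only [hb', if_pos hz]
    · rw [hb'0 z hz, zero_mul]
      by_cases hzb : z ∈ box
      · rw [indicator_of_mem hzb, hbt, hbz z (not_le.1 hz).le (hdist hzb)]
        simp
      · exact indicator_of_notMem hzb _
  have hosc := exists_norm_integral_oscillation_le (volume : Measure (Fin m → Fin d → ℝ))
    Metric.isOpen_ball hF
    (fun j => Pi.single k (Pi.single j 1)) v hvs hvF (isCompact_closedBall a R)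
    (Metric.closedBall_subset_ball hRR')
  obtain ⟨C₀, hC₀⟩ := hosc 0 b' hb's hb'0
  obtain ⟨C₁, hC₁⟩ := hosc M b' hb's hb'0
  refine ⟨2 ^ M * (C₀ + C₁), fun ξ => ?_⟩
  rw [hmain]
  set I := ‖∫ z, b' z * oscillation F (fun i => (ξ i : ℝ)) z‖ with hI
  have h0 := hC₀ fun i => (ξ i : ℝ)
  have h1 := hC₁ fun i => (ξ i : ℝ)
  rw [norm_intCast_pi] at h0 h1
  rw [pow_zero, one_mul] at h0
  have hI0 : 0 ≤ I := norm_nonneg _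
  have hw : freqWeight ξ ^ M ≤ 2 ^ M * (1 + ‖ξ‖ ^ M) := by
    rw [freqWeight]
    calc (1 + ‖ξ‖) ^ M ≤ (2 * max 1 ‖ξ‖) ^ M := by
          gcongr; linarith [le_max_left 1 ‖ξ‖, le_max_right 1 ‖ξ‖]
      _ = 2 ^ M * (max 1 ‖ξ‖) ^ M := mul_pow _ _ _
      _ ≤ _ := by
        gcongr
        rcases max_cases 1 ‖ξ‖ with ⟨h, _⟩ | ⟨h, _⟩
        · rw [h, one_pow]; linarith [pow_nonneg (norm_nonneg ξ) M]
        · rw [h]; linarith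
  calc freqWeight ξ ^ M * I ≤ 2 ^ M * (1 + ‖ξ‖ ^ M) * I := by gcongr
    _ = 2 ^ M * (I + ‖ξ‖ ^ M * I) := by ring
    _ ≤ _ := by gcongr

end SalemAvoid

end

open Set Filter Topology MeasureTheory
open scoped ENNReal ContDiff

noncomputable section

namespace SalemAvoid

open UnitAddTorus

/-! ### Fourier coefficients of functions -/

/-- The Fourier coefficients of a function on the torus. -/
def fnCoeff {d : ℕ} (g : Torus d → ℂ) (ξ : Fin d → ℤ) : ℂ := ∫ x, mFourier (-ξ) x * g x

/-- The case m = 1 of the previous theorem with the identity as map. Translating the bump multiplies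
coefficients by unimodular numbers, so the constant does not depend on the centre. -/
lemma exists_fnCoeff_torusBump_le {d : ℕ} {ρ R : ℝ} (hρ : 0 ≤ ρ) (hρR : ρ < R) (hR : R < 1 / 2)
    (M : ℕ) :
    ∃ C, ∀ (c : Torus d) (ξ : Fin d → ℤ), freqWeight ξ ^ M *
      ‖fnCoeff (fun x => (torusBump ρ R (x - c) : ℂ)) ξ‖ ≤ C := by
  have hunit : ∀ z ∈ Metric.ball (0 : Fin 1 → Fin d → ℝ) (R + 1),
      IsUnit (partialJacobian (fun z : Fin 1 → Fin d → ℝ => z 0) z 0) := by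
    intro z _
    have : partialJacobian (fun z : Fin 1 → Fin d → ℝ => z 0) z 0 = 1 := by
      ext i j
      have h : fderiv ℝ (fun z : Fin 1 → Fin d → ℝ => z 0) z =
          ContinuousLinearMap.proj (R := ℝ) (φ := fun _ : Fin 1 => Fin d → ℝ) 0 :=
        (ContinuousLinearMap.proj (R := ℝ) (φ := fun _ : Fin 1 => Fin d → ℝ) 0).fderiv
      simp [partialJacobian, h, Pi.single_apply, Matrix.one_apply]
    rw [this]; exact isUnit_one
  obtain ⟨C, hC⟩ := exists_norm_integral_tupleBump_le (m := 1) (d := d) (f := fun Z => Z 0)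
    (a := 0) (F := fun z => z 0) hρ hρR hR (by linarith : R < R + 1)
    (contDiff_apply ℝ (Fin d → ℝ) 0).contDiffOn (fun z _ => rfl) 0 hunit M
  refine ⟨C, fun c ξ => ?_⟩
  have h1 : ∫ Z : Fin 1 → Torus d, (tupleBump ρ R (projTuple 0) Z : ℂ) * mFourier (-ξ) (Z 0) =
      ∫ x : Torus d, (torusBump ρ R x : ℂ) * mFourier (-ξ) x := by
    have hmp := volume_preserving_funUnique (Fin 1) (Torus d)
    rw [← hmp.integral_comp' (g := fun x : Torus d => (torusBump ρ R x : ℂ) * mFourier (-ξ) x)]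
    refine integral_congr_ae (Eventually.of_forall fun Z => ?_)
    have h0 : projTuple (0 : Fin 1 → Fin d → ℝ) = 0 := by
      ext k i; simp [projTuple, proj]
    simp [tupleBump, h0, MeasurableEquiv.funUnique]
  have h2 : fnCoeff (fun x => (torusBump ρ R (x - c) : ℂ)) ξ = mFourier (-ξ) c *
      ∫ x : Torus d, (torusBump ρ R x : ℂ) * mFourier (-ξ) x := by
    rw [fnCoeff, ← integral_const_mul,
      ← integral_add_right_eq_self (fun x => mFourier (-ξ) x * (torusBump ρ R (x - c) : ℂ)) c]
    refine integral_congr_ae (Eventually.of_forall fun x => ?_)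
    simp only [mFourier_add_apply, add_sub_cancel_right]
    ring
  rw [h2, norm_mul, norm_mFourier, one_mul, ← h1]
  exact hC ξ

lemma haarAddCircle_eq_volume :
    (AddCircle.haarAddCircle : Measure UnitAddCircle) = volume := by
  rw [AddCircle.volume_eq_smul_haarAddCircle]; simp

/-- Parseval's identity for the coefficients of a product. -/
lemma hasSum_fnCoeff_mul {d : ℕ} {q g : Torus d → ℂ} (hq : Measurable q) (hg : Measurable g)
    {Kq Kg : ℝ} (hKq : ∀ x, ‖q x‖ ≤ Kq) (hKg : ∀ x, ‖g x‖ ≤ Kg) (ξ : Fin d → ℤ) :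
    HasSum (fun η => fnCoeff q (-η) * fnCoeff g (ξ + η)) (fnCoeff (fun x => q x * g x) ξ) := by
  have hvol : (Measure.pi fun _ : Fin d => (AddCircle.haarAddCircle : Measure UnitAddCircle)) =
      (volume : Measure (Torus d)) := by rw [haarAddCircle_eq_volume]; rfl
  set ν : Measure (Torus d) :=
    Measure.pi fun _ : Fin d => (AddCircle.haarAddCircle : Measure UnitAddCircle) with hν
  have hq2 : MemLp (fun x => (starRingEnd ℂ) (q x)) 2 ν :=
    MemLp.of_bound (Complex.continuous_conj.measurable.comp hq).aestronglyMeasurable Kq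
      (Eventually.of_forall fun x => by simpa using hKq x)
  have hg2 : MemLp (fun x => mFourier (-ξ) x * g x) 2 ν :=
    MemLp.of_bound ((mFourier (-ξ)).continuous.measurable.mul hg).aestronglyMeasurable Kg
      (Eventually.of_forall fun x => by simpa using hKg x)
  let qL := hq2.toLp (fun x => (starRingEnd ℂ) (q x))
  let gL := hg2.toLp (fun x => mFourier (-ξ) x * g x)
  have h := hasSum_prod_mFourierCoeff (d := Fin d) qL gL
  have e1 : ∀ η : Fin d → ℤ, (starRingEnd ℂ) (mFourierCoeff qL η) = fnCoeff q (-η) := by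
    intro η
    have : mFourierCoeff qL η = ∫ x, mFourier (-η) x * (starRingEnd ℂ) (q x) ∂ν :=
      integral_congr_ae (hq2.coeFn_toLp.mono fun x hx => by simp only [smul_eq_mul]; exact congrArg _ hx)
    rw [this, ← integral_conj, fnCoeff, ← hvol]
    refine integral_congr_ae (Eventually.of_forall fun x => ?_)
    simp only [map_mul, Complex.conj_conj, ← mFourier_neg]
  have e2 : ∀ η : Fin d → ℤ, mFourierCoeff gL η = fnCoeff g (ξ + η) := by
    intro η
    have : mFourierCoeff gL η = ∫ x, mFourier (-η) x * (mFourier (-ξ) x * g x) ∂ν :=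
      integral_congr_ae (hg2.coeFn_toLp.mono fun x hx => by simp only [smul_eq_mul]; exact congrArg _ hx)
    rw [this, fnCoeff, ← hvol]
    refine integral_congr_ae (Eventually.of_forall fun x => ?_)
    simp only [neg_add, mFourier_add]
    ring
  have e3 : ∫ t, (starRingEnd ℂ) (qL t) * gL t ∂ν = fnCoeff (fun x => q x * g x) ξ := by
    rw [fnCoeff, ← hvol]
    refine integral_congr_ae ?_
    filter_upwards [hq2.coeFn_toLp, hg2.coeFn_toLp] with x h1 h2
    rw [h1, h2, Complex.conj_conj]
    ring
  simp_rw [e1, e2] at h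
  rw [← e3]
  exact h

/-- The constant `∑ (1+|η|)^{-(d+1)}`. -/
def multConst (d : ℕ) : ℝ := ∑' η : Fin d → ℤ, freqWeight η ^ (-(d + 1 : ℝ))

lemma multConst_nonneg (d : ℕ) : 0 ≤ multConst d :=
  tsum_nonneg fun η => Real.rpow_nonneg (freqWeight_pos η).le _

/-- Multiplication by a function with rapidly decaying coefficients preserves decay. -/
lemma norm_fnCoeff_mul_le {d : ℕ} {q g : Torus d → ℂ} (hq : Measurable q) (hg : Measurable g)
    {Kq Kg : ℝ} (hKq : ∀ x, ‖q x‖ ≤ Kq) (hKg : ∀ x, ‖g x‖ ≤ Kg) {σ A B : ℝ} (hσ : 0 ≤ σ)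
    (hB : ∀ η, ‖fnCoeff q η‖ ≤ B * freqWeight η ^ (-(σ + d + 1)))
    (hA : ∀ ξ, ‖fnCoeff g ξ‖ ≤ A * freqWeight ξ ^ (-σ)) (ξ : Fin d → ℤ) :
    ‖fnCoeff (fun x => q x * g x) ξ‖ ≤ multConst d * B * A * freqWeight ξ ^ (-σ) := by
  have hA0 : 0 ≤ A := by
    have := (norm_nonneg _).trans (hA 0)
    exact nonneg_of_mul_nonneg_left this (Real.rpow_pos_of_pos (freqWeight_pos 0) _)
  have hB0 : 0 ≤ B := by
    have := (norm_nonneg _).trans (hB 0)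
    exact nonneg_of_mul_nonneg_left this (Real.rpow_pos_of_pos (freqWeight_pos 0) _)
  have hsum : Summable fun η : Fin d → ℤ => freqWeight η ^ (-(d + 1 : ℝ)) :=
    summable_freqWeight_rpow (by linarith)
  have hterm : ∀ η, ‖fnCoeff q (-η) * fnCoeff g (ξ + η)‖ ≤
      B * A * freqWeight ξ ^ (-σ) * freqWeight η ^ (-(d + 1 : ℝ)) := by
    intro η
    rw [norm_mul]
    have h1 := hB (-η)
    have h2 := hA (ξ + η)
    rw [freqWeight_neg] at h1
    have hp := freqWeight_pos η
    have hp' := freqWeight_pos ξ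
    have hp'' := freqWeight_pos (ξ + η)
    have h3 : freqWeight η ^ (-(σ + d + 1)) * freqWeight (ξ + η) ^ (-σ) ≤
        freqWeight ξ ^ (-σ) * freqWeight η ^ (-(d + 1 : ℝ)) := by
      have h4 : freqWeight ξ ≤ freqWeight (ξ + η) * freqWeight η := by
        have := freqWeight_add_le (ξ + η) (-η)
        simpa using this
      have h5 : (freqWeight (ξ + η) * freqWeight η) ^ (-σ) ≤ freqWeight ξ ^ (-σ) :=
        Real.rpow_le_rpow_of_nonpos hp' h4 (by linarith)
      rw [Real.mul_rpow hp''.le hp.le] at h5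
      have h6 : freqWeight η ^ (-(σ + d + 1)) =
          freqWeight η ^ (-σ) * freqWeight η ^ (-(d + 1 : ℝ)) := by
        rw [← Real.rpow_add hp]; ring_nf
      rw [h6]
      have h7 : 0 ≤ freqWeight η ^ (-(d + 1 : ℝ)) := Real.rpow_nonneg hp.le _
      nlinarith
    calc ‖fnCoeff q (-η)‖ * ‖fnCoeff g (ξ + η)‖
        ≤ (B * freqWeight η ^ (-(σ + d + 1))) * (A * freqWeight (ξ + η) ^ (-σ)) := by gcongr
      _ = B * A * (freqWeight η ^ (-(σ + d + 1)) * freqWeight (ξ + η) ^ (-σ)) := by ring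
      _ ≤ B * A * (freqWeight ξ ^ (-σ) * freqWeight η ^ (-(d + 1 : ℝ))) := by gcongr
      _ = _ := by ring
  rw [← (hasSum_fnCoeff_mul hq hg hKq hKg ξ).tsum_eq]
  refine (tsum_of_norm_bounded (hsum.hasSum.mul_left _) hterm).trans (le_of_eq ?_)
  rw [multConst]; ring

/-! ### Mollifiers at small scales -/

/-- A smooth bump on `ℝ^d` supported in the unit ball. -/
def euclideanBump (d : ℕ) : ContDiffBump (0 : Fin d → ℝ) := ⟨1 / 2, 1, by norm_num, by norm_num⟩

/-- A smooth probability density supported in the unit ball. -/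
def bumpDensity (d : ℕ) : (Fin d → ℝ) → ℝ := (euclideanBump d).normed volume

lemma bumpDensity_nonneg (d : ℕ) (x : Fin d → ℝ) : 0 ≤ bumpDensity d x :=
  (euclideanBump d).nonneg_normed x

lemma contDiff_bumpDensity (d : ℕ) : ContDiff ℝ ∞ (bumpDensity d) := (euclideanBump d).contDiff_normed

lemma bumpDensity_eq_zero {d : ℕ} {x : Fin d → ℝ} (hx : x ∉ Metric.closedBall (0 : Fin d → ℝ) 1) :
    bumpDensity d x = 0 := by
  by_contra h
  have h1 : x ∈ Function.support ((euclideanBump d).normed volume) := h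
  rw [(euclideanBump d).support_normed_eq] at h1
  exact hx (Metric.ball_subset_closedBall h1)

lemma integrable_bumpDensity (d : ℕ) : Integrable (bumpDensity d) := (euclideanBump d).integrable_normed

lemma integral_bumpDensity (d : ℕ) : ∫ x, bumpDensity d x = 1 := (euclideanBump d).integral_normed

/-- A smooth probability measure on the torus supported in the ball of radius `r`. -/
def mollifier (d : ℕ) (r : ℝ) : Measure (Torus d) :=
  (volume.withDensity fun x => ENNReal.ofReal (bumpDensity d x)).map fun x => proj (r • x)

instance (d : ℕ) : IsProbabilityMeasure
    ((volume : Measure (Fin d → ℝ)).withDensity fun x => ENNReal.ofReal (bumpDensity d x)) := by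
  constructor
  rw [withDensity_apply _ MeasurableSet.univ, Measure.restrict_univ,
    ← ofReal_integral_eq_lintegral_ofReal (integrable_bumpDensity d)
      (Eventually.of_forall (bumpDensity_nonneg d)), integral_bumpDensity, ENNReal.ofReal_one]

lemma measurable_proj_smul {d : ℕ} (r : ℝ) : Measurable fun x : Fin d → ℝ => proj (r • x) :=
  (continuous_proj.comp (continuous_const_smul r)).measurable

instance (d : ℕ) (r : ℝ) : IsProbabilityMeasure (mollifier d r) :=
  Measure.isProbabilityMeasure_map (measurable_proj_smul r).aemeasurable

lemma mollifier_compl_closedBall {d : ℕ} {r : ℝ} (hr : 0 ≤ r) :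
    mollifier d r (Metric.closedBall 0 r)ᶜ = 0 := by
  rw [mollifier, Measure.map_apply (measurable_proj_smul r)
    Metric.isClosed_closedBall.isOpen_compl.measurableSet]
  rw [withDensity_apply_eq_zero (contDiff_bumpDensity d).continuous.measurable.ennreal_ofReal]
  refine measure_mono_null (t := ∅) ?_ measure_empty
  rintro x ⟨hx1, hx2⟩
  exfalso
  have hx3 : x ∈ Metric.closedBall (0 : Fin d → ℝ) 1 := by
    by_contra h
    exact hx1 (by simp [bumpDensity_eq_zero h])
  refine hx2 ?_
  rw [mem_closedBall_zero_iff] at hx3 ⊢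
  refine (norm_proj_le _).trans ?_
  rw [norm_smul, Real.norm_eq_abs, abs_of_nonneg hr]
  exact mul_le_of_le_one_right hr hx3

lemma fourierCoeff_mollifier {d : ℕ} (r : ℝ) (ξ : Fin d → ℤ) :
    fourierCoeff (mollifier d r) ξ =
      ∫ x, (bumpDensity d x : ℂ) * oscillation (fun x : Fin d → ℝ => x) (fun i => r * ξ i) x := by
  rw [fourierCoeff, mollifier, integral_map (measurable_proj_smul r).aemeasurable
    (mFourier (-ξ)).continuous.aestronglyMeasurable,
    integral_withDensity_eq_integral_toReal_smul
      (contDiff_bumpDensity d).continuous.measurable.ennreal_ofReal (by simp)]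
  refine integral_congr_ae (Eventually.of_forall fun x => ?_)
  simp only [ENNReal.toReal_ofReal (bumpDensity_nonneg d x), Complex.real_smul]
  congr 1
  rw [mFourier_neg_proj_eq_oscillation (fun x : Fin d → ℝ => r • x), oscillation, oscillation]
  congr 3
  refine Finset.sum_congr rfl fun i _ => ?_
  simp; ring

/-- The coefficient is the Euclidean Fourier transform of one fixed bump evaluated at rξ, which is
why the constant is uniform in r. -/
lemma exists_fourierCoeff_mollifier_le (d M : ℕ) :
    ∃ C, 0 < C ∧ ∀ r : ℝ, 0 ≤ r → ∀ ξ : Fin d → ℤ,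
      (r * ‖ξ‖) ^ M * ‖fourierCoeff (mollifier d r) ξ‖ ≤ C := by
  obtain ⟨C, hC⟩ := exists_norm_integral_oscillation_le (volume : Measure (Fin d → ℝ))
    (F := fun x : Fin d → ℝ => x) isOpen_univ contDiff_id.contDiffOn
    (fun j => Pi.single j (1 : ℝ)) (fun i j _ => if i = j then 1 else 0)
    (fun i j => contDiffOn_const) (fun i z _ => by simp)
    (isCompact_closedBall (0 : Fin d → ℝ) 1) (subset_univ _) M (fun x => (bumpDensity d x : ℂ))
    (Complex.ofRealCLM.contDiff.comp (contDiff_bumpDensity d))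
    (fun z hz => by simp [bumpDensity_eq_zero hz])
  refine ⟨max C 1, by positivity, fun r hr ξ => le_trans ?_ (le_max_left _ _)⟩
  have h := hC fun i => r * ξ i
  rw [← fourierCoeff_mollifier] at h
  have hn : ‖(fun i => r * (ξ i : ℝ))‖ = r * ‖ξ‖ := by
    have : (fun i => r * (ξ i : ℝ)) = r • fun i => (ξ i : ℝ) := rfl
    rw [this, norm_smul, norm_intCast_pi, Real.norm_eq_abs, abs_of_nonneg hr]
  rwa [hn] at h

lemma norm_fourierCoeff_sub_one_le {d : ℕ} {μ : Measure (Torus d)} [IsProbabilityMeasure μ] {r : ℝ}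
    (h : μ (Metric.closedBall 0 r)ᶜ = 0) (ξ : Fin d → ℤ) :
    ‖fourierCoeff μ ξ - 1‖ ≤ 2 * Real.pi * d * ‖ξ‖ * r := by
  have h1 : fourierCoeff μ ξ - 1 = ∫ x, (mFourier (-ξ) x - 1) ∂μ := by
    rw [integral_sub (integrable_mFourier μ _) (integrable_const _)]
    simp [fourierCoeff]
  rw [h1]
  have h2 : ∀ᵐ x ∂μ, ‖mFourier (-ξ) x - 1‖ ≤ 2 * Real.pi * d * ‖ξ‖ * r := by
    have h3 : ∀ᵐ x ∂μ, x ∈ Metric.closedBall (0 : Torus d) r := by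
      rw [ae_iff]; exact h
    filter_upwards [h3] with x hx
    refine (norm_mFourier_sub_one_le (-ξ) x).trans ?_
    rw [norm_neg]
    gcongr
    simpa using hx
  have := norm_integral_le_of_norm_le_const h2
  simpa using this

end SalemAvoid

end

open Set Filter Topology MeasureTheory
open scoped ENNReal ContDiff

noncomputable section

namespace SalemAvoid

open UnitAddTorus

/-! ### Local control of the pattern function -/

lemma isOpen_setOf_injective_tuple {m d : ℕ} :
    IsOpen {Z : Fin m → Torus d | Function.Injective Z} := by
  have : {Z : Fin m → Torus d | Function.Injective Z} =
      ⋂ i, ⋂ j, {Z : Fin m → Torus d | i ≠ j → Z i ≠ Z j} := by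
    ext Z
    simp only [mem_iInter, mem_ofPred_eq]
    exact ⟨fun h i j hij hZ => hij (h hZ), fun h i j hZ => by_contra fun hij => h i j hij hZ⟩
  rw [this]
  refine isOpen_iInter_of_finite fun i => isOpen_iInter_of_finite fun j => ?_
  by_cases hij : i = j
  · simp [hij]
  · simp only [ne_eq, hij, not_false_eq_true, forall_const]
    exact isOpen_ne_fun (continuous_apply i) (continuous_apply j)

lemma fderiv_single_eq_mulVec {m d : ℕ} (F : (Fin m → Fin d → ℝ) → Fin d → ℝ)
    (a : Fin m → Fin d → ℝ) (k : Fin m) (v : Fin d → ℝ) :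
    fderiv ℝ F a (Pi.single k v) = (partialJacobian F a k).mulVec v := by
  have hv : (Pi.single k v : Fin m → Fin d → ℝ) =
      ∑ j, v j • (Pi.single k (Pi.single j (1 : ℝ)) : Fin m → Fin d → ℝ) := by
    ext k' j'
    rw [Finset.sum_apply, Finset.sum_apply]
    by_cases hk : k' = k
    · subst hk; simp [Pi.single_apply]
    · simp [Pi.single_eq_of_ne hk]
  ext i
  rw [hv, map_sum, Finset.sum_apply, Matrix.mulVec, dotProduct]
  exact Finset.sum_congr rfl fun j _ => by simp [partialJacobian, mul_comm]

lemma exists_norm_le_fderiv_single {m d : ℕ} {F : (Fin m → Fin d → ℝ) → Fin d → ℝ}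
    {a : Fin m → Fin d → ℝ} (h : ∀ k, IsUnit (partialJacobian F a k)) :
    ∃ C : ℝ, 0 < C ∧ ∀ k v, ‖v‖ ≤ C * ‖fderiv ℝ F a (Pi.single k v)‖ := by
  set B : Fin m → (Fin d → ℝ) →L[ℝ] (Fin d → ℝ) := fun k =>
    LinearMap.toContinuousLinearMap (Matrix.mulVecLin (partialJacobian F a k)⁻¹) with hB
  refine ⟨1 + ∑ k, ‖B k‖, by positivity, fun k v => ?_⟩
  have h1 : v = B k (fderiv ℝ F a (Pi.single k v)) := by
    rw [fderiv_single_eq_mulVec, hB]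
    simp [Matrix.mulVec_mulVec, Matrix.nonsing_inv_mul _ ((Matrix.isUnit_iff_isUnit_det _).1 (h k))]
  calc ‖v‖ = ‖B k (fderiv ℝ F a (Pi.single k v))‖ := by rw [← h1]
    _ ≤ ‖B k‖ * ‖fderiv ℝ F a (Pi.single k v)‖ := (B k).le_opNorm _
    _ ≤ _ := by
        gcongr
        have := Finset.single_le_sum (f := fun k => ‖B k‖) (fun _ _ => norm_nonneg _)
          (Finset.mem_univ k)
        linarith

/-- Near a point of `V` with distinct entries, `f` is Lipschitz, it is expanding in each variable,
and the exponentials `e(-ξ · f)` have rapidly decaying averages. -/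
theorem exists_local_control {m d : ℕ} (hm : 0 < m) {V : Set (Fin m → Torus d)} (hV : IsOpen V)
    {f : (Fin m → Torus d) → Torus d} (hf : IsSmoothOn f V)
    (hJ : PartialJacobiansInvertibleOn f V) {x : Fin m → Torus d} (hx : x ∈ V)
    (hinj : Function.Injective x) :
    ∃ R₀ Λ c : ℝ, 0 < R₀ ∧ R₀ ≤ 1 / 4 ∧ 0 < Λ ∧ 0 < c ∧
      (∀ Z ∈ Metric.closedBall x R₀, ∀ Z' ∈ Metric.closedBall x R₀,
        dist (f Z) (f Z') ≤ Λ * dist Z Z') ∧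
      (∀ k, ∀ Z ∈ Metric.closedBall x R₀, ∀ u, Function.update Z k u ∈ Metric.closedBall x R₀ →
        c * dist (Z k) u ≤ dist (f Z) (f (Function.update Z k u))) ∧
      ∀ ρ R, 0 ≤ ρ → ρ < R → R < R₀ → ∀ M : ℕ, ∃ C, ∀ ξ : Fin d → ℤ, freqWeight ξ ^ M *
        ‖∫ Z, (tupleBump ρ R x Z : ℂ) * mFourier (-ξ) (f Z)‖ ≤ C := by
  obtain ⟨a, ha, -⟩ := exists_projTuple_near 0 x
  obtain ⟨F, U, hU, hFU, hFf⟩ := hf a (ha ▸ hx)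
  have hW : interior U ∩ projTuple ⁻¹' (V ∩ {Z | Function.Injective Z}) ∈ 𝓝 a :=
    inter_mem (interior_mem_nhds.2 hU) (continuous_projTuple.continuousAt.preimage_mem_nhds
      ((hV.inter isOpen_setOf_injective_tuple).mem_nhds ⟨ha ▸ hx, by rw [ha]; exact hinj⟩))
  obtain ⟨R₁, hR₁, hR₁W⟩ := Metric.mem_nhds_iff.1 hW
  have hsub : Metric.ball a R₁ ⊆ U := fun z hz => interior_subset (hR₁W hz).1
  have hFb : ContDiffOn ℝ ∞ F (Metric.ball a R₁) := hFU.mono hsub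
  have hFfb : ∀ z ∈ Metric.ball a R₁, proj (F z) = f (projTuple z) := fun z hz => hFf z (hsub hz)
  have hunit : ∀ k, ∀ z ∈ Metric.ball a R₁, IsUnit (partialJacobian F z k) := fun k z hz =>
    hJ z (hR₁W hz).2.1 (hR₁W hz).2.2 F
      ⟨Metric.ball a R₁, Metric.isOpen_ball.mem_nhds hz, hFb, hFfb⟩ k
  obtain ⟨C, hC, hCv⟩ := exists_norm_le_fderiv_single fun k =>
    hunit k a (Metric.mem_ball_self hR₁)
  have hstrict : HasStrictFDerivAt F (fderiv ℝ F a) a :=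
    (hFb.contDiffAt (Metric.ball_mem_nhds a hR₁)).hasStrictFDerivAt (by simp)
  -- The derivative at a expands each block by at least 1/C = 2c. Strict differentiability with
  -- error c still leaves expansion by c.
  set c : ℝ := 1 / (2 * C) with hc
  have hc0 : 0 < c := by positivity
  have hev := hstrict.isLittleO.def hc0
  obtain ⟨R₂, hR₂, hR₂e⟩ := Metric.eventually_nhds_iff.1 hev
  set Λ : ℝ := ‖fderiv ℝ F a‖ + c with hΛ
  have hΛ0 : 0 < Λ := by positivity
  -- The bounds keep within the domain of the lift and the range of strict differentiability. They
  -- also make distances in domain and target at most 1/2, where the projection to the torus is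
  -- isometric.
  set R₀ : ℝ := min (min (R₁ / 2) (R₂ / 2)) (min (1 / 4) (1 / (4 * Λ))) with hR₀
  have hR₀0 : 0 < R₀ := by positivity
  have hR₀1 : R₀ < R₁ := by
    have : R₀ ≤ R₁ / 2 := (min_le_left _ _).trans (min_le_left _ _)
    linarith
  have hR₀2 : R₀ < R₂ := by
    have : R₀ ≤ R₂ / 2 := (min_le_left _ _).trans (min_le_right _ _)
    linarith
  have hR₀4 : R₀ ≤ 1 / 4 := (min_le_right _ _).trans (min_le_left _ _)
  have hR₀Λ : Λ * (2 * R₀) ≤ 1 / 2 := by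
    have : R₀ ≤ 1 / (4 * Λ) := (min_le_right _ _).trans (min_le_right _ _)
    rw [le_div_iff₀ (by positivity)] at this
    linarith
  have hlin : ∀ z z', dist z a ≤ R₀ → dist z' a ≤ R₀ →
      ‖F z - F z' - fderiv ℝ F a (z - z')‖ ≤ c * ‖z - z'‖ := fun z z' hz hz' =>
    hR₂e (y := (z, z')) (by rw [Prod.dist_eq]; exact max_lt (hz.trans_lt hR₀2) (hz'.trans_lt hR₀2))
  have hup : ∀ z z', dist z a ≤ R₀ → dist z' a ≤ R₀ → dist (F z) (F z') ≤ Λ * dist z z' := by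
    intro z z' hz hz'
    rw [dist_eq_norm, dist_eq_norm]
    have h1 := hlin z z' hz hz'
    have h2 := (fderiv ℝ F a).le_opNorm (z - z')
    have h3 := norm_le_norm_add_norm_sub' (F z - F z') (fderiv ℝ F a (z - z'))
    rw [hΛ, add_mul]
    linarith
  have hdist : ∀ z z', dist z a ≤ R₀ → dist z' a ≤ R₀ → dist z z' ≤ 2 * R₀ := fun z z' hz hz' => by
    have := dist_triangle_right z z' a
    linarith
  have hhalf : ∀ z z', dist z a ≤ R₀ → dist z' a ≤ R₀ →
      dist (f (projTuple z)) (f (projTuple z')) = dist (F z) (F z') := by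
    intro z z' hz hz'
    rw [← hFfb z (hz.trans_lt hR₀1), ← hFfb z' (hz'.trans_lt hR₀1)]
    refine dist_proj_of_le ((hup z z' hz hz').trans (le_trans ?_ hR₀Λ))
    exact mul_le_mul_of_nonneg_left (hdist z z' hz hz') hΛ0.le
  refine ⟨R₀, Λ, c, hR₀0, hR₀4, hΛ0, hc0, ?_, ?_, ?_⟩
  · intro Z hZ Z' hZ'
    obtain ⟨z, rfl, hz⟩ := exists_projTuple_near a Z
    obtain ⟨z', rfl, hz'⟩ := exists_projTuple_near a Z'
    rw [ha] at hz hz'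
    have hz0 := hz.trans_le (Metric.mem_closedBall.1 hZ)
    have hz0' := hz'.trans_le (Metric.mem_closedBall.1 hZ')
    rw [hhalf z z' hz0 hz0', dist_projTuple_of_le ((hdist z z' hz0 hz0').trans (by linarith))]
    exact hup z z' hz0 hz0'
  · intro k Z hZ u hu
    obtain ⟨z, rfl, hz⟩ := exists_projTuple_near a Z
    obtain ⟨v, rfl, hv⟩ := exists_proj_near (a k) u
    rw [ha] at hz
    have hz0 := hz.trans_le (Metric.mem_closedBall.1 hZ)
    have hv0 : dist v (a k) ≤ R₀ := by
      have h1 := (dist_pi_le_iff hR₀0.le).1 (Metric.mem_closedBall.1 hu) k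
      rw [hv]
      rw [Function.update_self, ← ha] at h1
      exact h1
    have hupd : Function.update (projTuple z) k (proj v) = projTuple (Function.update z k v) := by
      ext1 k'
      by_cases hk : k' = k
      · subst hk; simp [projTuple]
      · simp [projTuple, hk]
    have hz' : dist (Function.update z k v) a ≤ R₀ := by
      refine (dist_pi_le_iff hR₀0.le).2 fun k' => ?_
      by_cases hk : k' = k
      · subst hk; simpa using hv0
      · rw [Function.update_of_ne hk]; exact ((dist_le_pi_dist z a k').trans hz0)
    rw [hupd, hhalf _ _ hz0 hz', dist_eq_norm (F z)]
    have hdiff : z - Function.update z k v = Pi.single k (z k - v) := by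
      ext1 k'
      by_cases hk : k' = k
      · subst hk; simp
      · simp [hk]
    have h1 := hlin _ _ hz0 hz'
    rw [hdiff, Pi.norm_single] at h1
    have h2 := hCv k (z k - v)
    have h3 := norm_le_norm_add_norm_sub' (fderiv ℝ F a (Pi.single k (z k - v)))
      (F z - F (Function.update z k v))
    rw [norm_sub_rev] at h1
    have h4 : dist (projTuple z k) (proj v) ≤ ‖z k - v‖ := by
      rw [← dist_eq_norm]; exact dist_proj_le _ _
    have h5 : 2 * c * ‖z k - v‖ ≤ ‖fderiv ℝ F a (Pi.single k (z k - v))‖ := by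
      have : 2 * c = 1 / C := by rw [hc]; field_simp
      rw [this, one_div_mul_eq_div, div_le_iff₀ hC]
      linarith
    have h6 := mul_le_mul_of_nonneg_left h4 hc0.le
    linarith
  · intro ρ R hρ hρR hR M
    rw [← ha]
    exact exists_norm_integral_tupleBump_le hρ hρR (by linarith) (hR.trans hR₀1) hFb hFfb ⟨0, hm⟩
      (hunit _) M

end SalemAvoid

end

open Set Filter Topology MeasureTheory
open scoped ENNReal ContDiff

noncomputable section

namespace SalemAvoid

open UnitAddTorus

/-! ### Convolution with a mollifier -/

lemma fourierCoeff_conv {d : ℕ} (μ ν : Measure (Torus d)) [IsFiniteMeasure μ] [IsFiniteMeasure ν]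
    (ξ : Fin d → ℤ) : fourierCoeff (μ.conv ν) ξ = fourierCoeff μ ξ * fourierCoeff ν ξ := by
  rw [fourierCoeff, Measure.conv, integral_map measurable_add.aemeasurable
    (mFourier (-ξ)).continuous.aestronglyMeasurable]
  simp only [mFourier_add_apply]
  exact integral_prod_mul _ _

lemma support_conv_subset {d : ℕ} {μ ν : Measure (Torus d)} [SFinite μ] [SFinite ν] {r : ℝ}
    (hμ : μ (Metric.closedBall 0 r)ᶜ = 0) {A : Set (Torus d)} (hν : ν Aᶜ = 0) :
    (μ.conv ν).support ⊆ Metric.cthickening r A := by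
  refine Measure.support_subset_of_isClosed Metric.isClosed_cthickening ?_
  rw [mem_ae_iff, Measure.conv,
    Measure.map_apply measurable_add Metric.isClosed_cthickening.isOpen_compl.measurableSet]
  refine measure_mono_null (t := ((Metric.closedBall 0 r)ᶜ ×ˢ univ) ∪ (univ ×ˢ Aᶜ)) ?_ ?_
  · rintro ⟨a, b⟩ hab
    by_contra h
    simp only [mem_union, mem_prod, mem_univ, and_true, true_and, not_or, notMem_compl_iff] at h
    refine hab (Metric.mem_cthickening_of_dist_le (a + b) b r A h.2 ?_)
    simpa using h.1
  · refine measure_union_null ?_ ?_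
    · rw [Measure.prod_prod, hμ, zero_mul]
    · rw [Measure.prod_prod, hν, mul_zero]

lemma norm_fourierCoeff_le_one {d : ℕ} (μ : Measure (Torus d)) [IsProbabilityMeasure μ]
    (ξ : Fin d → ℤ) : ‖fourierCoeff μ ξ‖ ≤ 1 := by
  simpa using norm_fourierCoeff_le μ ξ

/-- Mollification at scale r effectively cuts frequencies at 1/r, so a weight of order t costs at
most r^(-t). -/
lemma exists_mollifier_weight_le (d : ℕ) {t : ℝ} (ht : 0 ≤ t) :
    ∃ C, 0 < C ∧ ∀ r : ℝ, 0 < r → r ≤ 1 → ∀ ξ : Fin d → ℤ,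
      freqWeight ξ ^ t * ‖fourierCoeff (mollifier d r) ξ‖ ≤ C * r ^ (-t) := by
  obtain ⟨M, hM⟩ := exists_nat_ge t
  obtain ⟨C, hC, h⟩ := exists_fourierCoeff_mollifier_le d M
  refine ⟨1 + 2 ^ M * (1 + C), by positivity, fun r hr hr1 ξ => ?_⟩
  have hw := freqWeight_pos ξ
  have h1 := norm_fourierCoeff_le_one (mollifier d r) ξ
  have h0 := norm_nonneg (fourierCoeff (mollifier d r) ξ)
  suffices hs : (r * freqWeight ξ) ^ t * ‖fourierCoeff (mollifier d r) ξ‖ ≤ 1 + 2 ^ M * (1 + C) by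
    rw [Real.mul_rpow hr.le hw.le] at hs
    have hrt : 0 < r ^ t := Real.rpow_pos_of_pos hr t
    rw [Real.rpow_neg hr.le, ← div_eq_mul_inv, le_div_iff₀ hrt]
    linarith
  rcases le_total (r * freqWeight ξ) 1 with hle | hle
  · have h2 : (r * freqWeight ξ) ^ t ≤ 1 := Real.rpow_le_one (by positivity) hle ht
    have h3 : (r * freqWeight ξ) ^ t * ‖fourierCoeff (mollifier d r) ξ‖ ≤ 1 * 1 := by gcongr
    have : 0 ≤ 2 ^ M * (1 + C) := by positivity
    linarith
  · have h2 : (r * freqWeight ξ) ^ t ≤ (r * freqWeight ξ) ^ M := by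
      rw [← Real.rpow_natCast]; exact Real.rpow_le_rpow_of_exponent_le hle hM
    have h3 : (r * freqWeight ξ) ^ M ≤ 2 ^ M * (1 + (r * ‖ξ‖) ^ M) := by
      have h4 : r * freqWeight ξ ≤ 2 * max 1 (r * ‖ξ‖) := by
        rw [freqWeight, mul_add, mul_one]
        have := le_max_left 1 (r * ‖ξ‖)
        have := le_max_right 1 (r * ‖ξ‖)
        linarith
      calc (r * freqWeight ξ) ^ M ≤ (2 * max 1 (r * ‖ξ‖)) ^ M := by gcongr
        _ = 2 ^ M * (max 1 (r * ‖ξ‖)) ^ M := mul_pow _ _ _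
        _ ≤ 2 ^ M * (1 + (r * ‖ξ‖) ^ M) := by
            gcongr
            have h5 : 0 ≤ (r * ‖ξ‖) ^ M := by positivity
            rcases max_cases 1 (r * ‖ξ‖) with h6 | h6
            · rw [h6.1, one_pow]; linarith
            · rw [h6.1]; linarith
    calc (r * freqWeight ξ) ^ t * ‖fourierCoeff (mollifier d r) ξ‖
        ≤ 2 ^ M * (1 + (r * ‖ξ‖) ^ M) * ‖fourierCoeff (mollifier d r) ξ‖ := by
          gcongr; exact h2.trans h3
      _ = 2 ^ M * (‖fourierCoeff (mollifier d r) ξ‖ +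
          (r * ‖ξ‖) ^ M * ‖fourierCoeff (mollifier d r) ξ‖) := by ring
      _ ≤ 2 ^ M * (1 + C) := by gcongr; exact h r hr.le ξ
      _ ≤ _ := by linarith

/-! ### Random samples -/

/-- The scale `N^{-1/s}` at which `N` balls make up a set of dimension `s`. -/
def scale (s : ℝ) (N : ℕ) : ℝ := (N : ℝ) ^ (-(1 / s))

lemma scale_pos {s : ℝ} {N : ℕ} (hN : 0 < N) : 0 < scale s N :=
  Real.rpow_pos_of_pos (by exact_mod_cast hN) _

lemma scale_le_one {s : ℝ} (hs : 0 < s) {N : ℕ} (hN : 0 < N) : scale s N ≤ 1 :=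
  Real.rpow_le_one_of_one_le_of_nonpos (by exact_mod_cast hN) (by
    have : 0 < 1 / s := by positivity
    linarith)

lemma scale_rpow {s : ℝ} (N : ℕ) (t : ℝ) : scale s N ^ t = (N : ℝ) ^ (-(t / s)) := by
  rw [scale, ← Real.rpow_mul (Nat.cast_nonneg N)]; congr 1; ring

lemma tendsto_natCast_rpow_neg {y : ℝ} (hy : y < 0) :
    Tendsto (fun N : ℕ => (N : ℝ) ^ y) atTop (𝓝 0) := by
  have := (tendsto_rpow_neg_atTop (y := -y) (by linarith)).comp tendsto_natCast_atTop_atTop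
  simpa [Function.comp_def] using this

lemma tendsto_scale {s : ℝ} (hs : 0 < s) : Tendsto (scale s) atTop (𝓝 0) :=
  tendsto_natCast_rpow_neg (by have : 0 < 1 / s := by positivity
                               linarith)

lemma eventually_card_mul_exp_lt_one (d D : ℕ) {γ b : ℝ} (hγ : 0 < γ) (hb : 0 < b) :
    ∀ᶠ N : ℕ in atTop, ((freqBox d (N ^ D)).card : ℝ) *
      (4 * Real.exp (-(b * (N : ℝ) ^ (2 * γ)))) < 1 := by
  have h1 : Tendsto (fun N : ℕ => (4 * 3 ^ d : ℝ) * (((N : ℝ) ^ (2 * γ)) ^ ((D * d : ℝ) / (2 * γ)) *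
      Real.exp (-b * (N : ℝ) ^ (2 * γ)))) atTop (𝓝 (4 * 3 ^ d * 0)) :=
    (((tendsto_rpow_mul_exp_neg_mul_atTop_nhds_zero _ b hb).comp
      ((tendsto_rpow_atTop (by positivity)).comp tendsto_natCast_atTop_atTop))).const_mul _
  rw [mul_zero] at h1
  filter_upwards [h1.eventually_lt_const one_pos, eventually_ge_atTop 1] with N hN hN1
  refine lt_of_le_of_lt ?_ hN
  have hN0 : (1 : ℝ) ≤ N := by exact_mod_cast hN1
  have h2 : ((N : ℝ) ^ (2 * γ)) ^ ((D * d : ℝ) / (2 * γ)) = ((N : ℝ) ^ D) ^ d := by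
    rw [← Real.rpow_mul (by positivity), mul_div_cancel₀ _ (by positivity), ← pow_mul,
      ← Nat.cast_mul, Real.rpow_natCast]
  rw [card_freqBox, h2, neg_mul]
  push_cast
  have h3 : (2 * (N : ℝ) ^ D + 1) ^ d ≤ (3 * (N : ℝ) ^ D) ^ d := by
    gcongr
    have := one_le_pow₀ hN0 (n := D)
    linarith
  calc (2 * (N : ℝ) ^ D + 1) ^ d * (4 * Real.exp (-(b * (N : ℝ) ^ (2 * γ))))
      ≤ (3 * (N : ℝ) ^ D) ^ d * (4 * Real.exp (-(b * (N : ℝ) ^ (2 * γ)))) := by gcongr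
    _ = _ := by rw [mul_pow]; ring

/-- A random sample makes all mollified Fourier coefficients close to their means. -/
theorem exists_sample {d m : ℕ} (hm : 0 < m) {s s' : ℝ} (hs : 0 ≤ s) (hss : s < s') (hsd : s' ≤ d)
    {C : ℝ} (hC : 0 < C) (K : ℝ) {δ : ℝ} (hδ : 0 < δ) :
    ∀ᶠ N : ℕ in atTop, ∀ G : (Fin d → ℤ) → (Fin m × Fin N → Torus d) → ℂ,
      (∀ ξ, Measurable (G ξ)) → (∀ ξ X, ‖G ξ X‖ ≤ K) →
      (∀ ξ X i u, ‖G ξ (Function.update X i u) - G ξ X‖ ≤ C / N) →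
      ∃ X, ∀ ξ, freqWeight ξ ^ (s / 2) * ‖fourierCoeff (mollifier d (scale s' N)) ξ‖ *
        ‖G ξ X - ∫ Y, G ξ Y‖ ≤ δ := by
  have hs' : 0 < s' := hs.trans_lt hss
  obtain ⟨C₁, hC₁, h₁⟩ := exists_mollifier_weight_le d (t := s / 2) (by linarith)
  obtain ⟨C₂, hC₂, h₂⟩ := exists_mollifier_weight_le d (t := d + 1) (by positivity)
  -- The weight costs N^(s/(2s')) and the deviation allowed is N^(-1/2+γ). Since s/(2s') - 1/2 =
  -- -2γ, the product is N^(-γ).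
  set γ : ℝ := (1 - s / s') / 4 with hγ
  have hγ0 : 0 < γ := by
    have : s / s' < 1 := (div_lt_one hs').2 hss
    rw [hγ]; linarith
  -- Beyond N^D no concentration is needed. Decay of the mollifier to order d + 1 costs
  -- N^((d+1)/s'), the weight is at most of order d, and the spare power of the frequency gains
  -- N^(-D). At least one power of N is left over.
  obtain ⟨D, hD⟩ := exists_nat_ge ((d + 1) / s' + 1)
  have hlim1 : Tendsto (fun N : ℕ => C₁ * (N : ℝ) ^ (-γ)) atTop (𝓝 (C₁ * 0)) :=
    (tendsto_natCast_rpow_neg (by linarith)).const_mul _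
  have hlim2 : Tendsto (fun N : ℕ => C₂ * (2 * |K|) * (N : ℝ) ^ (-1 : ℝ)) atTop
      (𝓝 (C₂ * (2 * |K|) * 0)) :=
    (tendsto_natCast_rpow_neg (by norm_num)).const_mul _
  rw [mul_zero] at hlim1 hlim2
  filter_upwards [eventually_card_mul_exp_lt_one d D hγ0
      (by positivity : 0 < 1 / (8 * m * C ^ 2)), eventually_ge_atTop 1,
    hlim1.eventually_le_const hδ, hlim2.eventually_le_const hδ] with N hcard hN1 hN2 hN3
  intro G hG hGK hGd
  have hN0 : (0 : ℝ) < N := by exact_mod_cast hN1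
  have hN1' : (1 : ℝ) ≤ N := by exact_mod_cast hN1
  have : Nonempty (Fin m × Fin N) := ⟨(⟨0, hm⟩, ⟨0, hN1⟩)⟩
  have hr := scale_pos (s := s') hN1
  have hr1 := scale_le_one hs' hN1
  set a : ℝ := (N : ℝ) ^ (-(1 / 2) + γ) with ha
  have ha0 : 0 ≤ a := by positivity
  have hexp : a ^ 2 / (8 * (Fintype.card (Fin m × Fin N) * (C / N) ^ 2)) =
      1 / (8 * m * C ^ 2) * (N : ℝ) ^ (2 * γ) := by
    have h1 : a ^ 2 = (N : ℝ) ^ (2 * γ) / N := by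
      rw [ha, ← Real.rpow_natCast, ← Real.rpow_mul hN0.le]
      nth_rewrite 3 [← Real.rpow_one (N : ℝ)]
      rw [← Real.rpow_sub hN0]
      congr 1
      push_cast; ring
    have hm' : (m : ℝ) ≠ 0 := by positivity
    rw [h1, Fintype.card_prod, Fintype.card_fin, Fintype.card_fin]
    push_cast
    field_simp
  obtain ⟨X, hX⟩ := exists_forall_norm_sub_integral_le (volume : Measure (Torus d))
    (freqBox d (N ^ D)) (by positivity : 0 < C / N) ha0 hG hGK hGd (by rw [hexp]; exact hcard)
  refine ⟨X, fun ξ => ?_⟩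
  have hw := freqWeight_pos ξ
  have hw1 := one_le_freqWeight ξ
  by_cases hξ : ξ ∈ freqBox d (N ^ D)
  · refine le_trans ?_ hN2
    calc freqWeight ξ ^ (s / 2) * ‖fourierCoeff (mollifier d (scale s' N)) ξ‖ *
          ‖G ξ X - ∫ Y, G ξ Y‖
        ≤ (C₁ * scale s' N ^ (-(s / 2))) * a := by
          have h3 := h₁ _ hr hr1 ξ
          exact mul_le_mul h3 (hX ξ hξ) (norm_nonneg _) (le_trans (by positivity) h3)
      _ = C₁ * (N : ℝ) ^ (-γ) := by
          rw [scale_rpow, ha, mul_assoc, ← Real.rpow_add hN0]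
          congr 2
          rw [hγ]; field_simp; ring
  · refine le_trans ?_ hN3
    rw [mem_freqBox, not_le] at hξ
    have hwN : (N : ℝ) ^ (D : ℝ) ≤ freqWeight ξ := by
      rw [Real.rpow_natCast]
      have := norm_le_freqWeight ξ
      push_cast at hξ
      linarith
    have hK0 : ‖G ξ X - ∫ Y, G ξ Y‖ ≤ 2 * |K| := by
      have h3 : ‖∫ Y, G ξ Y‖ ≤ |K| := by
        have := norm_integral_le_of_norm_le_const (μ := (volume : Measure (Fin m × Fin N → Torus d)))
          (Eventually.of_forall fun Y => (hGK ξ Y).trans (le_abs_self K))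
        simpa using this
      have h4 := (hGK ξ X).trans (le_abs_self K)
      linarith [norm_sub_le (G ξ X) (∫ Y, G ξ Y)]
    have h5 : freqWeight ξ ^ (s / 2) ≤ freqWeight ξ ^ ((d : ℝ) + 1) * freqWeight ξ ^ (-1 : ℝ) := by
      rw [← Real.rpow_add hw]
      exact Real.rpow_le_rpow_of_exponent_le hw1 (by linarith)
    have h6 : freqWeight ξ ^ (-1 : ℝ) ≤ ((N : ℝ) ^ (D : ℝ)) ^ (-1 : ℝ) :=
      Real.rpow_le_rpow_of_nonpos (by positivity) hwN (by norm_num)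
    calc freqWeight ξ ^ (s / 2) * ‖fourierCoeff (mollifier d (scale s' N)) ξ‖ *
          ‖G ξ X - ∫ Y, G ξ Y‖
        ≤ (freqWeight ξ ^ ((d : ℝ) + 1) * freqWeight ξ ^ (-1 : ℝ)) *
            ‖fourierCoeff (mollifier d (scale s' N)) ξ‖ * (2 * |K|) := by gcongr
      _ = (freqWeight ξ ^ ((d : ℝ) + 1) * ‖fourierCoeff (mollifier d (scale s' N)) ξ‖) *
            freqWeight ξ ^ (-1 : ℝ) * (2 * |K|) := by ring
      _ ≤ (C₂ * scale s' N ^ (-((d : ℝ) + 1))) * ((N : ℝ) ^ (D : ℝ)) ^ (-1 : ℝ) * (2 * |K|) := by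
          have h3 := h₂ _ hr hr1 ξ
          have h4 := le_trans (by positivity) h3
          refine mul_le_mul_of_nonneg_right (mul_le_mul h3 h6 (by positivity) h4) (by positivity)
      _ = C₂ * (2 * |K|) * (N : ℝ) ^ ((d + 1) / s' - D) := by
          rw [scale_rpow, ← Real.rpow_mul hN0.le, sub_eq_add_neg, Real.rpow_add hN0]
          ring_nf
      _ ≤ _ := by
          gcongr
          linarith

end SalemAvoid

end

open Set Filter Topology MeasureTheory
open scoped ENNReal ContDiff

noncomputable section

namespace SalemAvoid

open UnitAddTorus

/-! ### Approximation of smooth densities by mollified random measures -/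

/-- A continuous probability density whose Fourier coefficients decay rapidly. -/
structure IsSmoothDensity {d : ℕ} (ρ : Torus d → ℝ) : Prop where
  continuous : Continuous ρ
  nonneg : ∀ x, 0 ≤ ρ x
  integral_eq_one : ∫ x, ρ x = 1
  decay : ∀ M : ℕ, ∃ C, ∀ ξ : Fin d → ℤ, freqWeight ξ ^ M * ‖fnCoeff (fun x => (ρ x : ℂ)) ξ‖ ≤ C

lemma IsSmoothDensity.exists_weighted_le {d : ℕ} {ρ : Torus d → ℝ} (hρ : IsSmoothDensity ρ)
    (t : ℝ) : ∃ A, 0 < A ∧ ∀ ξ : Fin d → ℤ,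
      freqWeight ξ ^ t * ‖fnCoeff (fun x => (ρ x : ℂ)) ξ‖ ≤ A := by
  obtain ⟨M, hM⟩ := exists_nat_ge t
  obtain ⟨C, hC⟩ := hρ.decay M
  refine ⟨max C 1, by positivity, fun ξ => le_trans ?_ ((hC ξ).trans (le_max_left _ _))⟩
  gcongr
  rw [← Real.rpow_natCast]
  exact Real.rpow_le_rpow_of_exponent_le (one_le_freqWeight ξ) hM

lemma IsSmoothDensity.fnCoeff_zero {d : ℕ} {ρ : Torus d → ℝ} (hρ : IsSmoothDensity ρ) :
    fnCoeff (fun x => (ρ x : ℂ)) 0 = 1 := by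
  simp only [fnCoeff, neg_zero, mFourier_zero, ContinuousMap.one_apply, one_mul]
  rw [integral_complex_ofReal, hρ.integral_eq_one, Complex.ofReal_one]

lemma IsSmoothDensity.exists_mollifier_sub_le {d : ℕ} {ρ : Torus d → ℝ} (hρ : IsSmoothDensity ρ)
    (t : ℝ) : ∃ A, 0 < A ∧ ∀ r : ℝ, 0 ≤ r → ∀ ξ : Fin d → ℤ,
      freqWeight ξ ^ t * (‖fourierCoeff (mollifier d r) ξ - 1‖ *
        ‖fnCoeff (fun x => (ρ x : ℂ)) ξ‖) ≤ A * r := by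
  obtain ⟨A, hA, h⟩ := hρ.exists_weighted_le (t + 1)
  refine ⟨(2 * Real.pi * d + 1) * A, by positivity, fun r hr ξ => ?_⟩
  have h1 := norm_fourierCoeff_sub_one_le (mollifier_compl_closedBall (d := d) hr) ξ
  have h2 := norm_le_freqWeight ξ
  have hw := freqWeight_pos ξ
  have h3 := h ξ
  rw [Real.rpow_add hw, Real.rpow_one] at h3
  have h4 : ‖fourierCoeff (mollifier d r) ξ - 1‖ ≤ (2 * Real.pi * d + 1) * freqWeight ξ * r := by
    refine h1.trans ?_
    gcongr
    linarith
  calc freqWeight ξ ^ t * (‖fourierCoeff (mollifier d r) ξ - 1‖ *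
        ‖fnCoeff (fun x => (ρ x : ℂ)) ξ‖)
      ≤ freqWeight ξ ^ t * (((2 * Real.pi * d + 1) * freqWeight ξ * r) *
        ‖fnCoeff (fun x => (ρ x : ℂ)) ξ‖) := by gcongr
    _ = (2 * Real.pi * d + 1) * r * (freqWeight ξ ^ t * freqWeight ξ *
        ‖fnCoeff (fun x => (ρ x : ℂ)) ξ‖) := by ring
    _ ≤ (2 * Real.pi * d + 1) * r * A := by gcongr
    _ = _ := by ring

lemma fourierCoeff_smul {d : ℕ} (c : ℝ≥0∞) (μ : Measure (Torus d)) (ξ : Fin d → ℤ) :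
    fourierCoeff (c • μ) ξ = (c.toReal : ℂ) * fourierCoeff μ ξ := by
  rw [fourierCoeff, integral_smul_measure, fourierCoeff, Complex.real_smul]

lemma hasFourierDecay_of_le {d : ℕ} {μ : Measure (Torus d)} {t C : ℝ} (ht : 0 ≤ t)
    (h : ∀ ξ, freqWeight ξ ^ (t / 2) * ‖fourierCoeff μ ξ‖ ≤ C) : HasFourierDecay t μ := by
  refine ⟨(d : ℝ) ^ (t / 2) * C, ?_⟩
  rintro _ ⟨ξ, rfl⟩
  simp only [norm_weightedCoeff]
  calc freqNorm ξ ^ (t / 2) * ‖fourierCoeff μ ξ‖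
      ≤ ((d : ℝ) ^ (t / 2) * freqWeight ξ ^ (t / 2)) * ‖fourierCoeff μ ξ‖ := by
        gcongr; exact freqNorm_rpow_le (by linarith) ξ
    _ = (d : ℝ) ^ (t / 2) * (freqWeight ξ ^ (t / 2) * ‖fourierCoeff μ ξ‖) := by ring
    _ ≤ _ := by gcongr; exact h ξ

/-- The coefficient at 0 is the total mass, so closeness there puts the mass within e of 1, and
dividing by it is a small perturbation. -/
lemma exists_normalized {d : ℕ} {ρ : Torus d → ℝ} (hρ : IsSmoothDensity ρ) {s : ℝ} (hs : 0 ≤ s)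
    {δ : ℝ} (hδ : 0 < δ) : ∃ e, 0 < e ∧ ∀ ν : Measure (Torus d), IsFiniteMeasure ν →
      (∀ ξ, freqWeight ξ ^ (s / 2) *
        ‖fourierCoeff ν ξ - fnCoeff (fun x => (ρ x : ℂ)) ξ‖ ≤ e) →
      ν univ ≠ 0 ∧ ∀ ξ, freqWeight ξ ^ (s / 2) *
        ‖fourierCoeff ((ν univ)⁻¹ • ν) ξ - fnCoeff (fun x => (ρ x : ℂ)) ξ‖ ≤ δ := by
  obtain ⟨A, hA, hAρ⟩ := hρ.exists_weighted_le (s / 2)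
  refine ⟨min (1 / 2) (δ / (2 * (1 + A))), by positivity, fun ν hν h => ?_⟩
  set e := min (1 / 2) (δ / (2 * (1 + A))) with he
  set c : ℝ := ν.real univ with hc
  have he2 : 2 * (1 + A) * e ≤ δ := by
    have := min_le_right (1 / 2) (δ / (2 * (1 + A)))
    rw [le_div_iff₀ (by positivity)] at this
    linarith
  have hc1 : |c - 1| ≤ e := by
    have h0 := h 0
    rw [fourierCoeff_zero, hρ.fnCoeff_zero, ← Complex.ofReal_one, ← Complex.ofReal_sub,
      Complex.norm_real, Real.norm_eq_abs] at h0
    refine le_trans (le_mul_of_one_le_left (abs_nonneg _) ?_) h0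
    exact Real.one_le_rpow (one_le_freqWeight 0) (by linarith)
  have hc2 : 1 / 2 ≤ c := by
    have := min_le_left (1 / 2) (δ / (2 * (1 + A)))
    have := (abs_le.1 hc1).1
    linarith
  have hc0 : (c : ℂ) ≠ 0 := by
    rw [Complex.ofReal_ne_zero]; linarith
  refine ⟨fun h0 => ?_, fun ξ => ?_⟩
  · have : c = 0 := by rw [hc, Measure.real, h0, ENNReal.toReal_zero]
    linarith
  have hw : 0 < freqWeight ξ ^ (s / 2) := Real.rpow_pos_of_pos (freqWeight_pos ξ) _
  have hinv : ((ν univ)⁻¹).toReal = c⁻¹ := by rw [ENNReal.toReal_inv]; rfl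
  rw [fourierCoeff_smul, hinv]
  set R := fnCoeff (fun x => (ρ x : ℂ)) ξ
  have key : ((c⁻¹ : ℝ) : ℂ) * fourierCoeff ν ξ - R =
      ((c⁻¹ : ℝ) : ℂ) * ((fourierCoeff ν ξ - R) + ((1 - c : ℝ) : ℂ) * R) := by
    push_cast
    field_simp
    ring
  have hcinv : c⁻¹ ≤ 2 := by
    rw [inv_le_comm₀ (by linarith) (by norm_num)]; linarith
  have hcinv0 : 0 ≤ c⁻¹ := by rw [inv_nonneg]; linarith
  rw [key, norm_mul, Complex.norm_real, Real.norm_eq_abs, abs_of_nonneg hcinv0]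
  have h1 : ‖(fourierCoeff ν ξ - R) + ((1 - c : ℝ) : ℂ) * R‖ ≤
      ‖fourierCoeff ν ξ - R‖ + e * ‖R‖ := by
    refine (norm_add_le _ _).trans ?_
    rw [norm_mul, Complex.norm_real, Real.norm_eq_abs, abs_sub_comm]
    gcongr
  calc freqWeight ξ ^ (s / 2) * (c⁻¹ * ‖(fourierCoeff ν ξ - R) + ((1 - c : ℝ) : ℂ) * R‖)
      ≤ freqWeight ξ ^ (s / 2) * (2 * (‖fourierCoeff ν ξ - R‖ + e * ‖R‖)) := by gcongr
    _ = 2 * (freqWeight ξ ^ (s / 2) * ‖fourierCoeff ν ξ - R‖ +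
        e * (freqWeight ξ ^ (s / 2) * ‖R‖)) := by ring
    _ ≤ 2 * (e + e * A) := by
        gcongr
        · exact h ξ
        · exact hAρ ξ
    _ ≤ δ := by linarith

/-- If the means of the Fourier coefficients of a random measure depending on `N` independent
points are close to those of a smooth density, then some sample, mollified and normalized,
approximates the density. -/
theorem exists_random_measure {d m : ℕ} (hm : 0 < m) {ρ : Torus d → ℝ} (hρ : IsSmoothDensity ρ)
    {s s' : ℝ} (hs : 0 ≤ s) (hss : s < s') (hsd : s' ≤ d) {C : ℝ} (hC : 0 < C) (K : ℝ) {δ : ℝ}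
    (hδ : 0 < δ) :
    ∃ δ₁ > 0, ∀ᶠ N : ℕ in atTop, ∀ ν₀ : (Fin m × Fin N → Torus d) → Measure (Torus d),
      (∀ X, IsFiniteMeasure (ν₀ X)) → (∀ ξ, Measurable fun X => fourierCoeff (ν₀ X) ξ) →
      (∀ X, (ν₀ X).real univ ≤ K) →
      (∀ ξ X i u, ‖fourierCoeff (ν₀ (Function.update X i u)) ξ - fourierCoeff (ν₀ X) ξ‖ ≤ C / N) →
      (∀ ξ, freqWeight ξ ^ (s / 2) * ‖fourierCoeff (mollifier d (scale s' N)) ξ‖ *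
        ‖(∫ Y, fourierCoeff (ν₀ Y) ξ) - fnCoeff (fun x => (ρ x : ℂ)) ξ‖ ≤ δ₁) →
      ∃ X, ∃ μ : Measure (Torus d), IsProbabilityMeasure μ ∧ (∀ t, 0 ≤ t → HasFourierDecay t μ) ∧
        (∀ ξ, freqWeight ξ ^ (s / 2) *
          ‖fourierCoeff μ ξ - fnCoeff (fun x => (ρ x : ℂ)) ξ‖ ≤ δ) ∧
        ∀ A, ν₀ X Aᶜ = 0 → μ.support ⊆ Metric.cthickening (scale s' N) A := by
  have hs' : 0 < s' := hs.trans_lt hss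
  obtain ⟨e, he, hnorm⟩ := exists_normalized hρ hs hδ
  obtain ⟨A, hA, hAρ⟩ := hρ.exists_mollifier_sub_le (s / 2)
  refine ⟨e / 3, by positivity, ?_⟩
  have hlim : Tendsto (fun N : ℕ => A * scale s' N) atTop (𝓝 (A * 0)) :=
    (tendsto_scale hs').const_mul A
  rw [mul_zero] at hlim
  filter_upwards [exists_sample hm hs hss hsd hC K (by positivity : 0 < e / 3),
    hlim.eventually_le_const (by positivity : 0 < e / 3), eventually_ge_atTop 1] with N hN hN2 hN1
  intro ν₀ hfin hmeas hK hdiff hmean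
  obtain ⟨X, hX⟩ := hN (fun ξ X => fourierCoeff (ν₀ X) ξ) hmeas
    (fun ξ X => (norm_fourierCoeff_le (ν₀ X) ξ).trans (hK X)) hdiff
  have hr := scale_pos (s := s') hN1
  set r := scale s' N with hrdef
  have := hfin X
  set ν := (mollifier d r).conv (ν₀ X) with hν
  have hνc : ∀ ξ, fourierCoeff ν ξ = fourierCoeff (mollifier d r) ξ * fourierCoeff (ν₀ X) ξ :=
    fun ξ => fourierCoeff_conv _ _ ξ
  obtain ⟨h0, hclose⟩ := hnorm ν inferInstance fun ξ => by
    have hw : 0 < freqWeight ξ ^ (s / 2) := Real.rpow_pos_of_pos (freqWeight_pos ξ) _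
    set R := fnCoeff (fun x => (ρ x : ℂ)) ξ
    set S := fourierCoeff (mollifier d r) ξ
    have h1 := hX ξ
    have h2 := hmean ξ
    have h3 := (hAρ r hr.le ξ).trans hN2
    -- The three errors are the random fluctuation, the bias of the mean, and the mollification of ρ
    -- itself.
    have key : fourierCoeff ν ξ - R = S * (fourierCoeff (ν₀ X) ξ - ∫ Y, fourierCoeff (ν₀ Y) ξ) +
        S * ((∫ Y, fourierCoeff (ν₀ Y) ξ) - R) + (S - 1) * R := by
      rw [hνc]; ring
    have h4 := norm_add₃_le (a := S * (fourierCoeff (ν₀ X) ξ - ∫ Y, fourierCoeff (ν₀ Y) ξ))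
      (b := S * ((∫ Y, fourierCoeff (ν₀ Y) ξ) - R)) (c := (S - 1) * R)
    rw [← key] at h4
    simp only [norm_mul] at h4
    have h5 := mul_le_mul_of_nonneg_left h4 hw.le
    rw [mul_add, mul_add, ← mul_assoc, ← mul_assoc] at h5
    linarith
  refine ⟨X, (ν univ)⁻¹ • ν, ?_, fun t ht => ?_, hclose, fun B hB => ?_⟩
  · constructor
    rw [Measure.smul_apply, smul_eq_mul]
    exact ENNReal.inv_mul_cancel h0 (measure_ne_top ν univ)
  · obtain ⟨C', hC', h'⟩ := exists_mollifier_weight_le d (t := t / 2) (by linarith)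
    refine hasFourierDecay_of_le (C := ((ν univ)⁻¹).toReal * (C' * r ^ (-(t / 2)) * K)) ht
      fun ξ => ?_
    rw [fourierCoeff_smul, hνc, norm_mul, norm_mul, Complex.norm_real, Real.norm_eq_abs,
      abs_of_nonneg ENNReal.toReal_nonneg]
    have h1 := h' r hr (scale_le_one hs' hN1) ξ
    have h2 := (norm_fourierCoeff_le (ν₀ X) ξ).trans (hK X)
    calc _ = ((ν univ)⁻¹).toReal * (freqWeight ξ ^ (t / 2) * ‖fourierCoeff (mollifier d r) ξ‖ *
          ‖fourierCoeff (ν₀ X) ξ‖) := by ring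
      _ ≤ _ := by
        refine mul_le_mul_of_nonneg_left ?_ ENNReal.toReal_nonneg
        exact mul_le_mul h1 h2 (norm_nonneg _) (by positivity)
  · refine (Measure.AbsolutelyContinuous.support_mono Measure.smul_absolutelyContinuous).trans ?_
    exact support_conv_subset (mollifier_compl_closedBall hr.le) hB

end SalemAvoid

end

open Set Filter Topology MeasureTheory
open scoped ENNReal ContDiff

noncomputable section

namespace SalemAvoid

open UnitAddTorus

/-! ### Weighted empirical measures -/

/-- The measure `(1/N) ∑ g_k(X_{k,j}) δ_{X_{k,j}}`. -/
def empirical {d m N : ℕ} (g : Fin m → Torus d → ℝ) (X : Fin m × Fin N → Torus d) :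
    Measure (Torus d) :=
  ∑ i, ENNReal.ofReal (g i.1 (X i) / N) • Measure.dirac (X i)

instance {d m N : ℕ} (g : Fin m → Torus d → ℝ) (X : Fin m × Fin N → Torus d) :
    IsFiniteMeasure (empirical g X) := by
  constructor
  simp [empirical, ENNReal.sum_lt_top]

lemma empirical_compl {d m N : ℕ} (g : Fin m → Torus d → ℝ) (X : Fin m × Fin N → Torus d) :
    empirical g X {x | ∃ i, g i.1 (X i) ≠ 0 ∧ x = X i}ᶜ = 0 := by
  simp only [empirical, Measure.coe_finsetSum, Finset.sum_apply, Measure.smul_apply, smul_eq_mul,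
    Finset.sum_eq_zero_iff, Finset.mem_univ, true_implies, mul_eq_zero]
  intro i
  by_cases h : g i.1 (X i) = 0
  · left; simp [h]
  · right
    rw [Measure.dirac_apply, indicator_of_notMem]
    exact fun h' => h' ⟨i, h, rfl⟩

lemma integral_empirical {d m N : ℕ} {g : Fin m → Torus d → ℝ} (hg : ∀ k x, 0 ≤ g k x)
    (X : Fin m × Fin N → Torus d) (u : Torus d → ℂ) :
    ∫ x, u x ∂(empirical g X) = ∑ i, ((g i.1 (X i) / N : ℝ) : ℂ) * u (X i) := by
  rw [empirical, integral_finsetSum_measure fun i _ => ?_]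
  · refine Finset.sum_congr rfl fun i _ => ?_
    rw [integral_smul_measure, integral_dirac, Complex.real_smul,
      ENNReal.toReal_ofReal (div_nonneg (hg _ _) (Nat.cast_nonneg _))]
  · exact (integrable_dirac (by simp)).smul_measure (by simp)

lemma fourierCoeff_empirical {d m N : ℕ} {g : Fin m → Torus d → ℝ} (hg : ∀ k x, 0 ≤ g k x)
    (X : Fin m × Fin N → Torus d) (ξ : Fin d → ℤ) :
    fourierCoeff (empirical g X) ξ = ∑ i, ((g i.1 (X i) / N : ℝ) : ℂ) * mFourier (-ξ) (X i) :=
  integral_empirical hg X _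

lemma measureReal_empirical_le {d m N : ℕ} (hN : 0 < N) {g : Fin m → Torus d → ℝ}
    (hg : ∀ k x, 0 ≤ g k x) {B : ℝ} (hB : ∀ k x, g k x ≤ B) (X : Fin m × Fin N → Torus d) :
    (empirical g X).real univ ≤ m * B := by
  have h1 : (empirical g X).real univ = ∑ i, g i.1 (X i) / N := by
    have := integral_empirical hg X (fun _ => 1)
    simp only [integral_const, mul_one, Complex.real_smul, ← Complex.ofReal_sum] at this
    exact_mod_cast this
  rw [h1]
  have hN' : (0 : ℝ) < N := by exact_mod_cast hN
  calc ∑ i, g i.1 (X i) / N ≤ ∑ _i : Fin m × Fin N, B / N := by gcongr; exact hB _ _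
    _ = m * B := by
      simp only [Finset.sum_const, Finset.card_univ, Fintype.card_prod, Fintype.card_fin,
        nsmul_eq_mul]
      push_cast
      field_simp

lemma measurable_fourierCoeff_empirical {d m N : ℕ} {g : Fin m → Torus d → ℝ}
    (hg : ∀ k x, 0 ≤ g k x) (hgc : ∀ k, Continuous (g k)) (ξ : Fin d → ℤ) :
    Measurable fun X : Fin m × Fin N → Torus d => fourierCoeff (empirical g X) ξ := by
  simp only [fourierCoeff_empirical hg]
  refine Continuous.measurable (continuous_finsetSum _ fun i _ => ?_)
  have := (hgc i.1).comp (continuous_apply (A := fun _ : Fin m × Fin N => Torus d) i)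
  exact (Complex.continuous_ofReal.comp (this.div_const _)).mul
    ((mFourier (-ξ)).continuous.comp (continuous_apply i))

lemma norm_fourierCoeff_empirical_update_le {d m N : ℕ} {g : Fin m → Torus d → ℝ}
    (hg : ∀ k x, 0 ≤ g k x) {B : ℝ} (hB : ∀ k x, g k x ≤ B) (ξ : Fin d → ℤ)
    (X : Fin m × Fin N → Torus d) (i : Fin m × Fin N) (u : Torus d) :
    ‖fourierCoeff (empirical g (Function.update X i u)) ξ - fourierCoeff (empirical g X) ξ‖ ≤
      2 * B / N := by
  rw [fourierCoeff_empirical hg, fourierCoeff_empirical hg, ← Finset.sum_sub_distrib,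
    Finset.sum_eq_single i]
  · refine (norm_sub_le _ _).trans ?_
    simp only [norm_mul, Complex.norm_real, norm_mFourier, mul_one, Real.norm_eq_abs, abs_div,
      Nat.abs_cast, abs_of_nonneg (hg _ _)]
    rw [← add_div]
    gcongr
    linarith [hB i.1 (Function.update X i u i), hB i.1 (X i)]
  · intro j _ hj
    rw [Function.update_of_ne hj, sub_self]
  · simp

lemma integral_comp_eval_torus {d : ℕ} {ι : Type*} [Fintype ι] (i : ι) {h : Torus d → ℂ}
    (hh : Continuous h) : ∫ X : ι → Torus d, h (X i) = ∫ x, h x := by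
  have := (measurePreserving_eval (fun _ : ι => (volume : Measure (Torus d))) i)
  rw [← this.map_eq, integral_map (measurable_pi_apply i).aemeasurable
    hh.aestronglyMeasurable]
  rfl

lemma integral_fourierCoeff_empirical {d m N : ℕ} (hN : 0 < N) {g : Fin m → Torus d → ℝ}
    (hg : ∀ k x, 0 ≤ g k x) (hgc : ∀ k, Continuous (g k)) (ξ : Fin d → ℤ) :
    ∫ X : Fin m × Fin N → Torus d, fourierCoeff (empirical g X) ξ =
      ∑ k, fnCoeff (fun x => (g k x : ℂ)) ξ := by
  have hN' : (N : ℂ) ≠ 0 := by exact_mod_cast hN.ne'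
  simp only [fourierCoeff_empirical hg]
  have hcont : ∀ i : Fin m × Fin N,
      Continuous fun x => ((g i.1 x / N : ℝ) : ℂ) * mFourier (-ξ) x := fun i =>
    (Complex.continuous_ofReal.comp ((hgc i.1).div_const _)).mul (mFourier (-ξ)).continuous
  rw [integral_finsetSum]
  · have h1 : ∀ i : Fin m × Fin N, ∫ X : Fin m × Fin N → Torus d,
        ((g i.1 (X i) / N : ℝ) : ℂ) * mFourier (-ξ) (X i) =
          (N : ℂ)⁻¹ * fnCoeff (fun x => (g i.1 x : ℂ)) ξ := by
      intro i
      rw [integral_comp_eval_torus i (hcont i), fnCoeff, ← integral_const_mul]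
      refine integral_congr_ae (Eventually.of_forall fun x => ?_)
      simp only [Complex.ofReal_div, Complex.ofReal_natCast]
      ring
    simp only [h1, Fintype.sum_prod_type, Finset.sum_const, Finset.card_univ, Fintype.card_fin,
      nsmul_eq_mul]
    exact Finset.sum_congr rfl fun k _ => by rw [← mul_assoc, mul_inv_cancel₀ hN', one_mul]
  · intro i _
    exact ((hcont i).comp (continuous_apply i)).integrable_of_hasCompactSupport
      (HasCompactSupport.of_compactSpace _)

/-! ### Thin approximations -/

/-- Sample N points with weights ρ; the mean is exactly ρ. With s < s' < β the support lies in N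
balls of radius 2N^(-1/s'), and N · N^(-β/s') tends to 0. -/
theorem exists_thin_measure {d : ℕ} {ρ : Torus d → ℝ} (hρ : IsSmoothDensity ρ) {s β : ℝ}
    (hs : 0 ≤ s) (hsβ : s < β) (hβd : β ≤ d) {δ : ℝ} (hδ : 0 < δ) :
    ∃ μ : Measure (Torus d), IsProbabilityMeasure μ ∧ (∀ t, 0 ≤ t → HasFourierDecay t μ) ∧
      (∀ ξ, freqWeight ξ ^ (s / 2) *
        ‖fourierCoeff μ ξ - fnCoeff (fun x => (ρ x : ℂ)) ξ‖ ≤ δ) ∧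
      μ.support ⊆ Metric.cthickening δ {x | ρ x ≠ 0} ∧
      ∃ (S : Finset (Torus d)) (r : ℝ), 0 < r ∧ r < δ ∧ S.card * r ^ β < δ ∧
        μ.support ⊆ ⋃ x ∈ S, Metric.ball x r := by
  obtain ⟨s', hss, hs'β⟩ := exists_between hsβ
  have hs' : 0 < s' := hs.trans_lt hss
  have hβ : 0 < β := hs'.trans hs'β
  obtain ⟨B, hB⟩ : ∃ B, ∀ x, ρ x ≤ B := by
    obtain ⟨B, hB⟩ := (isCompact_range hρ.continuous).bddAbove
    exact ⟨B, fun x => hB (mem_range_self x)⟩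
  have hB0 : 0 ≤ B := (hρ.nonneg 0).trans (hB 0)
  set g : Fin 1 → Torus d → ℝ := fun _ => ρ with hg
  obtain ⟨δ₁, hδ₁, hev⟩ := exists_random_measure (m := 1) one_pos hρ hs hss (hs'β.le.trans hβd)
    (by positivity : 0 < 2 * B + 1) ((1 : ℕ) * B) hδ
  have hlim1 : Tendsto (fun N : ℕ => 2 * scale s' N) atTop (𝓝 (2 * 0)) :=
    (tendsto_scale hs').const_mul 2
  have hlim2 : Tendsto (fun N : ℕ => 2 ^ β * (N : ℝ) ^ (1 - β / s')) atTop (𝓝 (2 ^ β * 0)) := by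
    refine (tendsto_natCast_rpow_neg ?_).const_mul _
    have : 1 < β / s' := (one_lt_div hs').2 hs'β
    linarith
  rw [mul_zero] at hlim1 hlim2
  obtain ⟨N, hN, hN1, hN2, hN3⟩ := (hev.and ((eventually_ge_atTop 1).and
    ((hlim1.eventually_lt_const hδ).and (hlim2.eventually_lt_const hδ)))).exists
  have hN0 : (0 : ℝ) < N := by exact_mod_cast hN1
  have hr := scale_pos (s := s') hN1
  obtain ⟨X, μ, hμ, hdec, hclose, hsupp⟩ := hN (fun X => empirical g X) (fun X => inferInstance)
    (measurable_fourierCoeff_empirical (fun _ => hρ.nonneg) (fun _ => hρ.continuous))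
    (fun X => measureReal_empirical_le hN1 (fun _ => hρ.nonneg) (fun _ => hB) X)
    (fun ξ X i u => (norm_fourierCoeff_empirical_update_le (fun _ => hρ.nonneg) (fun _ => hB)
      ξ X i u).trans (by gcongr; linarith))
    (fun ξ => by
      rw [integral_fourierCoeff_empirical hN1 (fun _ => hρ.nonneg) (fun _ => hρ.continuous)]
      simpa [hg] using hδ₁.le)
  have hs1 := hsupp _ (empirical_compl g X)
  refine ⟨μ, hμ, hdec, hclose, ?_, Finset.univ.image X, 2 * scale s' N, by positivity, hN2, ?_, ?_⟩
  · refine hs1.trans ((Metric.cthickening_subset_of_subset _ ?_).trans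
      (Metric.cthickening_mono (by linarith) _))
    rintro x ⟨i, hi, rfl⟩
    exact hi
  · refine lt_of_le_of_lt ?_ hN3
    have hcard : ((Finset.univ.image X).card : ℝ) ≤ N := by
      have : (Finset.univ.image X).card ≤ N := Finset.card_image_le.trans (by simp)
      exact_mod_cast this
    calc ((Finset.univ.image X).card : ℝ) * (2 * scale s' N) ^ β ≤ N * (2 * scale s' N) ^ β := by
          gcongr
      _ = 2 ^ β * (N : ℝ) ^ (1 - β / s') := by
          rw [Real.mul_rpow (by norm_num) hr.le, scale_rpow, sub_eq_add_neg, Real.rpow_add hN0,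
            Real.rpow_one]
          ring
  · have hfin : {x | ∃ i, g i.1 (X i) ≠ 0 ∧ x = X i}.Finite :=
      (finite_range X).subset (by rintro x ⟨i, -, rfl⟩; exact mem_range_self i)
    rw [hfin.isCompact.cthickening_eq_biUnion_closedBall hr.le] at hs1
    refine hs1.trans (iUnion₂_subset ?_)
    rintro x ⟨i, -, rfl⟩
    refine subset_trans (Metric.closedBall_subset_ball (by linarith : scale s' N < 2 * scale s' N)) ?_
    exact subset_biUnion_of_mem (u := fun x => Metric.ball x (2 * scale s' N))
      (Finset.mem_coe.2 (Finset.mem_image_of_mem X (Finset.mem_univ i)))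

end SalemAvoid

end

open Set Filter Topology MeasureTheory
open scoped ENNReal ContDiff

noncomputable section

namespace SalemAvoid

open UnitAddTorus

/-! ### Products of numbers in the unit interval -/

lemma abs_prod_sub_prod_le {ι : Type*} (s : Finset ι) {a b : ι → ℝ} (ha0 : ∀ i, 0 ≤ a i)
    (ha1 : ∀ i, a i ≤ 1) (hb0 : ∀ i, 0 ≤ b i) (hb1 : ∀ i, b i ≤ 1) :
    |∏ i ∈ s, a i - ∏ i ∈ s, b i| ≤ ∑ i ∈ s, |a i - b i| := by
  classical
  induction s using Finset.induction_on with
  | empty => simp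
  | insert i s hi ih =>
    rw [Finset.prod_insert hi, Finset.prod_insert hi, Finset.sum_insert hi]
    have hA0 : 0 ≤ ∏ i ∈ s, a i := Finset.prod_nonneg fun i _ => ha0 i
    have hA1 : ∏ i ∈ s, a i ≤ 1 := Finset.prod_le_one (fun i _ => ha0 i) fun i _ => ha1 i
    have key : a i * ∏ i ∈ s, a i - b i * ∏ i ∈ s, b i =
        (a i - b i) * ∏ i ∈ s, a i + b i * (∏ i ∈ s, a i - ∏ i ∈ s, b i) := by ring
    rw [key]
    refine (abs_add_le _ _).trans (add_le_add ?_ ?_)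
    · rw [abs_mul, abs_of_nonneg hA0]
      exact mul_le_of_le_one_right (abs_nonneg _) hA1
    · rw [abs_mul, abs_of_nonneg (hb0 i)]
      exact (mul_le_of_le_one_left (abs_nonneg _) (hb1 i)).trans ih

lemma one_sub_sum_le_prod_one_sub {ι : Type*} (s : Finset ι) {a : ι → ℝ} (ha0 : ∀ i, 0 ≤ a i)
    (ha1 : ∀ i, a i ≤ 1) : 1 - ∑ i ∈ s, a i ≤ ∏ i ∈ s, (1 - a i) := by
  have := abs_prod_sub_prod_le s (a := fun i => 1 - a i) (b := fun _ => 1)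
    (fun i => sub_nonneg.2 (ha1 i)) (fun i => by linarith [ha0 i]) (by simp) (by simp)
  simp only [Finset.prod_const_one, sub_sub_cancel_left, abs_neg, abs_of_nonneg (ha0 _)] at this
  linarith [(abs_le.1 this).1]

/-- The second Bonferroni inequality. -/
lemma prod_one_sub_le {ι : Type*} [DecidableEq ι] (s : Finset ι) {a : ι → ℝ} (ha0 : ∀ i, 0 ≤ a i)
    (ha1 : ∀ i, a i ≤ 1) :
    ∏ i ∈ s, (1 - a i) ≤ 1 - ∑ i ∈ s, a i + ∑ p ∈ s.offDiag, a p.1 * a p.2 := by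
  induction s using Finset.induction_on with
  | empty => simp
  | insert i s hi ih =>
    rw [Finset.prod_insert hi, Finset.sum_insert hi, Finset.offDiag_insert hi]
    have h1 := one_sub_sum_le_prod_one_sub s ha0 ha1
    -- Ordered pairs count each product twice. Only one of the two new families is needed, paired
    -- with the first Bonferroni inequality for the old product.
    have h2 : ∑ p ∈ s.offDiag, a p.1 * a p.2 + a i * ∑ j ∈ s, a j ≤
        ∑ p ∈ s.offDiag ∪ {i} ×ˢ s ∪ s ×ˢ {i}, a p.1 * a p.2 := by
      have hdisj : Disjoint s.offDiag ({i} ×ˢ s) := by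
        rw [Finset.disjoint_left]
        rintro ⟨x, y⟩ hx hy
        rw [Finset.mem_offDiag] at hx
        rw [Finset.mem_product, Finset.mem_singleton] at hy
        exact hi (hy.1 ▸ hx.1)
      have h3 : ∑ p ∈ {i} ×ˢ s, a p.1 * a p.2 = a i * ∑ j ∈ s, a j := by
        rw [Finset.sum_product, Finset.sum_singleton, Finset.mul_sum]
      rw [← h3, ← Finset.sum_union hdisj]
      exact Finset.sum_le_sum_of_subset_of_nonneg Finset.subset_union_left
        fun p _ _ => mul_nonneg (ha0 _) (ha0 _)
    have h4 := ha0 i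
    nlinarith

/-! ### Resampling one coordinate -/

/-- Replacing one coordinate by an independent copy does not change the product law. This is how a
single sampled point is integrated out while the others stay fixed. -/
lemma measurePreserving_update {d : ℕ} {ι : Type*} [Fintype ι] [DecidableEq ι] (i : ι) :
    MeasurePreserving (fun p : (ι → Torus d) × Torus d => Function.update p.1 i p.2)
      (volume.prod volume) volume := by
  have hmeas : Measurable fun p : (ι → Torus d) × Torus d => Function.update p.1 i p.2 := by
    refine measurable_pi_lambda _ fun j => ?_
    by_cases hj : j = i
    · subst hj; simpa using measurable_snd
    · simpa [hj, Function.comp_def] using (measurable_pi_apply j).comp measurable_fst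
  refine ⟨hmeas, ?_⟩
  rw [volume_pi]
  refine (Measure.pi_eq fun s hs => ?_).symm
  rw [Measure.map_apply hmeas (MeasurableSet.univ_pi hs)]
  have hpre : (fun p : (ι → Torus d) × Torus d => Function.update p.1 i p.2) ⁻¹' pi univ s =
      pi univ (Function.update s i univ) ×ˢ s i := by
    ext ⟨X, u⟩
    simp only [mem_preimage, Set.mem_pi, mem_univ, true_implies, mem_prod]
    constructor
    · intro h
      refine ⟨fun j => ?_, by simpa using h i⟩
      by_cases hj : j = i
      · subst hj; simp
      · simpa [hj] using h j
    · rintro ⟨h1, h2⟩ j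
      by_cases hj : j = i
      · subst hj; simpa using h2
      · simpa [hj] using h1 j
  rw [hpre, Measure.prod_prod, Measure.pi_pi, ← Finset.mul_prod_erase _ _ (Finset.mem_univ i),
    ← Finset.mul_prod_erase _ (fun j => volume (s j)) (Finset.mem_univ i)]
  simp only [Function.update_self, measure_univ, one_mul]
  rw [mul_comm]
  congr 1
  refine Finset.prod_congr rfl fun j hj => ?_
  rw [Function.update_of_ne (Finset.ne_of_mem_erase hj)]

lemma integral_eq_integral_update {d : ℕ} {ι : Type*} [Fintype ι] [DecidableEq ι] (i : ι)
    {F : (ι → Torus d) → ℝ} (hF : Measurable F) {K : ℝ} (hK : ∀ X, |F X| ≤ K) :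
    ∫ X, F X = ∫ X, ∫ u, F (Function.update X i u) := by
  have hmp := measurePreserving_update (d := d) i
  have h1 := integral_prod (μ := (volume : Measure (ι → Torus d)))
    (ν := (volume : Measure (Torus d))) (fun p => F (Function.update p.1 i p.2))
    (integrable_of_measurable_of_abs_le (hF.comp hmp.measurable) fun p => hK _)
  rw [← h1]
  conv_lhs => rw [← hmp.map_eq]
  exact integral_map hmp.measurable.aemeasurable hF.aestronglyMeasurable

/-- The tuple `(X_{1,J_1}, …, X_{m,J_m})`. -/
def pick {m d N : ℕ} (X : Fin m × Fin N → Torus d) (J : Fin m → Fin N) : Fin m → Torus d :=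
  fun k => X (k, J k)

lemma measurable_pick {m d N : ℕ} (J : Fin m → Fin N) :
    Measurable fun X : Fin m × Fin N → Torus d => pick X J :=
  measurable_pi_lambda _ fun _ => measurable_pi_apply _

lemma pick_update_of_eq {m d N : ℕ} (X : Fin m × Fin N → Torus d) {J : Fin m → Fin N}
    {i : Fin m × Fin N} (h : J i.1 = i.2) (u : Torus d) :
    pick (Function.update X i u) J = Function.update (pick X J) i.1 u := by
  ext1 k
  by_cases hk : k = i.1
  · subst hk
    rw [Function.update_self, pick, h, Function.update_self]
  · rw [Function.update_of_ne hk, pick, Function.update_of_ne, pick]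
    exact fun h' => hk (congrArg Prod.fst h')

lemma pick_update_of_ne {m d N : ℕ} (X : Fin m × Fin N → Torus d) {J : Fin m → Fin N}
    {i : Fin m × Fin N} (h : J i.1 ≠ i.2) (u : Torus d) :
    pick (Function.update X i u) J = pick X J := by
  ext1 k
  rw [pick, Function.update_of_ne, pick]
  rintro rfl
  exact h rfl

lemma measurePreserving_pick {m d N : ℕ} (J : Fin m → Fin N) :
    MeasurePreserving (fun X : Fin m × Fin N → Torus d => pick X J) volume volume := by
  refine ⟨measurable_pick J, ?_⟩
  rw [volume_pi (α := fun _ : Fin m => Torus d)]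
  refine (Measure.pi_eq fun s hs => ?_).symm
  rw [Measure.map_apply (measurable_pick J) (MeasurableSet.univ_pi hs)]
  have hpre : (fun X : Fin m × Fin N → Torus d => pick X J) ⁻¹' pi univ s =
      pi univ fun i : Fin m × Fin N => if i.2 = J i.1 then s i.1 else univ := by
    ext X
    simp only [mem_preimage, Set.mem_pi, mem_univ, true_implies]
    constructor
    · rintro h ⟨k, j⟩
      by_cases hj : j = J k
      · subst hj; simpa [pick] using h k
      · simp [hj]
    · intro h k
      simpa [pick] using h (k, J k)
  rw [hpre, volume_pi, Measure.pi_pi, Fintype.prod_prod_type]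
  refine Finset.prod_congr rfl fun k _ => ?_
  rw [Finset.prod_eq_single (J k)]
  · simp
  · intro j _ hj; simp [hj]
  · simp

end SalemAvoid

end

open Set Filter Topology MeasureTheory
open scoped ENNReal ContDiff

noncomputable section

namespace SalemAvoid

open UnitAddTorus

/-! ### Densities -/

lemma fourierCoeff_withDensity {d : ℕ} {φ : Torus d → ℝ} (hφ : Measurable φ) (h0 : ∀ x, 0 ≤ φ x)
    (ξ : Fin d → ℤ) : fourierCoeff (volume.withDensity fun x => ENNReal.ofReal (φ x)) ξ =
      fnCoeff (fun x => (φ x : ℂ)) ξ := by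
  rw [fourierCoeff, integral_withDensity_eq_integral_toReal_smul hφ.ennreal_ofReal (by simp),
    fnCoeff]
  refine integral_congr_ae (Eventually.of_forall fun x => ?_)
  simp only [ENNReal.toReal_ofReal (h0 x), Complex.real_smul]
  ring

lemma withDensity_ofReal_univ_le {d : ℕ} {φ : Torus d → ℝ} {H : ℝ} (hH : ∀ x, φ x ≤ H) :
    (volume.withDensity fun x => ENNReal.ofReal (φ x)) (univ : Set (Torus d)) ≤
      ENNReal.ofReal H := by
  rw [withDensity_apply _ MeasurableSet.univ]
  calc ∫⁻ x in univ, ENNReal.ofReal (φ x) ≤ ∫⁻ _ in (univ : Set (Torus d)), ENNReal.ofReal H :=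
        lintegral_mono fun x => ENNReal.ofReal_le_ofReal (hH x)
    _ = ENNReal.ofReal H := by simp

/-- Fourier coefficients of bounded functions depend on them continuously in `L¹`. -/
lemma norm_fnCoeff_sub_le {d : ℕ} {φ ψ : Torus d → ℝ} (hφ : Measurable φ) (hψ : Measurable ψ)
    {K K' : ℝ} (hK : ∀ x, |φ x| ≤ K) (hK' : ∀ x, |ψ x| ≤ K') (ξ : Fin d → ℤ) :
    ‖fnCoeff (fun x => (φ x : ℂ)) ξ - fnCoeff (fun x => (ψ x : ℂ)) ξ‖ ≤ ∫ x, |φ x - ψ x| := by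
  have hInt : ∀ {θ : Torus d → ℝ} {L : ℝ}, Measurable θ → (∀ x, |θ x| ≤ L) →
      Integrable fun x => mFourier (-ξ) x * (θ x : ℂ) := fun hθ hL =>
    Integrable.of_bound ((mFourier (-ξ)).continuous.measurable.mul
      (Complex.measurable_ofReal.comp hθ)).aestronglyMeasurable _
      (Eventually.of_forall fun x => by simpa using hL x)
  rw [fnCoeff, fnCoeff, ← integral_sub (hInt hφ hK) (hInt hψ hK')]
  refine (norm_integral_le_integral_norm _).trans (le_of_eq ?_)
  refine integral_congr_ae (Eventually.of_forall fun x => ?_)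
  simp only [← mul_sub, norm_mul, norm_mFourier, one_mul, ← Complex.ofReal_sub, Complex.norm_real,
    Real.norm_eq_abs]

/-! ### The weight that erases the pattern -/

/-- A measurable function with values in the unit interval. -/
structure IsCutoff {Ω : Type*} [MeasurableSpace Ω] (κ : Ω → ℝ) : Prop where
  measurable : Measurable κ
  nonneg : ∀ Z, 0 ≤ κ Z
  le_one : ∀ Z, κ Z ≤ 1

/-- The cutoff `κ(Z)` if `x` is within distance `ℓ` of `g(Z)`. -/
def hit {m d : ℕ} (κ : (Fin m → Torus d) → ℝ) (g : (Fin m → Torus d) → Torus d) (ℓ : ℝ)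
    (x : Torus d) (Z : Fin m → Torus d) : ℝ := if dist x (g Z) ≤ ℓ then κ Z else 0

/-- The weight that vanishes near `g(X_{1,J_1}, …, X_{m,J_m})` for all `J`. -/
def avoidWeight {m d N : ℕ} (κ : (Fin m → Torus d) → ℝ) (g : (Fin m → Torus d) → Torus d) (ℓ : ℝ)
    (X : Fin m × Fin N → Torus d) (x : Torus d) : ℝ :=
  ∏ J : Fin m → Fin N, (1 - hit κ g ℓ x (pick X J))

section

variable {m d N : ℕ} {κ : (Fin m → Torus d) → ℝ} {g : (Fin m → Torus d) → Torus d} {ℓ : ℝ}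

lemma hit_nonneg (hκ : IsCutoff κ) (x : Torus d) (Z : Fin m → Torus d) : 0 ≤ hit κ g ℓ x Z := by
  rw [hit]; split_ifs
  · exact hκ.nonneg Z
  · exact le_rfl

lemma hit_le_one (hκ : IsCutoff κ) (x : Torus d) (Z : Fin m → Torus d) : hit κ g ℓ x Z ≤ 1 := by
  rw [hit]; split_ifs
  · exact hκ.le_one Z
  · exact zero_le_one

lemma abs_hit_le_one (hκ : IsCutoff κ) (x : Torus d) (Z : Fin m → Torus d) :
    |hit κ g ℓ x Z| ≤ 1 := by
  rw [abs_of_nonneg (hit_nonneg hκ x Z)]; exact hit_le_one hκ x Z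

lemma measurable_hit (hκ : IsCutoff κ) (hg : Measurable g) :
    Measurable fun p : Torus d × (Fin m → Torus d) => hit κ g ℓ p.1 p.2 :=
  Measurable.ite (measurableSet_le (measurable_fst.dist (hg.comp measurable_snd)) measurable_const)
    (hκ.measurable.comp measurable_snd) measurable_const

lemma measurable_hit_left (hκ : IsCutoff κ) (hg : Measurable g) (Z : Fin m → Torus d) :
    Measurable fun x : Torus d => hit κ g ℓ x Z :=
  Measurable.of_uncurry_right (f := fun x Z => hit κ g ℓ x Z) (measurable_hit hκ hg)

lemma measurable_hit_right (hκ : IsCutoff κ) (hg : Measurable g) (x : Torus d) :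
    Measurable fun Z : Fin m → Torus d => hit κ g ℓ x Z :=
  Measurable.of_uncurry_left (f := fun x Z => hit κ g ℓ x Z) (measurable_hit hκ hg)

lemma integrable_hit_left (hκ : IsCutoff κ) (hg : Measurable g) (Z : Fin m → Torus d) :
    Integrable fun x : Torus d => hit κ g ℓ x Z :=
  integrable_of_measurable_of_abs_le (measurable_hit_left hκ hg Z) fun x => abs_hit_le_one hκ x Z

lemma integral_hit_le (hκ : IsCutoff κ) (hg : Measurable g) (hℓ : 0 ≤ ℓ) (Z : Fin m → Torus d) :
    ∫ x, hit κ g ℓ x Z ≤ (2 * ℓ) ^ d := by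
  refine le_trans ?_ (measureReal_closedBall_le (g Z) hℓ)
  rw [← integral_indicator_one Metric.isClosed_closedBall.measurableSet]
  refine integral_mono (integrable_hit_left hκ hg Z) ?_ fun x => ?_
  · exact (integrable_const (1 : ℝ)).indicator Metric.isClosed_closedBall.measurableSet
  · rw [hit]
    split_ifs with h
    · rw [indicator_of_mem (Metric.mem_closedBall.2 h)]
      exact hκ.le_one Z
    · exact indicator_nonneg (fun _ _ => zero_le_one) x

lemma avoidWeight_nonneg (hκ : IsCutoff κ) (X : Fin m × Fin N → Torus d) (x : Torus d) :
    0 ≤ avoidWeight κ g ℓ X x :=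
  Finset.prod_nonneg fun _ _ => sub_nonneg.2 (hit_le_one hκ _ _)

lemma avoidWeight_le_one (hκ : IsCutoff κ) (X : Fin m × Fin N → Torus d) (x : Torus d) :
    avoidWeight κ g ℓ X x ≤ 1 :=
  Finset.prod_le_one (fun _ _ => sub_nonneg.2 (hit_le_one hκ _ _))
    fun _ _ => by linarith [hit_nonneg (g := g) (ℓ := ℓ) hκ x (pick X ‹_›)]

lemma measurable_avoidWeight (hκ : IsCutoff κ) (hg : Measurable g) :
    Measurable fun p : (Fin m × Fin N → Torus d) × Torus d => avoidWeight κ g ℓ p.1 p.2 := by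
  unfold avoidWeight
  refine Finset.measurable_fun_prod _ fun J _ => ?_
  have h1 : Measurable fun p : (Fin m × Fin N → Torus d) × Torus d => pick p.1 J :=
    (measurable_pick J).comp measurable_fst
  have h2 : Measurable fun p : (Fin m × Fin N → Torus d) × Torus d => (p.2, pick p.1 J) :=
    measurable_snd.prodMk h1
  have h3 := (measurable_hit (ℓ := ℓ) hκ hg).comp h2
  simp only [Function.comp_def] at h3
  exact measurable_const.sub h3

lemma measurable_avoidWeight_right (hκ : IsCutoff κ) (hg : Measurable g)
    (X : Fin m × Fin N → Torus d) : Measurable (avoidWeight κ g ℓ X) :=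
  Measurable.of_uncurry_left (f := fun X x => avoidWeight κ g ℓ X x) (measurable_avoidWeight hκ hg)

lemma measurable_avoidWeight_left (hκ : IsCutoff κ) (hg : Measurable g) (x : Torus d) :
    Measurable fun X : Fin m × Fin N → Torus d => avoidWeight κ g ℓ X x :=
  Measurable.of_uncurry_right (f := fun X x => avoidWeight κ g ℓ X x)
    (measurable_avoidWeight hκ hg)

/-- Only the factors whose tuple passes through the point i change, and a product of numbers in [0,
1] is 1-Lipschitz in each factor. -/
lemma abs_avoidWeight_update_sub_le (hκ : IsCutoff κ) (X : Fin m × Fin N → Torus d)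
    (i : Fin m × Fin N) (u x : Torus d) :
    |avoidWeight κ g ℓ (Function.update X i u) x - avoidWeight κ g ℓ X x| ≤
      ∑ J : Fin m → Fin N with J i.1 = i.2,
        (hit κ g ℓ x (pick (Function.update X i u) J) + hit κ g ℓ x (pick X J)) := by
  refine (abs_prod_sub_prod_le Finset.univ (fun J => sub_nonneg.2 (hit_le_one hκ _ _))
    (fun J => by linarith [hit_nonneg (g := g) (ℓ := ℓ) hκ x (pick (Function.update X i u) J)])
    (fun J => sub_nonneg.2 (hit_le_one hκ _ _))
    (fun J => by linarith [hit_nonneg (g := g) (ℓ := ℓ) hκ x (pick X J)])).trans ?_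
  rw [Finset.sum_filter]
  refine Finset.sum_le_sum fun J _ => ?_
  split_ifs with h
  · have h1 := hit_nonneg (g := g) (ℓ := ℓ) hκ x (pick (Function.update X i u) J)
    have h2 := hit_nonneg (g := g) (ℓ := ℓ) hκ x (pick X J)
    rw [abs_le]; constructor <;> linarith
  · rw [pick_update_of_ne X h, sub_self, abs_zero]

lemma card_filter_apply_eq_mul (k : Fin m) (j : Fin N) :
    (Finset.univ.filter fun J : Fin m → Fin N => J k = j).card * N = N ^ m := by
  have h1 : (Finset.univ.filter fun J : Fin m → Fin N => J k = j) =
      Fintype.piFinset (Function.update (fun _ : Fin m => (Finset.univ : Finset (Fin N))) k {j}) := by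
    ext J
    simp only [Finset.mem_filter, Finset.mem_univ, true_and, Fintype.mem_piFinset]
    constructor
    · intro h k'
      by_cases hk : k' = k
      · subst hk; simp [h]
      · simp [hk]
    · intro h
      simpa using h k
  rw [h1, Fintype.card_piFinset, ← Finset.mul_prod_erase _ _ (Finset.mem_univ k),
    Function.update_self, Finset.card_singleton, one_mul]
  have h2 : ∀ k' ∈ Finset.univ.erase k,
      (Function.update (fun _ => (Finset.univ : Finset (Fin N))) k {j} k').card = N := by
    intro k' hk'
    rw [Function.update_of_ne (Finset.ne_of_mem_erase hk')]; simp
  rw [Finset.prod_congr rfl h2, Finset.prod_const, Finset.card_erase_of_mem (Finset.mem_univ k),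
    Finset.card_univ, Fintype.card_fin, ← pow_succ, Nat.sub_add_cancel k.pos]

/-- There are N^(m-1) tuples through a given point, each erasing a ball of volume at most (2ℓ)^d.
When N^m ℓ^d is bounded the influence is O(1/N), as concentration requires. -/
lemma integral_abs_avoidWeight_update_sub_le (hκ : IsCutoff κ) (hg : Measurable g) (hℓ : 0 ≤ ℓ)
    (X : Fin m × Fin N → Torus d) (i : Fin m × Fin N) (u : Torus d) :
    ∫ x, |avoidWeight κ g ℓ (Function.update X i u) x - avoidWeight κ g ℓ X x| ≤
      2 * (N ^ m * (2 * ℓ) ^ d) / N := by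
  have hN : (0 : ℝ) < N := by exact_mod_cast i.2.pos
  have hW : ∀ X : Fin m × Fin N → Torus d, Measurable (avoidWeight κ g ℓ X) :=
    measurable_avoidWeight_right hκ hg
  have hh : ∀ Z, Integrable fun x => hit κ g ℓ x Z := integrable_hit_left hκ hg
  calc ∫ x, |avoidWeight κ g ℓ (Function.update X i u) x - avoidWeight κ g ℓ X x|
      ≤ ∫ x, ∑ J : Fin m → Fin N with J i.1 = i.2,
        (hit κ g ℓ x (pick (Function.update X i u) J) + hit κ g ℓ x (pick X J)) := by
        refine integral_mono (integrable_of_measurable_of_abs_le (K := 1)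
          ((hW _).sub (hW _)).abs fun x => ?_)
          (integrable_finsetSum _ fun J _ => (hh _).add (hh _))
          fun x => abs_avoidWeight_update_sub_le hκ X i u x
        rw [abs_abs, abs_le]
        have h1 := avoidWeight_nonneg (g := g) (ℓ := ℓ) hκ X x
        have h2 := avoidWeight_nonneg (g := g) (ℓ := ℓ) hκ (Function.update X i u) x
        have h3 := avoidWeight_le_one (g := g) (ℓ := ℓ) hκ X x
        have h4 := avoidWeight_le_one (g := g) (ℓ := ℓ) hκ (Function.update X i u) x
        constructor <;> linarith
    _ = ∑ J : Fin m → Fin N with J i.1 = i.2,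
        ((∫ x, hit κ g ℓ x (pick (Function.update X i u) J)) + ∫ x, hit κ g ℓ x (pick X J)) := by
        refine (integral_finsetSum _ fun J _ => (hh _).add (hh _)).trans ?_
        exact Finset.sum_congr rfl fun J _ => integral_add (hh _) (hh _)
    _ ≤ ∑ J : Fin m → Fin N with J i.1 = i.2, ((2 * ℓ) ^ d + (2 * ℓ) ^ d) := by
        gcongr <;> exact integral_hit_le hκ hg hℓ _
    _ = 2 * (N ^ m * (2 * ℓ) ^ d) / N := by
        have h1 : ((Finset.univ.filter fun J : Fin m → Fin N => J i.1 = i.2).card : ℝ) * N =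
            N ^ m := by exact_mod_cast card_filter_apply_eq_mul i.1 i.2
        rw [Finset.sum_const, nsmul_eq_mul, eq_div_iff hN.ne', ← h1]
        ring

/-- The mean of the weight. -/
def meanWeight (κ : (Fin m → Torus d) → ℝ) (g : (Fin m → Torus d) → Torus d) (ℓ : ℝ) (N : ℕ)
    (x : Torus d) : ℝ := ∫ X : Fin m × Fin N → Torus d, avoidWeight κ g ℓ X x

lemma measurable_fnCoeff_avoidWeight (hκ : IsCutoff κ) (hg : Measurable g) {h : Torus d → ℝ}
    (hh : Measurable h) (ξ : Fin d → ℤ) :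
    Measurable fun X : Fin m × Fin N → Torus d =>
      fnCoeff (fun x => ((avoidWeight κ g ℓ X x * h x : ℝ) : ℂ)) ξ := by
  have h1 : Measurable fun p : (Fin m × Fin N → Torus d) × Torus d =>
      mFourier (-ξ) p.2 * ((avoidWeight κ g ℓ p.1 p.2 * h p.2 : ℝ) : ℂ) :=
    ((mFourier (-ξ)).continuous.measurable.comp measurable_snd).mul (Complex.measurable_ofReal.comp
      ((measurable_avoidWeight hκ hg).mul (hh.comp measurable_snd)))
  exact (h1.stronglyMeasurable.integral_prod_right').measurable

lemma integral_fnCoeff_avoidWeight (hκ : IsCutoff κ) (hg : Measurable g) {h : Torus d → ℝ}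
    (hh : Measurable h) {H : ℝ} (hH : ∀ x, |h x| ≤ H) (ξ : Fin d → ℤ) :
    ∫ X : Fin m × Fin N → Torus d, fnCoeff (fun x => ((avoidWeight κ g ℓ X x * h x : ℝ) : ℂ)) ξ =
      fnCoeff (fun x => ((meanWeight κ g ℓ N x * h x : ℝ) : ℂ)) ξ := by
  have h1 : Measurable fun p : (Fin m × Fin N → Torus d) × Torus d =>
      mFourier (-ξ) p.2 * ((avoidWeight κ g ℓ p.1 p.2 * h p.2 : ℝ) : ℂ) :=
    ((mFourier (-ξ)).continuous.measurable.comp measurable_snd).mul (Complex.measurable_ofReal.comp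
      ((measurable_avoidWeight hκ hg).mul (hh.comp measurable_snd)))
  have h2 : ∀ p : (Fin m × Fin N → Torus d) × Torus d,
      ‖mFourier (-ξ) p.2 * ((avoidWeight κ g ℓ p.1 p.2 * h p.2 : ℝ) : ℂ)‖ ≤ H := by
    intro p
    rw [norm_mul, norm_mFourier, one_mul, Complex.norm_real, Real.norm_eq_abs, abs_mul,
      abs_of_nonneg (avoidWeight_nonneg hκ _ _)]
    exact (mul_le_of_le_one_left (abs_nonneg _) (avoidWeight_le_one hκ _ _)).trans (hH _)
  simp only [fnCoeff]
  rw [integral_integral_swap (Integrable.of_bound h1.aestronglyMeasurable H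
    (Eventually.of_forall h2))]
  refine integral_congr_ae (Eventually.of_forall fun x => ?_)
  simp only
  rw [integral_const_mul, integral_complex_ofReal, integral_mul_const]
  rfl

end

end SalemAvoid

end

open Set Filter Topology MeasureTheory
open scoped ENNReal ContDiff

noncomputable section

namespace SalemAvoid

open UnitAddTorus

/-! ### The mean of the weight -/

/-- The mean of `hit` over independent uniform points. -/
def hitProb {m d : ℕ} (κ : (Fin m → Torus d) → ℝ) (g : (Fin m → Torus d) → Torus d) (ℓ : ℝ)
    (x : Torus d) : ℝ := ∫ Z, hit κ g ℓ x Z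

section

variable {m d N : ℕ} {κ : (Fin m → Torus d) → ℝ} {g : (Fin m → Torus d) → Torus d} {ℓ : ℝ}

lemma integrable_hit_right (hκ : IsCutoff κ) (hg : Measurable g) (x : Torus d) :
    Integrable fun Z : Fin m → Torus d => hit κ g ℓ x Z :=
  integrable_of_measurable_of_abs_le (measurable_hit_right hκ hg x) fun Z => abs_hit_le_one hκ x Z

lemma hitProb_nonneg (hκ : IsCutoff κ) (x : Torus d) : 0 ≤ hitProb κ g ℓ x :=
  integral_nonneg fun Z => hit_nonneg hκ x Z

lemma hitProb_le_one (hκ : IsCutoff κ) (x : Torus d) : hitProb κ g ℓ x ≤ 1 :=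
  (le_abs_self _).trans (abs_integral_le_of_abs_le fun Z => abs_hit_le_one hκ x Z)

lemma measurable_hitProb (hκ : IsCutoff κ) (hg : Measurable g) : Measurable (hitProb κ g ℓ) :=
  ((measurable_hit (ℓ := ℓ) hκ hg).stronglyMeasurable.integral_prod_right').measurable

/-- The hitting probability is the convolution of the image of κ dZ under g with the indicator of a
ball, so coefficients multiply. The first factor carries the rapid decay, the second the volume ℓ^d.
-/
lemma fnCoeff_hitProb (hκ : IsCutoff κ) (hg : Measurable g) (ξ : Fin d → ℤ) :
    fnCoeff (fun x => (hitProb κ g ℓ x : ℂ)) ξ = (∫ Z, (κ Z : ℂ) * mFourier (-ξ) (g Z)) *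
      ∫ y : Torus d, mFourier (-ξ) y * (if ‖y‖ ≤ ℓ then 1 else 0 : ℂ) := by
  have h1 : Measurable fun p : Torus d × (Fin m → Torus d) =>
      mFourier (-ξ) p.1 * ((hit κ g ℓ p.1 p.2 : ℝ) : ℂ) :=
    ((mFourier (-ξ)).continuous.measurable.comp measurable_fst).mul
      (Complex.measurable_ofReal.comp (measurable_hit hκ hg))
  have h2 : ∀ p : Torus d × (Fin m → Torus d),
      ‖mFourier (-ξ) p.1 * ((hit κ g ℓ p.1 p.2 : ℝ) : ℂ)‖ ≤ 1 := fun p => by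
    rw [norm_mul, norm_mFourier, one_mul, Complex.norm_real, Real.norm_eq_abs]
    exact abs_hit_le_one hκ _ _
  have h3 : fnCoeff (fun x => (hitProb κ g ℓ x : ℂ)) ξ =
      ∫ x, ∫ Z, mFourier (-ξ) x * ((hit κ g ℓ x Z : ℝ) : ℂ) := by
    rw [fnCoeff]
    refine integral_congr_ae (Eventually.of_forall fun x => ?_)
    simp only
    rw [integral_const_mul, integral_complex_ofReal]
    rfl
  rw [h3, integral_integral_swap (Integrable.of_bound h1.aestronglyMeasurable 1
    (Eventually.of_forall h2)), ← integral_mul_const]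
  refine integral_congr_ae (Eventually.of_forall fun Z => ?_)
  simp only
  rw [← integral_add_right_eq_self (fun x => mFourier (-ξ) x * ((hit κ g ℓ x Z : ℝ) : ℂ)) (g Z),
    ← integral_const_mul]
  refine integral_congr_ae (Eventually.of_forall fun y => ?_)
  simp only [mFourier_add_apply, hit, dist_eq_norm, add_sub_cancel_right]
  split_ifs
  · ring
  · simp

lemma norm_fnCoeff_hitProb_le (hκ : IsCutoff κ) (hg : Measurable g) (hℓ : 0 ≤ ℓ)
    (ξ : Fin d → ℤ) : ‖fnCoeff (fun x => (hitProb κ g ℓ x : ℂ)) ξ‖ ≤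
      (2 * ℓ) ^ d * ‖∫ Z, (κ Z : ℂ) * mFourier (-ξ) (g Z)‖ := by
  rw [fnCoeff_hitProb hκ hg, norm_mul, mul_comm]
  refine mul_le_mul_of_nonneg_right ?_ (norm_nonneg _)
  refine (norm_integral_le_integral_norm _).trans ?_
  refine le_trans (le_of_eq ?_) (measureReal_closedBall_le (0 : Torus d) hℓ)
  rw [← integral_indicator_one Metric.isClosed_closedBall.measurableSet]
  refine integral_congr_ae (Eventually.of_forall fun y => ?_)
  simp only [norm_mul, norm_mFourier, one_mul, indicator, mem_closedBall_zero_iff, Pi.one_apply]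
  split_ifs <;> simp

lemma integral_hit_pick (hκ : IsCutoff κ) (hg : Measurable g) (x : Torus d) (J : Fin m → Fin N) :
    ∫ X : Fin m × Fin N → Torus d, hit κ g ℓ x (pick X J) = hitProb κ g ℓ x := by
  have hmp := measurePreserving_pick (d := d) J
  rw [hitProb, ← hmp.map_eq, integral_map hmp.measurable.aemeasurable
    (measurable_hit_right hκ hg x).aestronglyMeasurable]

/-- Two different tuples may share points but differ in some slot k. Resampling the k-th point of J
leaves J' untouched and bounds the first factor by D, whatever the other points are. A second
resampling bounds the remaining factor. -/
lemma integral_hit_mul_hit_le (hκ : IsCutoff κ) (hg : Measurable g) {D : ℝ}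
    (hD : ∀ k x Z, ∫ u, hit κ g ℓ x (Function.update Z k u) ≤ D) (x : Torus d)
    {J J' : Fin m → Fin N} (hJ : J ≠ J') :
    ∫ X : Fin m × Fin N → Torus d, hit κ g ℓ x (pick X J) * hit κ g ℓ x (pick X J') ≤ D ^ 2 := by
  obtain ⟨k, hk⟩ := Function.ne_iff.1 hJ
  have hD0 : 0 ≤ D := le_trans (integral_nonneg fun u => hit_nonneg hκ _ _) (hD k x 0)
  have hmeas : ∀ J : Fin m → Fin N, Measurable fun X : Fin m × Fin N → Torus d =>
      hit κ g ℓ x (pick X J) := fun J => by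
    have := (measurable_hit_right (ℓ := ℓ) hκ hg x).comp (measurable_pick (d := d) J)
    simpa only [Function.comp_def] using this
  have hInt : ∀ J : Fin m → Fin N, Integrable fun X : Fin m × Fin N → Torus d =>
      hit κ g ℓ x (pick X J) := fun J =>
    integrable_of_measurable_of_abs_le (hmeas J) fun X => abs_hit_le_one hκ _ _
  have hone : ∀ J : Fin m → Fin N, ∫ X : Fin m × Fin N → Torus d, hit κ g ℓ x (pick X J) ≤ D := by
    intro J
    rw [integral_eq_integral_update (k, J k) (hmeas J) fun X => abs_hit_le_one hκ _ _]
    simp only [pick_update_of_eq _ (i := (k, J k)) (J := J) rfl]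
    refine (integral_mono_of_nonneg (Eventually.of_forall fun X => integral_nonneg fun u =>
      hit_nonneg hκ _ _) (integrable_const D) (Eventually.of_forall fun X => hD k x _)).trans ?_
    simp
  rw [integral_eq_integral_update (F := fun X => hit κ g ℓ x (pick X J) * hit κ g ℓ x (pick X J'))
    (k, J k) ((hmeas J).mul (hmeas J')) (K := 1) fun X => by
    rw [abs_mul]
    exact mul_le_one₀ (abs_hit_le_one hκ _ _) (abs_nonneg _) (abs_hit_le_one hκ _ _)]
  simp only [pick_update_of_eq _ (i := (k, J k)) (J := J) rfl,
    pick_update_of_ne _ (i := (k, J k)) (J := J') (Ne.symm hk), integral_mul_const]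
  calc ∫ X : Fin m × Fin N → Torus d, (∫ u, hit κ g ℓ x (Function.update (pick X J) k u)) *
        hit κ g ℓ x (pick X J')
      ≤ ∫ X : Fin m × Fin N → Torus d, D * hit κ g ℓ x (pick X J') := by
        refine integral_mono_of_nonneg (Eventually.of_forall fun X => mul_nonneg
          (integral_nonneg fun u => hit_nonneg hκ _ _) (hit_nonneg hκ _ _))
          ((hInt J').const_mul D) (Eventually.of_forall fun X => ?_)
        exact mul_le_mul_of_nonneg_right (hD k x _) (hit_nonneg hκ _ _)
    _ = D * ∫ X : Fin m × Fin N → Torus d, hit κ g ℓ x (pick X J') := integral_const_mul _ _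
    _ ≤ D * D := mul_le_mul_of_nonneg_left (hone J') hD0
    _ = D ^ 2 := (sq D).symm

/-- The weight has mean `1 - N^m q` up to second order. -/
lemma abs_meanWeight_sub_le (hκ : IsCutoff κ) (hg : Measurable g) {D : ℝ}
    (hD : ∀ k x Z, ∫ u, hit κ g ℓ x (Function.update Z k u) ≤ D) (x : Torus d) :
    |meanWeight κ g ℓ N x - (1 - N ^ m * hitProb κ g ℓ x)| ≤ (N ^ m * D) ^ 2 := by
  have hmeas : ∀ J : Fin m → Fin N, Measurable fun X : Fin m × Fin N → Torus d =>
      hit κ g ℓ x (pick X J) := fun J => by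
    have := (measurable_hit_right (ℓ := ℓ) hκ hg x).comp (measurable_pick (d := d) J)
    simpa only [Function.comp_def] using this
  have hInt : ∀ J : Fin m → Fin N, Integrable fun X : Fin m × Fin N → Torus d =>
      hit κ g ℓ x (pick X J) := fun J =>
    integrable_of_measurable_of_abs_le (hmeas J) fun X => abs_hit_le_one hκ _ _
  have hint2 : ∀ p : (Fin m → Fin N) × (Fin m → Fin N), Integrable
      fun X : Fin m × Fin N → Torus d => hit κ g ℓ x (pick X p.1) * hit κ g ℓ x (pick X p.2) :=
    fun p => integrable_of_measurable_of_abs_le (K := 1) ((hmeas p.1).mul (hmeas p.2)) fun X => by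
      rw [abs_mul]
      exact mul_le_one₀ (abs_hit_le_one hκ _ _) (abs_nonneg _) (abs_hit_le_one hκ _ _)
  have hintW : Integrable fun X : Fin m × Fin N → Torus d => avoidWeight κ g ℓ X x :=
    integrable_of_measurable_of_abs_le (K := 1) (measurable_avoidWeight_left hκ hg x) fun X => by
      rw [abs_of_nonneg (avoidWeight_nonneg hκ _ _)]; exact avoidWeight_le_one hκ _ _
  have hsum : ∫ X : Fin m × Fin N → Torus d, (1 - ∑ J, hit κ g ℓ x (pick X J)) =
      1 - N ^ m * hitProb κ g ℓ x := by
    rw [integral_sub (integrable_const _) (integrable_finsetSum _ fun J _ => hInt J),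
      integral_finsetSum _ fun J _ => hInt J]
    simp [integral_hit_pick hκ hg]
  have hintS : Integrable fun X : Fin m × Fin N → Torus d => 1 - ∑ J, hit κ g ℓ x (pick X J) :=
    (integrable_const _).sub (integrable_finsetSum _ fun J _ => hInt J)
  have hintP : Integrable fun X : Fin m × Fin N → Torus d =>
      ∑ p ∈ (Finset.univ : Finset (Fin m → Fin N)).offDiag,
        hit κ g ℓ x (pick X p.1) * hit κ g ℓ x (pick X p.2) :=
    integrable_finsetSum _ fun p _ => hint2 p
  have hlow : 1 - N ^ m * hitProb κ g ℓ x ≤ meanWeight κ g ℓ N x := by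
    rw [← hsum]
    exact integral_mono hintS hintW fun X => one_sub_sum_le_prod_one_sub _
      (fun J => hit_nonneg hκ _ _) fun J => hit_le_one hκ _ _
  have hup : meanWeight κ g ℓ N x ≤ 1 - N ^ m * hitProb κ g ℓ x + (N ^ m * D) ^ 2 := by
    have h1 : meanWeight κ g ℓ N x ≤ ∫ X : Fin m × Fin N → Torus d,
        ((1 - ∑ J, hit κ g ℓ x (pick X J)) +
          ∑ p ∈ (Finset.univ : Finset (Fin m → Fin N)).offDiag,
            hit κ g ℓ x (pick X p.1) * hit κ g ℓ x (pick X p.2)) :=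
      integral_mono hintW (hintS.add hintP) fun X => prod_one_sub_le _
        (fun J => hit_nonneg hκ _ _) fun J => hit_le_one hκ _ _
    rw [integral_add hintS hintP, hsum, integral_finsetSum _ fun p _ => hint2 p] at h1
    refine h1.trans (add_le_add le_rfl ?_)
    calc _ ≤ ∑ _p ∈ (Finset.univ : Finset (Fin m → Fin N)).offDiag, D ^ 2 :=
          Finset.sum_le_sum fun p hp =>
            integral_hit_mul_hit_le hκ hg hD x (Finset.mem_offDiag.1 hp).2.2
      _ = ((Finset.univ : Finset (Fin m → Fin N)).offDiag.card : ℝ) * D ^ 2 := by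
          rw [Finset.sum_const, nsmul_eq_mul]
      _ ≤ ((N : ℝ) ^ m * N ^ m) * D ^ 2 := by
          gcongr
          have : (Finset.univ : Finset (Fin m → Fin N)).offDiag.card ≤ N ^ m * N ^ m := by
            rw [Finset.offDiag_card]; simp
          exact_mod_cast this
      _ = _ := by ring
  rw [abs_le]
  exact ⟨by nlinarith [sq_nonneg ((N : ℝ) ^ m * D)], by linarith⟩

end

/-- With a single variable, the mean of the weight is exactly `(1 - q)^N`. -/
lemma meanWeight_eq_pow {d : ℕ} {κ : (Fin 1 → Torus d) → ℝ} {g : (Fin 1 → Torus d) → Torus d}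
    {ℓ : ℝ} (hκ : IsCutoff κ) (hg : Measurable g) (N : ℕ) (x : Torus d) :
    meanWeight κ g ℓ N x = (1 - hitProb κ g ℓ x) ^ N := by
  have h1 : ∀ X : Fin 1 × Fin N → Torus d, avoidWeight κ g ℓ X x =
      ∏ i, (1 - hit κ g ℓ x fun _ => X i) := by
    intro X
    rw [avoidWeight]
    -- With one variable a tuple is a single sample point, so the factors are independent and the
    -- mean of the product is the product of the means.
    let e : (Fin 1 → Fin N) ≃ Fin 1 × Fin N :=
      { toFun := fun J => (0, J 0)
        invFun := fun i _ => i.2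
        left_inv := fun J => by ext k; rw [Subsingleton.elim k 0]
        right_inv := fun i => by ext <;> simp [Subsingleton.elim i.1 0] }
    refine Fintype.prod_equiv e _ _ fun J => ?_
    congr 2
    ext1 k
    rw [Subsingleton.elim k 0]; rfl
  have hmp := volume_preserving_funUnique (Fin 1) (Torus d)
  have h2 : ∫ u : Torus d, (1 - hit κ g ℓ x fun _ => u) = 1 - hitProb κ g ℓ x := by
    rw [← hmp.integral_comp' (g := fun u => 1 - hit κ g ℓ x fun _ => u)]
    have h3 : ∀ Z : Fin 1 → Torus d,
        (fun _ => MeasurableEquiv.funUnique (Fin 1) (Torus d) Z) = Z := fun Z => by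
      ext1 k
      rw [Subsingleton.elim k 0]; rfl
    simp only [h3]
    have h4 : ∫ Z : Fin 1 → Torus d, (1 - hit κ g ℓ x Z) = 1 - hitProb κ g ℓ x := by
      rw [integral_sub (integrable_const _) (integrable_hit_right hκ hg x)]
      simp [hitProb]
    convert h4
  simp only [meanWeight, h1]
  rw [integral_fintype_prod_volume_eq_pow (ι := Fin 1 × Fin N) (fun u => 1 - hit κ g ℓ x fun _ => u),
    h2]
  simp

end SalemAvoid

end

open Set Filter Topology MeasureTheory
open scoped ENNReal ContDiff

noncomputable section

namespace SalemAvoid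

open UnitAddTorus

/-! ### The mean of the weighted density -/

lemma integrable_mFourier_mul_ofReal {d : ℕ} {θ : Torus d → ℝ} (hθ : Measurable θ) {K : ℝ}
    (hK : ∀ x, |θ x| ≤ K) (ξ : Fin d → ℤ) :
    Integrable fun x => mFourier (-ξ) x * (θ x : ℂ) :=
  Integrable.of_bound ((mFourier (-ξ)).continuous.measurable.mul
    (Complex.measurable_ofReal.comp hθ)).aestronglyMeasurable K
    (Eventually.of_forall fun x => by simpa using hK x)

lemma fnCoeff_sub_const_mul {d : ℕ} {φ ψ : Torus d → ℝ} (hφ : Measurable φ) (hψ : Measurable ψ)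
    {K K' : ℝ} (hK : ∀ x, |φ x| ≤ K) (hK' : ∀ x, |ψ x| ≤ K') (c : ℝ) (ξ : Fin d → ℤ) :
    fnCoeff (fun x => ((φ x - c * ψ x : ℝ) : ℂ)) ξ =
      fnCoeff (fun x => (φ x : ℂ)) ξ - c * fnCoeff (fun x => (ψ x : ℂ)) ξ := by
  rw [fnCoeff, fnCoeff, fnCoeff, ← integral_const_mul,
    ← integral_sub (integrable_mFourier_mul_ofReal hφ hK ξ)
      ((integrable_mFourier_mul_ofReal hψ hK' ξ).const_mul _)]
  refine integral_congr_ae (Eventually.of_forall fun x => ?_)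
  push_cast
  ring

lemma norm_fnCoeff_ofReal_mul_le {d : ℕ} {q h : Torus d → ℝ} (hq : Measurable q)
    (hh : Measurable h) {Kq Kh : ℝ} (hKq : ∀ x, |q x| ≤ Kq) (hKh : ∀ x, |h x| ≤ Kh) {σ A B : ℝ}
    (hσ : 0 ≤ σ)
    (hB : ∀ η, ‖fnCoeff (fun x => (q x : ℂ)) η‖ ≤ B * freqWeight η ^ (-(σ + d + 1)))
    (hA : ∀ ξ, ‖fnCoeff (fun x => (h x : ℂ)) ξ‖ ≤ A * freqWeight ξ ^ (-σ)) (ξ : Fin d → ℤ) :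
    ‖fnCoeff (fun x => ((q x * h x : ℝ) : ℂ)) ξ‖ ≤ multConst d * B * A * freqWeight ξ ^ (-σ) := by
  have := norm_fnCoeff_mul_le (Complex.measurable_ofReal.comp hq)
    (Complex.measurable_ofReal.comp hh) (Kq := Kq) (Kg := Kh) (fun x => by simpa using hKq x)
    (fun x => by simpa using hKh x) hσ hB hA ξ
  simpa using this

/-- The first-order term N^m q h has decaying coefficients. The quadratic remainder is controlled
only in sup norm, so its contribution has no decay in ξ; this is the term that limits the dimension
for n ≥ 3. -/
lemma norm_fnCoeff_meanWeight_sub_le {m d N : ℕ} {κ : (Fin m → Torus d) → ℝ}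
    {g : (Fin m → Torus d) → Torus d} {ℓ : ℝ} (hκ : IsCutoff κ) (hg : Measurable g) {D : ℝ}
    (hD : ∀ k x Z, ∫ u, hit κ g ℓ x (Function.update Z k u) ≤ D) {h : Torus d → ℝ}
    (hh : Measurable h) {H : ℝ} (hH : ∀ x, |h x| ≤ H) {σ A B : ℝ} (hσ : 0 ≤ σ)
    (hB : ∀ η, ‖fnCoeff (fun x => (hitProb κ g ℓ x : ℂ)) η‖ ≤ B * freqWeight η ^ (-(σ + d + 1)))
    (hA : ∀ ξ, ‖fnCoeff (fun x => (h x : ℂ)) ξ‖ ≤ A * freqWeight ξ ^ (-σ)) (ξ : Fin d → ℤ) :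
    ‖fnCoeff (fun x => ((meanWeight κ g ℓ N x * h x : ℝ) : ℂ)) ξ - fnCoeff (fun x => (h x : ℂ)) ξ‖ ≤
      N ^ m * (multConst d * B * A) * freqWeight ξ ^ (-σ) + (N ^ m * D) ^ 2 * H := by
  have hH0 : 0 ≤ H := (abs_nonneg _).trans (hH 0)
  have hqm := measurable_hitProb (ℓ := ℓ) hκ hg
  have hq1 : ∀ x, |hitProb κ g ℓ x| ≤ 1 := fun x => by
    rw [abs_of_nonneg (hitProb_nonneg hκ x)]; exact hitProb_le_one hκ x
  have hqh1 : ∀ x, |hitProb κ g ℓ x * h x| ≤ H := fun x => by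
    rw [abs_mul]; exact (mul_le_of_le_one_left (abs_nonneg _) (hq1 x)).trans (hH x)
  have hWm : Measurable (meanWeight κ g ℓ N) := by
    have h1 := measurable_avoidWeight (N := N) (ℓ := ℓ) hκ hg
    exact (h1.stronglyMeasurable.integral_prod_left').measurable
  have hW1 : ∀ x, |meanWeight κ g ℓ N x| ≤ 1 := fun x => abs_integral_le_of_abs_le fun X => by
    rw [abs_of_nonneg (avoidWeight_nonneg hκ X x)]; exact avoidWeight_le_one hκ X x
  have hWh1 : ∀ x, |meanWeight κ g ℓ N x * h x| ≤ H := fun x => by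
    rw [abs_mul]; exact (mul_le_of_le_one_left (abs_nonneg _) (hW1 x)).trans (hH x)
  have hlin := fnCoeff_sub_const_mul hh (hqm.mul hh) hH hqh1 ((N : ℝ) ^ m) ξ
  simp only [Pi.mul_apply] at hlin
  have hdiffb : ∀ x, |h x - (N : ℝ) ^ m * (hitProb κ g ℓ x * h x)| ≤ H + (N : ℝ) ^ m * H := by
    intro x
    refine (abs_sub _ _).trans (add_le_add (hH x) ?_)
    rw [abs_mul, abs_of_nonneg (by positivity : (0 : ℝ) ≤ (N : ℝ) ^ m)]
    gcongr
    exact hqh1 x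
  have h1 := norm_fnCoeff_sub_le (hWm.mul hh) (hh.sub ((hqm.mul hh).const_mul ((N : ℝ) ^ m)))
    hWh1 hdiffb ξ
  have h2 : ∫ x, |meanWeight κ g ℓ N x * h x - (h x - (N : ℝ) ^ m * (hitProb κ g ℓ x * h x))| ≤
      (N ^ m * D) ^ 2 * H := by
    refine (le_abs_self _).trans (abs_integral_le_of_abs_le fun x => ?_)
    rw [abs_abs]
    have : meanWeight κ g ℓ N x * h x - (h x - (N : ℝ) ^ m * (hitProb κ g ℓ x * h x)) =
        (meanWeight κ g ℓ N x - (1 - N ^ m * hitProb κ g ℓ x)) * h x := by ring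
    rw [this, abs_mul]
    exact mul_le_mul (abs_meanWeight_sub_le hκ hg hD x) (hH x) (abs_nonneg _) (sq_nonneg _)
  have h3 := norm_fnCoeff_ofReal_mul_le hqm hh hq1 hH hσ hB hA ξ
  have h4 : fnCoeff (fun x => ((meanWeight κ g ℓ N x * h x : ℝ) : ℂ)) ξ -
      fnCoeff (fun x => (h x : ℂ)) ξ =
      (fnCoeff (fun x => ((meanWeight κ g ℓ N x * h x : ℝ) : ℂ)) ξ -
        fnCoeff (fun x => ((h x - (N : ℝ) ^ m * (hitProb κ g ℓ x * h x) : ℝ) : ℂ)) ξ) -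
      (((N : ℝ) ^ m : ℝ) : ℂ) * fnCoeff (fun x => ((hitProb κ g ℓ x * h x : ℝ) : ℂ)) ξ := by
    rw [hlin]; ring
  rw [h4]
  refine (norm_sub_le _ _).trans ?_
  rw [norm_mul, Complex.norm_real, Real.norm_eq_abs,
    abs_of_nonneg (by positivity : (0 : ℝ) ≤ (N : ℝ) ^ m), add_comm]
  refine add_le_add ?_ (h1.trans h2)
  rw [mul_assoc]
  exact mul_le_mul_of_nonneg_left h3 (by positivity)

/-- Each multiplication by 1 - q preserves the decay and enlarges the constant by at most 1 +
`multConst d` · B. Expanding to all orders in this way leaves no rough remainder. -/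
lemma norm_fnCoeff_one_sub_pow_mul_sub_le {d : ℕ} {q h : Torus d → ℝ} (hq : Measurable q)
    (hq0 : ∀ x, 0 ≤ q x) (hq1 : ∀ x, q x ≤ 1) (hh : Measurable h) {H : ℝ} (hH : ∀ x, |h x| ≤ H)
    {σ A B : ℝ} (hσ : 0 ≤ σ)
    (hB : ∀ η, ‖fnCoeff (fun x => (q x : ℂ)) η‖ ≤ B * freqWeight η ^ (-(σ + d + 1)))
    (hA : ∀ ξ, ‖fnCoeff (fun x => (h x : ℂ)) ξ‖ ≤ A * freqWeight ξ ^ (-σ)) (N : ℕ) :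
    ∀ ξ, ‖fnCoeff (fun x => (((1 - q x) ^ N * h x : ℝ) : ℂ)) ξ - fnCoeff (fun x => (h x : ℂ)) ξ‖ ≤
      ((1 + multConst d * B) ^ N - 1) * A * freqWeight ξ ^ (-σ) := by
  have hq1' : ∀ x, |q x| ≤ 1 := fun x => by rw [abs_of_nonneg (hq0 x)]; exact hq1 x
  induction N with
  | zero => intro ξ; simp
  | succ N ih =>
    intro ξ
    have hb : ∀ x, |(1 - q x) ^ N * h x| ≤ H := fun x => by
      rw [abs_mul, abs_pow]
      refine (mul_le_of_le_one_left (abs_nonneg _) (pow_le_one₀ (abs_nonneg _) ?_)).trans (hH x)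
      rw [abs_le]; constructor <;> linarith [hq0 x, hq1 x]
    have hm : Measurable fun x => (1 - q x) ^ N * h x := ((hq.const_sub 1).pow_const N).mul hh
    have hb' : ∀ x, |q x * ((1 - q x) ^ N * h x)| ≤ H := fun x => by
      rw [abs_mul]; exact (mul_le_of_le_one_left (abs_nonneg _) (hq1' x)).trans (hb x)
    have hA' : ∀ ξ, ‖fnCoeff (fun x => (((1 - q x) ^ N * h x : ℝ) : ℂ)) ξ‖ ≤
        ((1 + multConst d * B) ^ N * A) * freqWeight ξ ^ (-σ) := fun ξ => by
      have h1 := norm_le_norm_add_norm_sub (fnCoeff (fun x => (h x : ℂ)) ξ)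
        (fnCoeff (fun x => (((1 - q x) ^ N * h x : ℝ) : ℂ)) ξ)
      rw [norm_sub_rev] at h1
      have h2 := ih ξ
      have h3 := hA ξ
      linarith
    have h1 := norm_fnCoeff_ofReal_mul_le hq hm hq1' hb hσ hB hA' ξ
    have h2 := fnCoeff_sub_const_mul hm (hq.mul hm) hb hb' 1 ξ
    simp only [Pi.mul_apply] at h2
    have h3 : ∀ x, (1 - q x) ^ N * h x - 1 * (q x * ((1 - q x) ^ N * h x)) =
        (1 - q x) ^ (N + 1) * h x := fun x => by ring
    simp only [h3] at h2
    rw [h2, Complex.ofReal_one, one_mul, sub_right_comm]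
    refine (norm_sub_le _ _).trans ((add_le_add (ih ξ) h1).trans (le_of_eq ?_))
    ring

/-- The mean of the weighted density is close to the density if `s'` is below the critical
exponent. -/
theorem eventually_mean_close {m d : ℕ} {κ : (Fin m → Torus d) → ℝ}
    {g : (Fin m → Torus d) → Torus d} (hκ : IsCutoff κ) (hg : Measurable g)
    (hdec : ∀ M : ℕ, ∃ C, ∀ ξ : Fin d → ℤ,
      freqWeight ξ ^ M * ‖∫ Z, (κ Z : ℂ) * mFourier (-ξ) (g Z)‖ ≤ C) {C₂ : ℝ}
    (hcoord : ∀ ℓ, 0 ≤ ℓ → ∀ k x Z, ∫ u, hit κ g ℓ x (Function.update Z k u) ≤ C₂ * ℓ ^ d)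
    {h : Torus d → ℝ} (hh : Measurable h) {H : ℝ} (hH : ∀ x, |h x| ≤ H) {A : ℝ}
    (hA : ∀ ξ, ‖fnCoeff (fun x => (h x : ℂ)) ξ‖ ≤ A * freqWeight ξ ^ (-(d : ℝ))) {s s' : ℝ}
    (hs : 0 ≤ s) (hss : s < s') (hsd : s' ≤ d)
    (hcrit : (m = 1 ∧ s' < d) ∨ (m : ℝ) + 1 / 4 < d / s') {L : ℝ} (hL : 0 < L) {δ : ℝ}
    (hδ : 0 < δ) :
    ∀ᶠ N : ℕ in atTop, ∀ ξ, freqWeight ξ ^ (s / 2) *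
      ‖fourierCoeff (mollifier d (scale s' N)) ξ‖ *
        ‖fnCoeff (fun x => ((meanWeight κ g (L * scale s' N) N x * h x : ℝ) : ℂ)) ξ -
          fnCoeff (fun x => (h x : ℂ)) ξ‖ ≤ δ := by
  have hs' : 0 < s' := hs.trans_lt hss
  have hH0 : 0 ≤ H := (abs_nonneg _).trans (hH 0)
  have hA0 : 0 ≤ A := nonneg_of_mul_nonneg_left ((norm_nonneg _).trans (hA 0))
    (Real.rpow_pos_of_pos (freqWeight_pos 0) _)
  have hmc := multConst_nonneg d
  obtain ⟨C₁, hC₁⟩ := hdec (2 * d + 1)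
  obtain ⟨C₃, hC₃, hmol⟩ := exists_mollifier_weight_le d (t := s / 2) (by linarith)
  have hq : ∀ ℓ, 0 ≤ ℓ → ∀ η : Fin d → ℤ, ‖fnCoeff (fun x => (hitProb κ g ℓ x : ℂ)) η‖ ≤
      ((2 * ℓ) ^ d * |C₁|) * freqWeight η ^ (-((d : ℝ) + d + 1)) := by
    intro ℓ hℓ η
    refine (norm_fnCoeff_hitProb_le hκ hg hℓ η).trans ?_
    rw [mul_assoc]
    refine mul_le_mul_of_nonneg_left ?_ (by positivity)
    have hw := freqWeight_pos η
    have h1 : freqWeight η ^ (-((d : ℝ) + d + 1)) = (freqWeight η ^ (2 * d + 1))⁻¹ := by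
      rw [Real.rpow_neg hw.le, ← Real.rpow_natCast]
      push_cast
      ring_nf
    rw [h1, ← div_eq_mul_inv, le_div_iff₀ (by positivity), mul_comm]
    exact (hC₁ η).trans (le_abs_self _)
  -- The expected number of hits at a point is of order N^m ℓ^d, which is a constant times N^y.
  set y : ℝ := m - d / s' with hy
  have hy0 : y < 0 := by
    rcases hcrit with ⟨h1, h2⟩ | h1
    · have : 1 < d / s' := (one_lt_div hs').2 h2
      rw [hy, h1, Nat.cast_one]; linarith
    · linarith
  have hpow : ∀ N : ℕ, 1 ≤ N → (N : ℝ) ^ m * (L * scale s' N) ^ d = L ^ d * (N : ℝ) ^ y := by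
    intro N hN
    have hN0 : (0 : ℝ) < N := by exact_mod_cast hN
    rw [mul_pow, ← Real.rpow_natCast (scale s' N), scale_rpow, hy, sub_eq_add_neg,
      Real.rpow_add hN0, Real.rpow_natCast]
    ring
  have hweight : ∀ ξ : Fin d → ℤ, freqWeight ξ ^ (s / 2) * freqWeight ξ ^ (-(d : ℝ)) ≤ 1 := by
    intro ξ
    rw [← Real.rpow_add (freqWeight_pos ξ)]
    exact Real.rpow_le_one_of_one_le_of_nonpos (one_le_freqWeight ξ) (by linarith)
  have hsimple : ∀ (N : ℕ) (ξ : Fin d → ℤ) (T : ℝ), 0 ≤ T → freqWeight ξ ^ (s / 2) *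
      ‖fourierCoeff (mollifier d (scale s' N)) ξ‖ * (T * freqWeight ξ ^ (-(d : ℝ))) ≤ T := by
    intro N ξ T hT
    have h1 := norm_fourierCoeff_le_one (mollifier d (scale s' N)) ξ
    calc _ = ‖fourierCoeff (mollifier d (scale s' N)) ξ‖ *
          (freqWeight ξ ^ (s / 2) * freqWeight ξ ^ (-(d : ℝ))) * T := by ring
      _ ≤ 1 * 1 * T := by
          have := freqWeight_pos ξ
          gcongr
          exact hweight ξ
      _ = T := by ring
  rcases hcrit with ⟨rfl, hsd'⟩ | hcrit
  · set c : ℝ := multConst d * (2 ^ d * |C₁| * L ^ d) with hc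
    have hlim : Tendsto (fun N : ℕ => (Real.exp (c * (N : ℝ) ^ y) - 1) * A) atTop
        (𝓝 ((Real.exp (c * 0) - 1) * A)) :=
      (((Real.continuous_exp.tendsto _).comp
        ((tendsto_natCast_rpow_neg hy0).const_mul c)).sub_const 1).mul_const A
    rw [mul_zero, Real.exp_zero, sub_self, zero_mul] at hlim
    filter_upwards [hlim.eventually_le_const hδ, eventually_ge_atTop 1] with N hN hN1 ξ
    have hN0 : (0 : ℝ) < N := by exact_mod_cast hN1
    have hr := scale_pos (s := s') hN1
    set ℓ := L * scale s' N with hℓ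
    have hℓ0 : 0 ≤ ℓ := by positivity
    set B := (2 * ℓ) ^ d * |C₁| with hB
    have hB0 : 0 ≤ B := by positivity
    have h1 := norm_fnCoeff_one_sub_pow_mul_sub_le (measurable_hitProb (ℓ := ℓ) hκ hg)
      (hitProb_nonneg hκ) (hitProb_le_one hκ) hh hH (Nat.cast_nonneg d) (hq ℓ hℓ0) hA N ξ
    simp only [← meanWeight_eq_pow hκ hg] at h1
    have h2 : (1 + multConst d * B) ^ N ≤ Real.exp (c * (N : ℝ) ^ y) := by
      have h3 : c * (N : ℝ) ^ y = N * (multConst d * B) := by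
        have := hpow N hN1
        rw [pow_one] at this
        rw [hB, mul_pow, hc]
        linear_combination (-(multConst d * 2 ^ d * |C₁|)) * this
      rw [h3, Real.exp_nat_mul]
      refine pow_le_pow_left₀ (by positivity) ?_ N
      rw [add_comm]; exact Real.add_one_le_exp _
    have h4 : 1 ≤ (1 + multConst d * B) ^ N := one_le_pow₀ (by
      have : 0 ≤ multConst d * B := by positivity
      linarith)
    calc _ ≤ freqWeight ξ ^ (s / 2) * ‖fourierCoeff (mollifier d (scale s' N)) ξ‖ *
          (((1 + multConst d * B) ^ N - 1) * A * freqWeight ξ ^ (-(d : ℝ))) := by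
            have := freqWeight_pos ξ
            gcongr
      _ ≤ ((1 + multConst d * B) ^ N - 1) * A := by
          refine hsimple N ξ _ (mul_nonneg ?_ hA0); linarith
      _ ≤ (Real.exp (c * (N : ℝ) ^ y) - 1) * A := by gcongr
      _ ≤ δ := hN
  · set c₁ : ℝ := multConst d * (2 ^ d * |C₁|) * A * L ^ d with hc₁
    set c₂ : ℝ := C₃ * C₂ ^ 2 * H * (L ^ d) ^ 2 with hc₂
    -- The quadratic error N^(2y) times the cost N^(s/(2s')) < N^(1/2) of the weight. This is where
    -- the extra 1/4 in the critical exponent is needed.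
    have hz : 2 * y + s / (2 * s') < 0 := by
      have h1 : s / (2 * s') < 1 / 2 := by
        rw [div_lt_div_iff₀ (by positivity) (by norm_num)]; linarith
      rw [hy]; linarith
    have hlim : Tendsto (fun N : ℕ => c₁ * (N : ℝ) ^ y + c₂ * (N : ℝ) ^ (2 * y + s / (2 * s')))
        atTop (𝓝 (c₁ * 0 + c₂ * 0)) :=
      ((tendsto_natCast_rpow_neg hy0).const_mul c₁).add
        ((tendsto_natCast_rpow_neg hz).const_mul c₂)
    rw [mul_zero, mul_zero, add_zero] at hlim
    filter_upwards [hlim.eventually_le_const hδ, eventually_ge_atTop 1] with N hN hN1 ξ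
    have hN0 : (0 : ℝ) < N := by exact_mod_cast hN1
    have hr := scale_pos (s := s') hN1
    set ℓ := L * scale s' N with hℓ
    have hℓ0 : 0 ≤ ℓ := by positivity
    have hw := freqWeight_pos ξ
    have h1 := norm_fnCoeff_meanWeight_sub_le (N := N) hκ hg (hcoord ℓ hℓ0) hh hH
      (Nat.cast_nonneg d) (hq ℓ hℓ0) hA ξ
    have hp := hpow N hN1
    refine le_trans ?_ hN
    have h2 := hmol _ hr (scale_le_one hs' hN1) ξ
    have h3 := hsimple N ξ (N ^ m * (multConst d * ((2 * ℓ) ^ d * |C₁|) * A)) (by positivity)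
    have h4 : (N : ℝ) ^ m * (multConst d * ((2 * ℓ) ^ d * |C₁|) * A) = c₁ * (N : ℝ) ^ y := by
      rw [mul_pow, hc₁]
      linear_combination (multConst d * 2 ^ d * |C₁| * A) * hp
    have h5 : C₃ * scale s' N ^ (-(s / 2)) * ((N ^ m * (C₂ * ℓ ^ d)) ^ 2 * H) =
        c₂ * (N : ℝ) ^ (2 * y + s / (2 * s')) := by
      have h6 : ((N : ℝ) ^ m * (C₂ * ℓ ^ d)) ^ 2 = C₂ ^ 2 * (L ^ d * (N : ℝ) ^ y) ^ 2 := by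
        rw [← hp]; ring
      have h7 : (N : ℝ) ^ (2 * y + s / (2 * s')) =
          ((N : ℝ) ^ y) ^ 2 * scale s' N ^ (-(s / 2)) := by
        rw [scale_rpow, Real.rpow_add hN0, ← Real.rpow_natCast ((N : ℝ) ^ y),
          ← Real.rpow_mul hN0.le]
        congr 2
        · push_cast; ring
        · field_simp
      rw [h6, h7, hc₂]
      ring
    calc _ ≤ freqWeight ξ ^ (s / 2) * ‖fourierCoeff (mollifier d (scale s' N)) ξ‖ *
          (N ^ m * (multConst d * ((2 * ℓ) ^ d * |C₁|) * A) * freqWeight ξ ^ (-(d : ℝ)) +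
            (N ^ m * (C₂ * ℓ ^ d)) ^ 2 * H) := by gcongr
      _ = freqWeight ξ ^ (s / 2) * ‖fourierCoeff (mollifier d (scale s' N)) ξ‖ *
          (N ^ m * (multConst d * ((2 * ℓ) ^ d * |C₁|) * A) * freqWeight ξ ^ (-(d : ℝ))) +
          freqWeight ξ ^ (s / 2) * ‖fourierCoeff (mollifier d (scale s' N)) ξ‖ *
            ((N ^ m * (C₂ * ℓ ^ d)) ^ 2 * H) := by ring
      _ ≤ c₁ * (N : ℝ) ^ y + c₂ * (N : ℝ) ^ (2 * y + s / (2 * s')) := by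
          refine add_le_add (h3.trans_eq h4) (le_trans ?_ h5.le)
          exact mul_le_mul_of_nonneg_right h2 (by positivity)

end SalemAvoid

end

open Set Filter Topology MeasureTheory
open scoped ENNReal ContDiff

noncomputable section

namespace SalemAvoid

open UnitAddTorus

/-! ### Approximation by measures avoiding the pattern locally -/

lemma fourierCoeff_add {d : ℕ} (μ ν : Measure (Torus d)) [IsFiniteMeasure μ] [IsFiniteMeasure ν]
    (ξ : Fin d → ℤ) : fourierCoeff (μ + ν) ξ = fourierCoeff μ ξ + fourierCoeff ν ξ :=
  integral_add_measure (integrable_mFourier μ _) (integrable_mFourier ν _)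

lemma continuous_integrable {d : ℕ} {φ : Torus d → ℂ} (hφ : Continuous φ) : Integrable φ :=
  hφ.integrable_of_hasCompactSupport (HasCompactSupport.of_compactSpace _)

lemma fnCoeff_sub_sum {d m : ℕ} {ρ : Torus d → ℝ} (hρ : Continuous ρ) {G : Fin m → Torus d → ℝ}
    (hG : ∀ k, Continuous (G k)) (ξ : Fin d → ℤ) :
    fnCoeff (fun x => ((ρ x - ∑ k, G k x : ℝ) : ℂ)) ξ =
      fnCoeff (fun x => (ρ x : ℂ)) ξ - ∑ k, fnCoeff (fun x => (G k x : ℂ)) ξ := by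
  have hc : ∀ {φ : Torus d → ℝ}, Continuous φ →
      Integrable fun x => mFourier (-ξ) x * (φ x : ℂ) := fun hφ =>
    continuous_integrable ((mFourier (-ξ)).continuous.mul (Complex.continuous_ofReal.comp hφ))
  simp only [fnCoeff]
  rw [← integral_finsetSum _ fun k _ => hc (hG k),
    ← integral_sub (hc hρ) (integrable_finsetSum _ fun k _ => hc (hG k))]
  refine integral_congr_ae (Eventually.of_forall fun x => ?_)
  push_cast
  rw [mul_sub, Finset.mul_sum]

lemma pow_mul_scale_pow_le_one {m d N : ℕ} (hN : 1 ≤ N) {s : ℝ} (h : (m : ℝ) ≤ d / s) :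
    (N : ℝ) ^ m * scale s N ^ d ≤ 1 := by
  have hN0 : (0 : ℝ) < N := by exact_mod_cast hN
  rw [← Real.rpow_natCast, ← Real.rpow_natCast, scale_rpow, ← Real.rpow_add hN0]
  exact Real.rpow_le_one_of_one_le_of_nonpos (by exact_mod_cast hN) (by linarith)

/-- With n = m + 1 the number n - 3/4 is m + 1/4, so being below the critical dimension is the
condition on exponents used for the means. The bound m ≤ d/s is what the bounded differences use. -/
lemma lt_criticalDim {m d : ℕ} (hm : 0 < m) {s β : ℝ} (hs : 0 < s) (hsβ : s < β)
    (hβ : β ≤ criticalDim d (m + 1)) :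
    ((m = 1 ∧ s < d) ∨ (m : ℝ) + 1 / 4 < d / s) ∧ s ≤ d ∧ (m : ℝ) ≤ d / s := by
  rw [criticalDim] at hβ
  have hm1 : (1 : ℝ) ≤ m := by exact_mod_cast hm
  split_ifs at hβ with h
  · have h1 : m = 1 := by omega
    refine ⟨Or.inl ⟨h1, by linarith⟩, by linarith, ?_⟩
    rw [h1, Nat.cast_one, one_le_div hs]; linarith
  · have h1 : (m : ℝ) + 1 / 4 < d / s := by
      push_cast at hβ
      have h2 : s < d / ((m : ℝ) + 1 - 3 / 4) := by linarith
      rw [lt_div_iff₀ (by linarith)] at h2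
      rw [lt_div_iff₀ hs]; linarith
    refine ⟨Or.inr h1, ?_, by linarith⟩
    have h2 : 1 ≤ d / s := by linarith
    rwa [one_le_div hs] at h2

/-- If u and u₀ both hit x, their images are within 2ℓ of each other, so by expansion in the k-th
variable u lies in the ball of radius 2ℓ/c around u₀. -/
lemma integral_hit_update_le {m d : ℕ} {κ : (Fin m → Torus d) → ℝ}
    {g : (Fin m → Torus d) → Torus d} (hκ : IsCutoff κ) (hg : Measurable g) {c : ℝ} (hc : 0 < c)
    (hexp : ∀ k Z u, κ Z ≠ 0 → κ (Function.update Z k u) ≠ 0 →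
      c * dist (Z k) u ≤ dist (g Z) (g (Function.update Z k u))) {ℓ : ℝ} (hℓ : 0 ≤ ℓ) (k : Fin m)
    (x : Torus d) (Z : Fin m → Torus d) :
    ∫ u, hit κ g ℓ x (Function.update Z k u) ≤ (4 / c) ^ d * ℓ ^ d := by
  by_cases hne : ∃ u₀, hit κ g ℓ x (Function.update Z k u₀) ≠ 0
  · obtain ⟨u₀, hu₀⟩ := hne
    have hmem : ∀ {Y}, hit κ g ℓ x Y ≠ 0 → κ Y ≠ 0 ∧ dist x (g Y) ≤ ℓ := by
      intro Y hY
      rw [hit] at hY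
      split_ifs at hY with h
      · exact ⟨hY, h⟩
      · exact absurd rfl hY
    have hsub : ∀ u, hit κ g ℓ x (Function.update Z k u) ≠ 0 →
        u ∈ Metric.closedBall u₀ (2 * ℓ / c) := by
      intro u hu
      obtain ⟨h1, h2⟩ := hmem hu₀
      obtain ⟨h3, h4⟩ := hmem hu
      have h5 := hexp k (Function.update Z k u₀) u h1 (by rwa [Function.update_idem])
      rw [Function.update_self, Function.update_idem] at h5
      rw [Metric.mem_closedBall, dist_comm, le_div_iff₀ hc]
      have h6 := dist_triangle_left (g (Function.update Z k u₀)) (g (Function.update Z k u)) x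
      linarith
    have hmeas : Measurable fun u => hit κ g ℓ x (Function.update Z k u) := by
      have := (measurable_hit_right (ℓ := ℓ) hκ hg x).comp (measurable_update Z (a := k))
      simpa only [Function.comp_def] using this
    have h1 : (2 * (2 * ℓ / c)) ^ d = (4 / c) ^ d * ℓ ^ d := by rw [← mul_pow]; congr 1; ring
    rw [← h1]
    refine le_trans ?_ (measureReal_closedBall_le u₀ (by positivity))
    rw [← integral_indicator_one Metric.isClosed_closedBall.measurableSet]
    refine integral_mono (integrable_of_measurable_of_abs_le hmeas fun u => abs_hit_le_one hκ _ _)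
      ((integrable_const (1 : ℝ)).indicator Metric.isClosed_closedBall.measurableSet) fun u => ?_
    by_cases hu : hit κ g ℓ x (Function.update Z k u) = 0
    · simp only [hu]
      exact indicator_nonneg (fun _ _ => zero_le_one) u
    · rw [indicator_of_mem (hsub u hu)]
      exact hit_le_one hκ _ _
  · push Not at hne
    simp only [hne, integral_zero]
    positivity

lemma isCutoff_tupleBump {m d : ℕ} (ρ R : ℝ) (c : Fin m → Torus d) : IsCutoff (tupleBump ρ R c) :=
  ⟨(continuous_tupleBump ρ R c).measurable, tupleBump_nonneg ρ R c, tupleBump_le_one ρ R c⟩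

lemma tupleBump_eq_one {m d : ℕ} {ρ R : ℝ} (hρ : 0 ≤ ρ) (hρR : ρ < R) (hR : R ≤ 1 / 2)
    {c Z : Fin m → Torus d} (h : dist Z c ≤ ρ) : tupleBump ρ R c Z = 1 :=
  Finset.prod_eq_one fun k _ => torusBump_eq_one hρ hρR hR (by
    rw [← dist_eq_norm]; exact (dist_le_pi_dist Z c k).trans h)

lemma exists_fnCoeff_bump_mul_le {d : ℕ} {ρ : Torus d → ℝ} (hρ : IsSmoothDensity ρ) {a b : ℝ}
    (ha : 0 ≤ a) (hab : a < b) (hb : b < 1 / 2) (c : Torus d) :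
    ∃ A, ∀ ξ, ‖fnCoeff (fun x => ((torusBump a b (x - c) * ρ x : ℝ) : ℂ)) ξ‖ ≤
      A * freqWeight ξ ^ (-(d : ℝ)) := by
  obtain ⟨C, hC⟩ := exists_fnCoeff_torusBump_le (d := d) ha hab hb (2 * d + 1)
  obtain ⟨A, -, hA⟩ := hρ.exists_weighted_le d
  obtain ⟨K, hK⟩ := (isCompact_range hρ.continuous).bddAbove
  refine ⟨_, norm_fnCoeff_ofReal_mul_le (σ := d) (A := A) (B := C) (Kq := 1) (Kh := K)
    ((continuous_torusBump a b).comp (continuous_id.sub continuous_const)).measurable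
    hρ.continuous.measurable (fun x => ?_) (fun x => ?_) (Nat.cast_nonneg d) (fun η => ?_)
    fun ξ => ?_⟩
  · rw [Function.comp_apply, abs_of_nonneg (torusBump_nonneg a b _)]; exact torusBump_le_one a b _
  · rw [abs_of_nonneg (hρ.nonneg x)]; exact hK (mem_range_self x)
  · have hw := freqWeight_pos η
    have h1 : freqWeight η ^ (-((d : ℝ) + d + 1)) = (freqWeight η ^ (2 * d + 1))⁻¹ := by
      rw [Real.rpow_neg hw.le, ← Real.rpow_natCast]
      push_cast
      ring_nf
    rw [h1, ← div_eq_mul_inv, le_div_iff₀ (by positivity), mul_comm]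
    exact hC c η
  · have hw := freqWeight_pos ξ
    rw [Real.rpow_neg hw.le, ← div_eq_mul_inv,
      le_div_iff₀ (Real.rpow_pos_of_pos hw _), mul_comm]
    exact hA ξ

end SalemAvoid

end

open Set Filter Topology MeasureTheory
open scoped ENNReal ContDiff

noncomputable section

namespace SalemAvoid

open UnitAddTorus

/-- The bumps have radius 2η and their centres are more than 8η apart, so at most one is nonzero at
each point. -/
lemma sum_torusBump_le_one {m d : ℕ} {x : Fin m → Torus d} {η : ℝ} (hη : 0 < η) (hη' : η ≤ 1 / 8)
    (hsep : ∀ i j, i ≠ j → 8 * η < dist (x i) (x j)) (u : Torus d) :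
    ∑ k, torusBump (3 / 2 * η) (2 * η) (u - x k) ≤ 1 := by
  by_cases h : ∃ k, torusBump (3 / 2 * η) (2 * η) (u - x k) ≠ 0
  · obtain ⟨k, hk⟩ := h
    have hk1 : dist u (x k) < 2 * η := by
      by_contra hlt
      exact hk (torusBump_eq_zero (by positivity) (by linarith) (by linarith)
        (by rw [← dist_eq_norm]; exact not_lt.1 hlt))
    rw [Finset.sum_eq_single k]
    · exact torusBump_le_one _ _ _
    · intro j _ hj
      refine torusBump_eq_zero (by positivity) (by linarith) (by linarith) ?_
      rw [← dist_eq_norm]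
      have h1 := hsep j k hj
      have h2 := dist_triangle_left (x j) (x k) u
      linarith
    · simp
  · push Not at h
    simp [h]

/-- A smooth density is approximated by measures whose supports contain no points close to
`(x, y)` that satisfy `y' = f(x')`. -/
theorem exists_avoiding_measure {m d : ℕ} (hm : 0 < m) {f : (Fin m → Torus d) → Torus d}
    {x : Fin m → Torus d} {y : Torus d} {R₀ Λ c η : ℝ} (hR₀' : R₀ ≤ 1 / 4) (hΛ : 0 < Λ)
    (hc : 0 < c)
    (hlip : ∀ Z ∈ Metric.closedBall x R₀, ∀ Z' ∈ Metric.closedBall x R₀,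
      dist (f Z) (f Z') ≤ Λ * dist Z Z')
    (hexp : ∀ k, ∀ Z ∈ Metric.closedBall x R₀, ∀ u,
      Function.update Z k u ∈ Metric.closedBall x R₀ →
        c * dist (Z k) u ≤ dist (f Z) (f (Function.update Z k u)))
    (hdec : ∀ ρ R, 0 ≤ ρ → ρ < R → R < R₀ → ∀ M : ℕ, ∃ C, ∀ ξ : Fin d → ℤ, freqWeight ξ ^ M *
      ‖∫ Z, (tupleBump ρ R x Z : ℂ) * mFourier (-ξ) (f Z)‖ ≤ C)
    (hη : 0 < η) (hηR : 2 * η < R₀) (hsep : ∀ i j, i ≠ j → 8 * η < dist (x i) (x j))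
    (hsepy : ∀ k, 8 * η < dist (x k) y)
    {ρ : Torus d → ℝ} (hρ : IsSmoothDensity ρ) {s β : ℝ} (hs : 0 ≤ s) (hsβ : s < β)
    (hβ : β ≤ criticalDim d (m + 1)) {δ : ℝ} (hδ : 0 < δ) :
    ∃ μ : Measure (Torus d), IsProbabilityMeasure μ ∧ (∀ t, 0 ≤ t → HasFourierDecay t μ) ∧
      (∀ ξ, freqWeight ξ ^ (s / 2) *
        ‖fourierCoeff μ ξ - fnCoeff (fun x => (ρ x : ℂ)) ξ‖ ≤ δ) ∧
      μ.support ⊆ Metric.cthickening δ {x | ρ x ≠ 0} ∧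
      ∀ z ∈ Metric.closedBall x η, ∀ y' ∈ Metric.closedBall y η, (∀ k, z k ∈ μ.support) →
        y' ∈ μ.support → y' ≠ f z := by
  obtain ⟨s', hss, hs'β⟩ := exists_between hsβ
  have hs' : 0 < s' := hs.trans_lt hss
  obtain ⟨hcrit, hs'd, hmd⟩ := lt_criticalDim hm hs' hs'β hβ
  have hη8 : η ≤ 1 / 8 := by linarith
  -- Points within η of x k are moved by less than 2r < η/2 to reach the unmollified support, so
  -- they stay in the region of radius a where the bump is 1.
  set a : ℝ := 3 / 2 * η with ha
  set b : ℝ := 2 * η with hb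
  have ha0 : 0 ≤ a := by positivity
  have hab : a < b := by rw [ha, hb]; linarith
  have hb2 : b < 1 / 2 := by linarith
  -- the pattern function, made measurable away from `x`
  classical
  set g : (Fin m → Torus d) → Torus d := (Metric.closedBall x R₀).piecewise f 0 with hgdef
  have hfc : ContinuousOn f (Metric.closedBall x R₀) :=
    (LipschitzOnWith.of_dist_le_mul (K := Λ.toNNReal) fun Z hZ Z' hZ' => by
      rw [Real.coe_toNNReal _ hΛ.le]; exact hlip Z hZ Z' hZ').continuousOn
  have hg : Measurable g := hfc.measurable_piecewise continuousOn_const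
    Metric.isClosed_closedBall.measurableSet
  have hgf : ∀ Z ∈ Metric.closedBall x R₀, g Z = f Z := fun Z hZ => piecewise_eq_of_mem _ _ _ hZ
  set κ : (Fin m → Torus d) → ℝ := tupleBump a b x with hκdef
  have hκ : IsCutoff κ := isCutoff_tupleBump a b x
  have hκsupp : ∀ Z, κ Z ≠ 0 → Z ∈ Metric.closedBall x R₀ := by
    intro Z hZ
    by_contra h
    rw [Metric.mem_closedBall, not_le] at h
    exact hZ (tupleBump_eq_zero ha0 hab hb2.le (by linarith))
  have hdec' : ∀ M : ℕ, ∃ C, ∀ ξ : Fin d → ℤ,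
      freqWeight ξ ^ M * ‖∫ Z, (κ Z : ℂ) * mFourier (-ξ) (g Z)‖ ≤ C := by
    intro M
    obtain ⟨C, hC⟩ := hdec a b ha0 hab hηR M
    refine ⟨C, fun ξ => ?_⟩
    have : ∀ Z, (κ Z : ℂ) * mFourier (-ξ) (g Z) = (κ Z : ℂ) * mFourier (-ξ) (f Z) := by
      intro Z
      by_cases hZ : κ Z = 0
      · simp [hZ]
      · rw [hgf Z (hκsupp Z hZ)]
    simp only [this]
    exact hC ξ
  have hcoord : ∀ ℓ, 0 ≤ ℓ → ∀ k u Z,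
      ∫ v, hit κ g ℓ u (Function.update Z k v) ≤ (4 / c) ^ d * ℓ ^ d := by
    intro ℓ hℓ k u Z
    refine integral_hit_update_le hκ hg hc (fun k Z u h1 h2 => ?_) hℓ k u Z
    rw [hgf _ (hκsupp _ h1), hgf _ (hκsupp _ h2)]
    exact hexp k Z (hκsupp _ h1) u (hκsupp _ h2)
  -- the two parts of the density
  set χ : Fin m → Torus d → ℝ := fun k u => torusBump a b (u - x k) with hχ
  have hχc : ∀ k, Continuous (χ k) := fun k =>
    (continuous_torusBump a b).comp (continuous_id.sub continuous_const)
  set G : Fin m → Torus d → ℝ := fun k u => χ k u * ρ u with hG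
  have hGc : ∀ k, Continuous (G k) := fun k => (hχc k).mul hρ.continuous
  have hG0 : ∀ k u, 0 ≤ G k u := fun k u => mul_nonneg (torusBump_nonneg _ _ _) (hρ.nonneg u)
  obtain ⟨B, hB⟩ : ∃ B, ∀ u, ρ u ≤ B := by
    obtain ⟨B, hB⟩ := (isCompact_range hρ.continuous).bddAbove
    exact ⟨B, fun u => hB (mem_range_self u)⟩
  have hB0 : 0 ≤ B := (hρ.nonneg 0).trans (hB 0)
  have hGB : ∀ k u, G k u ≤ B := fun k u =>
    (mul_le_of_le_one_left (hρ.nonneg u) (torusBump_le_one _ _ _)).trans (hB u)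
  -- The remainder vanishes within a of each x k, so near x only sampled points occur. Near y the
  -- bumps vanish, so there only the remainder occurs.
  set h : Torus d → ℝ := fun u => ρ u - ∑ k, G k u with hh
  have hhc : Continuous h := hρ.continuous.sub (continuous_finsetSum _ fun k _ => hGc k)
  have hheq : ∀ u, h u = (1 - ∑ k, χ k u) * ρ u := fun u => by
    simp only [hh, hG, sub_mul, one_mul, Finset.sum_mul]
  have hh0 : ∀ u, 0 ≤ h u := fun u => by
    rw [hheq]
    exact mul_nonneg (sub_nonneg.2 (sum_torusBump_le_one hη hη8 hsep u)) (hρ.nonneg u)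
  have hhB : ∀ u, h u ≤ B := fun u => by
    have : 0 ≤ ∑ k, G k u := Finset.sum_nonneg fun k _ => hG0 k u
    have := hB u
    simp only [hh]; linarith
  have hhabs : ∀ u, |h u| ≤ B := fun u => by rw [abs_of_nonneg (hh0 u)]; exact hhB u
  obtain ⟨A, hA⟩ : ∃ A, ∀ ξ, ‖fnCoeff (fun u => (h u : ℂ)) ξ‖ ≤ A * freqWeight ξ ^ (-(d : ℝ)) := by
    choose Ak hAk using fun k => exists_fnCoeff_bump_mul_le hρ ha0 hab hb2 (x k)
    obtain ⟨A₀, -, hA₀⟩ := hρ.exists_weighted_le d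
    refine ⟨A₀ + ∑ k, Ak k, fun ξ => ?_⟩
    have hw := freqWeight_pos ξ
    rw [fnCoeff_sub_sum hρ.continuous hGc, add_mul, Finset.sum_mul]
    refine (norm_sub_le _ _).trans (add_le_add ?_ ((norm_sum_le _ _).trans
      (Finset.sum_le_sum fun k _ => hAk k ξ)))
    rw [Real.rpow_neg hw.le, ← div_eq_mul_inv, le_div_iff₀ (Real.rpow_pos_of_pos hw _), mul_comm]
    exact hA₀ ξ
  -- Mollification moves the last point by less than 2r, and replacing z by sampled points within 2r
  -- moves f(z) by at most 2Λr.
  set L : ℝ := 2 + 2 * Λ with hL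
  have hL0 : 0 < L := by positivity
  set C : ℝ := 2 * B + 2 * (2 * L) ^ d * B + 1 with hC
  obtain ⟨δ₁, hδ₁, hev⟩ := exists_random_measure hm hρ hs hss hs'd
    (by positivity : 0 < C) (m * B + B) hδ
  have hlim1 : Tendsto (fun N : ℕ => 2 * scale s' N) atTop (𝓝 (2 * 0)) :=
    (tendsto_scale hs').const_mul 2
  rw [mul_zero] at hlim1
  obtain ⟨N, hN, hN1, hNmean, hNδ, hNη⟩ := (hev.and ((eventually_ge_atTop 1).and
    ((eventually_mean_close hκ hg hdec' hcoord hhc.measurable hhabs hA hs hss hs'd hcrit hL0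
      hδ₁).and ((hlim1.eventually_lt_const hδ).and
        (hlim1.eventually_lt_const (by positivity : 0 < η / 2)))))).exists
  have hN0 : (0 : ℝ) < N := by exact_mod_cast hN1
  set r := scale s' N with hrdef
  have hr : 0 < r := scale_pos hN1
  have hℓ : 0 ≤ L * r := by positivity
  set W : (Fin m × Fin N → Torus d) → Torus d → ℝ := avoidWeight κ g (L * r) with hW
  have hWm : ∀ X, Measurable (W X) := measurable_avoidWeight_right hκ hg
  have hWh0 : ∀ X u, 0 ≤ W X u * h u := fun X u =>
    mul_nonneg (avoidWeight_nonneg hκ X u) (hh0 u)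
  have hWhB : ∀ X u, W X u * h u ≤ B := fun X u =>
    (mul_le_of_le_one_left (hh0 u) (avoidWeight_le_one hκ X u)).trans (hhB u)
  have hWhabs : ∀ X u, |W X u * h u| ≤ B := fun X u => by
    rw [abs_of_nonneg (hWh0 X u)]; exact hWhB X u
  have hWhm : ∀ X, Measurable fun u => W X u * h u := fun X => (hWm X).mul hhc.measurable
  set dens : (Fin m × Fin N → Torus d) → Measure (Torus d) := fun X =>
    volume.withDensity fun u => ENNReal.ofReal (W X u * h u) with hdens
  have hdensle : ∀ X, dens X univ ≤ ENNReal.ofReal B := fun X =>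
    withDensity_ofReal_univ_le (hWhB X)
  have hdensfin : ∀ X, IsFiniteMeasure (dens X) := fun X =>
    ⟨(hdensle X).trans_lt ENNReal.ofReal_lt_top⟩
  have hcoeff : ∀ X ξ, fourierCoeff (empirical G X + dens X) ξ = fourierCoeff (empirical G X) ξ +
      fnCoeff (fun u => ((W X u * h u : ℝ) : ℂ)) ξ := fun X ξ => by
    rw [fourierCoeff_add, fourierCoeff_withDensity (hWhm X) (hWh0 X)]
  have hm1 := measurable_fourierCoeff_empirical (N := N) hG0 hGc
  have hm2 := fun ξ => measurable_fnCoeff_avoidWeight (N := N) (ℓ := L * r) hκ hg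
    hhc.measurable ξ
  have hdensreal : ∀ X, (dens X).real univ ≤ B := fun X =>
    ENNReal.toReal_le_of_le_ofReal hB0 (hdensle X)
  obtain ⟨X, μ, hμ, hμdec, hclose, hsupp⟩ := hN (fun X => empirical G X + dens X)
    (fun X => inferInstance)
    (fun ξ => by simp only [hcoeff]; exact (hm1 ξ).add (hm2 ξ))
    (fun X => by
      rw [measureReal_add_apply]
      exact add_le_add (measureReal_empirical_le hN1 hG0 hGB X) (hdensreal X))
    -- Influence of one point: 2B/N from the empirical part, and O(1/N) from the weight because N^m
    -- r^d ≤ 1.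
    (fun ξ X i u => by
      simp only [hcoeff]
      have h1 := norm_fourierCoeff_empirical_update_le hG0 hGB ξ X i u
      have h2 := norm_fnCoeff_sub_le (hWhm (Function.update X i u)) (hWhm X)
        (hWhabs (Function.update X i u)) (hWhabs X) ξ
      have h3 : ∫ v, |W (Function.update X i u) v * h v - W X v * h v| ≤
          B * (2 * (N ^ m * (2 * (L * r)) ^ d) / N) := by
        refine le_trans ?_ (mul_le_mul_of_nonneg_left
          (integral_abs_avoidWeight_update_sub_le hκ hg hℓ X i u) hB0)
        rw [← integral_const_mul]
        refine integral_mono_of_nonneg (Eventually.of_forall fun v => abs_nonneg _)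
          ((integrable_of_measurable_of_abs_le (K := 2) ((hWm _).sub (hWm _)).abs
            fun v => ?_).const_mul B) (Eventually.of_forall fun v => ?_)
        · have e1 := avoidWeight_nonneg (g := g) (ℓ := L * r) hκ X v
          have e2 := avoidWeight_nonneg (g := g) (ℓ := L * r) hκ (Function.update X i u) v
          have e3 := avoidWeight_le_one (g := g) (ℓ := L * r) hκ X v
          have e4 := avoidWeight_le_one (g := g) (ℓ := L * r) hκ (Function.update X i u) v
          rw [abs_abs, abs_le, Pi.sub_apply]
          constructor <;> simp only [hW] <;> linarith
        · simp only [← sub_mul, abs_mul]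
          rw [mul_comm]
          exact mul_le_mul_of_nonneg_right (hhabs v) (abs_nonneg _)
      have h4 : (N : ℝ) ^ m * (2 * (L * r)) ^ d ≤ (2 * L) ^ d := by
        have := pow_mul_scale_pow_le_one hN1 hmd
        calc (N : ℝ) ^ m * (2 * (L * r)) ^ d = (2 * L) ^ d * (N ^ m * scale s' N ^ d) := by
              rw [← mul_assoc, mul_pow (2 * L)]; ring
          _ ≤ (2 * L) ^ d * 1 := by gcongr
          _ = _ := mul_one _
      have h5 : B * (2 * (N ^ m * (2 * (L * r)) ^ d) / N) ≤ (2 * (2 * L) ^ d * B) / N := by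
        rw [mul_div_assoc', div_le_div_iff_of_pos_right hN0]
        nlinarith
      have h6 : 2 * B / N + (2 * (2 * L) ^ d * B) / N ≤ C / N := by
        rw [← add_div]; gcongr; linarith
      rw [add_sub_add_comm]
      refine (norm_add_le _ _).trans ?_
      linarith)
    (fun ξ => by
      simp only [hcoeff]
      rw [integral_add, integral_fourierCoeff_empirical hN1 hG0 hGc,
        integral_fnCoeff_avoidWeight hκ hg hhc.measurable hhabs]
      · have h1 := hNmean ξ
        rw [fnCoeff_sub_sum hρ.continuous hGc] at h1
        have h2 : ∀ a b c : ℂ, a + b - c = b - (c - a) := fun a b c => by ring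
        rw [h2]
        exact h1
      · exact Integrable.of_bound (hm1 ξ).aestronglyMeasurable (m * B) (Eventually.of_forall
          fun X => (norm_fourierCoeff_le _ ξ).trans (measureReal_empirical_le hN1 hG0 hGB X))
      · refine Integrable.of_bound (hm2 ξ).aestronglyMeasurable B (Eventually.of_forall fun X => ?_)
        have h1 := fourierCoeff_withDensity (hWhm X) (hWh0 X) ξ
        rw [← h1]
        exact (norm_fourierCoeff_le (dens X) ξ).trans (hdensreal X))
  set S : Set (Torus d) := {u | ∃ i, G i.1 (X i) ≠ 0 ∧ u = X i} ∪ {u | W X u * h u ≠ 0} with hS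
  have hnull : (empirical G X + dens X) Sᶜ = 0 := by
    rw [Measure.add_apply, add_eq_zero]
    constructor
    · exact measure_mono_null (compl_subset_compl.2 subset_union_left) (empirical_compl G X)
    · refine measure_mono_null (compl_subset_compl.2 subset_union_right) ?_
      rw [hdens, withDensity_apply_eq_zero (hWhm X).ennreal_ofReal]
      refine measure_mono_null (t := ∅) ?_ measure_empty
      rintro u ⟨hu1, hu2⟩
      simp only [mem_compl_iff, mem_ofPred_eq, not_not] at hu2
      exact hu1 (by simp [hu2])
  have hsub := hsupp S hnull
  have hnear : ∀ u ∈ μ.support, ∃ v ∈ S, dist u v < 2 * r := fun u hu =>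
    Metric.mem_thickening_iff.1 (Metric.cthickening_subset_thickening' (by positivity)
      (by linarith) S (hsub hu))
  refine ⟨μ, hμ, hμdec, hclose, ?_, ?_⟩
  · refine hsub.trans ((Metric.cthickening_subset_of_subset _ ?_).trans
      (Metric.cthickening_mono (by linarith) _))
    rintro u (⟨i, hi, rfl⟩ | hu)
    · exact right_ne_zero_of_mul hi
    · have := right_ne_zero_of_mul hu
      rw [hheq] at this
      exact right_ne_zero_of_mul this
  · intro z hz y' hy' hzS hyS hyf
    have hχsupp : ∀ k u, χ k u ≠ 0 → dist u (x k) < b := by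
      intro k u hu
      by_contra hlt
      exact hu (torusBump_eq_zero ha0 hab hb2.le (by rw [← dist_eq_norm]; exact not_lt.1 hlt))
    have hzk : ∀ k, dist (z k) (x k) ≤ η := fun k =>
      (dist_le_pi_dist z x k).trans (Metric.mem_closedBall.1 hz)
    -- A nearby point of the unmollified support cannot come from the remainder, which vanishes
    -- there, nor from another group, whose bump is too far away.
    have hpick : ∀ k, ∃ j, dist (z k) (X (k, j)) < 2 * r := by
      intro k
      obtain ⟨v, hv, hzv⟩ := hnear (z k) (hzS k)
      have hvx : dist v (x k) < a := by
        have h1 := dist_triangle_left v (x k) (z k)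
        have h2 := hzk k
        rw [ha]; linarith
      rcases hv with ⟨⟨k', j⟩, hi, rfl⟩ | hv
      · have h1 := hχsupp k' _ (left_ne_zero_of_mul hi)
        by_cases hk : k' = k
        · subst hk; exact ⟨j, hzv⟩
        · have h2 := hsep k' k hk
          have h3 := dist_triangle_left (x k') (x k) (X (k', j))
          linarith
      · exfalso
        have h1 := right_ne_zero_of_mul hv
        rw [hheq] at h1
        refine left_ne_zero_of_mul h1 ?_
        have h2 : χ k v = 1 := torusBump_eq_one ha0 hab hb2.le (by
          rw [← dist_eq_norm]; exact hvx.le)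
        have h3 := sum_torusBump_le_one hη hη8 hsep v
        have h4 : χ k v ≤ ∑ k, χ k v :=
          Finset.single_le_sum (f := fun k => χ k v) (fun k _ => torusBump_nonneg a b _)
            (Finset.mem_univ k)
        have h5 : ∑ k, χ k v = 1 := le_antisymm h3 (h2 ▸ h4)
        rw [h5, sub_self]
    choose J hJ using hpick
    have hzJ : dist z (pick X J) ≤ 2 * r := (dist_pi_le_iff (by positivity)).2 fun k => (hJ k).le
    have hJx : dist (pick X J) x ≤ a := by
      have h1 := dist_triangle_left (pick X J) x z
      have h2 := Metric.mem_closedBall.1 hz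
      rw [ha]; linarith
    have hκJ : κ (pick X J) = 1 := tupleBump_eq_one ha0 hab hb2.le hJx
    have hJball : pick X J ∈ Metric.closedBall x R₀ := Metric.mem_closedBall.2 (by linarith)
    have hzball : z ∈ Metric.closedBall x R₀ :=
      Metric.closedBall_subset_closedBall (by linarith) hz
    obtain ⟨v, hv, hyv⟩ := hnear y' hyS
    rcases hv with ⟨⟨k, j⟩, hi, rfl⟩ | hv
    · have h1 := hχsupp k _ (left_ne_zero_of_mul hi)
      have h2 := hsepy k
      have h3 := Metric.mem_closedBall.1 hy'
      have h4 := dist_triangle_left (x k) y (X (k, j))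
      have h5 := dist_triangle_left (X (k, j)) y y'
      linarith
    -- The point v comes from the weighted remainder but lies within L r of f at a tuple whose
    -- cutoff is 1, so the factor of that tuple makes the weight zero there.
    · refine left_ne_zero_of_mul hv ?_
      have h1 : dist v (g (pick X J)) ≤ L * r := by
        rw [hgf _ hJball]
        have h2 := hlip z hzball _ hJball
        have h3 := dist_triangle_left v (f (pick X J)) y'
        rw [hyf] at h3 hyv
        have h4 := mul_le_mul_of_nonneg_left hzJ hΛ.le
        rw [hL]; linarith
      refine Finset.prod_eq_zero (Finset.mem_univ J) ?_
      rw [hit, if_pos h1, hκJ, sub_self]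

end SalemAvoid

end

open Set Filter Topology MeasureTheory
open scoped ENNReal ContDiff

noncomputable section

namespace SalemAvoid

open UnitAddTorus

/-! ### Smoothing a measure -/

/-- A bump of radius `ε` around the origin with integral one. -/
def unitBump {d : ℕ} (ε : ℝ) (x : Torus d) : ℝ :=
  torusBump (ε / 2) ε x / ∫ u : Torus d, torusBump (ε / 2) ε u

/-- The density of the convolution of a measure with a bump. -/
def smoothing {d : ℕ} (ε : ℝ) (τ : Measure (Torus d)) (x : Torus d) : ℝ :=
  ∫ y, unitBump ε (x - y) ∂τ

section

variable {d : ℕ} {ε : ℝ}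

lemma integral_torusBump_pos (hε : 0 < ε) (hε' : ε < 1 / 2) :
    0 < ∫ u : Torus d, torusBump (ε / 2) ε u :=
  (continuous_torusBump _ _).integral_pos_of_hasCompactSupport_nonneg_nonzero
    (HasCompactSupport.of_compactSpace _) (torusBump_nonneg _ _) (x := 0) (by
      rw [torusBump_eq_one (by positivity) (by linarith) hε'.le (by simp; positivity)]
      exact one_ne_zero)

lemma continuous_unitBump : Continuous (unitBump (d := d) ε) :=
  (continuous_torusBump _ _).div_const _

lemma unitBump_nonneg (x : Torus d) : 0 ≤ unitBump ε x :=
  div_nonneg (torusBump_nonneg _ _ _) (integral_nonneg fun _ => torusBump_nonneg _ _ _)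

lemma unitBump_eq_zero (hε : 0 < ε) (hε' : ε < 1 / 2) {x : Torus d} (hx : ε ≤ ‖x‖) :
    unitBump ε x = 0 := by
  rw [unitBump, torusBump_eq_zero (by positivity) (by linarith) hε'.le hx, zero_div]

lemma unitBump_zero_pos (hε : 0 < ε) (hε' : ε < 1 / 2) : 0 < unitBump ε (0 : Torus d) := by
  rw [unitBump, torusBump_eq_one (by positivity) (by linarith) hε'.le (by simp; positivity)]
  exact div_pos one_pos (integral_torusBump_pos hε hε')

lemma exists_unitBump_le : ∃ K, ∀ x : Torus d, |unitBump ε x| ≤ K := by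
  obtain ⟨K, hK⟩ := (isCompact_range (continuous_unitBump (d := d) (ε := ε))).bddAbove
  exact ⟨K, fun x => by rw [abs_of_nonneg (unitBump_nonneg x)]; exact hK (mem_range_self x)⟩

lemma integral_unitBump (hε : 0 < ε) (hε' : ε < 1 / 2) : ∫ x : Torus d, unitBump ε x = 1 := by
  simp only [unitBump]
  rw [integral_div, div_self (integral_torusBump_pos hε hε').ne']

lemma exists_fnCoeff_unitBump_le (hε : 0 < ε) (hε' : ε < 1 / 2) (M : ℕ) :
    ∃ C, ∀ ξ : Fin d → ℤ, freqWeight ξ ^ M *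
      ‖fnCoeff (fun x : Torus d => (unitBump ε x : ℂ)) ξ‖ ≤ C := by
  obtain ⟨C, hC⟩ := exists_fnCoeff_torusBump_le (d := d) (by positivity : 0 ≤ ε / 2)
    (by linarith : ε / 2 < ε) hε' M
  set I := ∫ u : Torus d, torusBump (ε / 2) ε u with hI
  have hI0 : 0 < I := integral_torusBump_pos hε hε'
  refine ⟨I⁻¹ * C, fun ξ => ?_⟩
  have h1 : fnCoeff (fun x : Torus d => (unitBump ε x : ℂ)) ξ =
      ((I⁻¹ : ℝ) : ℂ) * fnCoeff (fun x : Torus d => (torusBump (ε / 2) ε (x - 0) : ℂ)) ξ := by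
    rw [fnCoeff, fnCoeff, ← integral_const_mul]
    refine integral_congr_ae (Eventually.of_forall fun x => ?_)
    simp only [unitBump, sub_zero, ← hI]
    push_cast
    rw [div_eq_mul_inv]
    ring
  rw [h1, norm_mul, Complex.norm_real, Real.norm_eq_abs, abs_of_pos (inv_pos.2 hI0),
    mul_left_comm]
  exact mul_le_mul_of_nonneg_left (hC 0 ξ) (inv_pos.2 hI0).le

lemma norm_fnCoeff_unitBump_sub_one_le (hε : 0 < ε) (hε' : ε < 1 / 2) (ξ : Fin d → ℤ) :
    ‖fnCoeff (fun x : Torus d => (unitBump ε x : ℂ)) ξ - 1‖ ≤ 2 * Real.pi * d * ‖ξ‖ * ε := by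
  have hc : Continuous fun x : Torus d => (unitBump ε x : ℂ) :=
    Complex.continuous_ofReal.comp continuous_unitBump
  have h1 : (1 : ℂ) = ∫ x : Torus d, (unitBump ε x : ℂ) := by
    rw [integral_complex_ofReal, integral_unitBump hε hε', Complex.ofReal_one]
  have h2 : fnCoeff (fun x : Torus d => (unitBump ε x : ℂ)) ξ - 1 =
      ∫ x : Torus d, (mFourier (-ξ) x - 1) * (unitBump ε x : ℂ) := by
    conv_lhs => rw [h1]
    have h3 : Integrable fun x : Torus d => mFourier (-ξ) x * (unitBump ε x : ℂ) :=
      continuous_integrable ((mFourier (-ξ)).continuous.mul hc)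
    rw [fnCoeff, ← integral_sub h3 (continuous_integrable hc)]
    refine integral_congr_ae (Eventually.of_forall fun x => ?_)
    simp only
    ring
  have hInt : Integrable fun x : Torus d => unitBump ε x :=
    continuous_unitBump.integrable_of_hasCompactSupport (HasCompactSupport.of_compactSpace _)
  rw [h2]
  refine (norm_integral_le_of_norm_le (hInt.const_mul (2 * Real.pi * d * ‖ξ‖ * ε))
    (Eventually.of_forall fun x => ?_)).trans (le_of_eq ?_)
  · rw [norm_mul, Complex.norm_real, Real.norm_eq_abs, abs_of_nonneg (unitBump_nonneg x)]
    by_cases hx : ε ≤ ‖x‖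
    · simp [unitBump_eq_zero hε hε' hx]
    · refine mul_le_mul_of_nonneg_right ?_ (unitBump_nonneg x)
      refine (norm_mFourier_sub_one_le (-ξ) x).trans ?_
      rw [norm_neg]
      have := (not_le.1 hx).le
      gcongr
  · rw [integral_const_mul, integral_unitBump hε hε', mul_one]

variable (τ : Measure (Torus d))

lemma smoothing_support_subset (hε : 0 < ε) (hε' : ε < 1 / 2) {E : Set (Torus d)}
    (hE : τ Eᶜ = 0) : {x | smoothing ε τ x ≠ 0} ⊆ Metric.thickening ε E := by
  intro x hx
  rw [Metric.mem_thickening_iff]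
  by_contra hno
  push Not at hno
  refine hx (integral_eq_zero_of_ae ?_)
  have h1 : ∀ᵐ y ∂τ, y ∈ E := by rw [ae_iff]; exact hE
  filter_upwards [h1] with y hy
  exact unitBump_eq_zero hε hε' (by rw [← dist_eq_norm]; exact hno y hy)

variable [IsProbabilityMeasure τ]

lemma continuous_smoothing : Continuous (smoothing ε τ) := by
  obtain ⟨K, hK⟩ := exists_unitBump_le (d := d) (ε := ε)
  refine continuous_of_dominated (bound := fun _ => K) (fun x => ?_) (fun x => ?_)
    (integrable_const K) (Eventually.of_forall fun y => ?_)
  · exact (continuous_unitBump.comp (continuous_const.sub continuous_id)).aestronglyMeasurable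
  · exact Eventually.of_forall fun y => hK _
  · exact continuous_unitBump.comp (continuous_id.sub continuous_const)

lemma fnCoeff_smoothing (ξ : Fin d → ℤ) : fnCoeff (fun x => (smoothing ε τ x : ℂ)) ξ =
    fnCoeff (fun x : Torus d => (unitBump ε x : ℂ)) ξ * fourierCoeff τ ξ := by
  obtain ⟨K, hK⟩ := exists_unitBump_le (d := d) (ε := ε)
  have hc : Continuous fun p : Torus d × Torus d =>
      mFourier (-ξ) p.1 * ((unitBump ε (p.1 - p.2) : ℝ) : ℂ) :=
    ((mFourier (-ξ)).continuous.comp continuous_fst).mul (Complex.continuous_ofReal.comp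
      (continuous_unitBump.comp (continuous_fst.sub continuous_snd)))
  have hInt : Integrable (fun p : Torus d × Torus d =>
      mFourier (-ξ) p.1 * ((unitBump ε (p.1 - p.2) : ℝ) : ℂ)) (volume.prod τ) :=
    Integrable.of_bound hc.aestronglyMeasurable K (Eventually.of_forall fun p => by
      rw [norm_mul, norm_mFourier, one_mul, Complex.norm_real]; exact hK _)
  have h3 : fnCoeff (fun x => (smoothing ε τ x : ℂ)) ξ =
      ∫ x, ∫ y, mFourier (-ξ) x * ((unitBump ε (x - y) : ℝ) : ℂ) ∂τ := by
    rw [fnCoeff]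
    refine integral_congr_ae (Eventually.of_forall fun x => ?_)
    simp only
    rw [integral_const_mul, integral_complex_ofReal]
    rfl
  rw [h3, integral_integral_swap hInt, fourierCoeff, ← integral_const_mul]
  refine integral_congr_ae (Eventually.of_forall fun y => ?_)
  simp only
  rw [← integral_add_right_eq_self
    (fun x => mFourier (-ξ) x * ((unitBump ε (x - y) : ℝ) : ℂ)) y, fnCoeff, ← integral_mul_const]
  refine integral_congr_ae (Eventually.of_forall fun x => ?_)
  simp only [mFourier_add_apply, add_sub_cancel_right]
  ring

lemma isSmoothDensity_smoothing (hε : 0 < ε) (hε' : ε < 1 / 2) :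
    IsSmoothDensity (smoothing ε τ) where
  continuous := continuous_smoothing τ
  nonneg x := integral_nonneg fun y => unitBump_nonneg _
  integral_eq_one := by
    have h := fnCoeff_smoothing (ε := ε) τ 0
    simp only [fnCoeff, fourierCoeff, neg_zero, mFourier_zero, ContinuousMap.one_apply, one_mul]
      at h
    rw [integral_complex_ofReal, integral_complex_ofReal, integral_unitBump hε hε'] at h
    simpa using h
  decay M := by
    obtain ⟨C, hC⟩ := exists_fnCoeff_unitBump_le (d := d) hε hε' M
    refine ⟨C, fun ξ => le_trans ?_ (hC ξ)⟩
    rw [fnCoeff_smoothing, norm_mul]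
    have hw := freqWeight_pos ξ
    refine mul_le_mul_of_nonneg_left ?_ (by positivity)
    exact mul_le_of_le_one_right (norm_nonneg _) (norm_fourierCoeff_le_one τ ξ)

lemma smoothing_pos (hε : 0 < ε) (hε' : ε < 1 / 2) {u : Torus d} (hu : 0 < τ {u}) :
    0 < smoothing ε τ u := by
  obtain ⟨K, hK⟩ := exists_unitBump_le (d := d) (ε := ε)
  have hc : Continuous fun y => unitBump ε (u - y) :=
    continuous_unitBump.comp (continuous_const.sub continuous_id)
  refine (integral_pos_iff_support_of_nonneg (fun y => unitBump_nonneg _)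
    (integrable_of_measurable_of_abs_le hc.measurable fun y => hK _)).2 (hu.trans_le ?_)
  refine measure_mono (singleton_subset_iff.2 ?_)
  simp only [Function.mem_support, sub_self]
  exact (unitBump_zero_pos hε hε').ne'

end

/-! ### Closeness of coefficients and supports -/

lemma mFourierCoeff_eq_fnCoeff {d : ℕ} (b : Torus d → ℂ) : mFourierCoeff b = fnCoeff b := by
  have hvol : (Measure.pi fun _ : Fin d => (AddCircle.haarAddCircle : Measure UnitAddCircle)) =
      (volume : Measure (Torus d)) := by rw [haarAddCircle_eq_volume]; rfl
  ext ξ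
  rw [fnCoeff, ← hvol]
  rfl

lemma hasSum_integral_of_summable_fnCoeff {d : ℕ} {b : Torus d → ℂ} (hb : Continuous b)
    (hs : Summable fun ξ => ‖fnCoeff b ξ‖) (μ : Measure (Torus d)) [IsProbabilityMeasure μ] :
    HasSum (fun ξ => fnCoeff b ξ * fourierCoeff μ (-ξ)) (∫ x, b x ∂μ) := by
  have hs' : Summable (mFourierCoeff (ContinuousMap.mk b hb)) := by
    rw [ContinuousMap.coe_mk, mFourierCoeff_eq_fnCoeff]; exact hs.of_norm
  have h := hasSum_integral_of_summable_integral_norm (μ := μ)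
    (F := fun (ξ : Fin d → ℤ) x => fnCoeff b ξ * mFourier ξ x)
    (fun ξ => (integrable_mFourier μ ξ).const_mul _) (by simpa using hs)
  have h1 : ∀ x, ∑' ξ, fnCoeff b ξ * mFourier ξ x = b x := fun x => by
    have := (hasSum_mFourier_series_apply_of_summable hs' x).tsum_eq
    rwa [ContinuousMap.coe_mk, mFourierCoeff_eq_fnCoeff] at this
  simp only [h1] at h
  simpa only [integral_const_mul, fourierCoeff, neg_neg] using h

lemma norm_integral_sub_integral_le {d : ℕ} {b : Torus d → ℂ} (hb : Continuous b)
    (hs : Summable fun ξ => ‖fnCoeff b ξ‖) (μ ν : Measure (Torus d)) [IsProbabilityMeasure μ]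
    [IsProbabilityMeasure ν] {δ : ℝ} (h : ∀ ξ, ‖fourierCoeff μ ξ - fourierCoeff ν ξ‖ ≤ δ) :
    ‖∫ x, b x ∂μ - ∫ x, b x ∂ν‖ ≤ (∑' ξ, ‖fnCoeff b ξ‖) * δ := by
  have h1 := (hasSum_integral_of_summable_fnCoeff hb hs μ).sub
    (hasSum_integral_of_summable_fnCoeff hb hs ν)
  rw [← h1.tsum_eq]
  refine tsum_of_norm_bounded (hs.hasSum.mul_right δ) fun ξ => ?_
  rw [← mul_sub, norm_mul]
  exact mul_le_mul_of_nonneg_left (h _) (norm_nonneg _)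

/-- A measure whose coefficients are close to those of a density charges the balls around the
points where the density is positive. -/
lemma exists_mem_support_dist_le {d : ℕ} {ρ : Torus d → ℝ} (hρ : IsSmoothDensity ρ) {u : Torus d}
    (hu : 0 < ρ u) {ε : ℝ} (hε : 0 < ε) (hε' : ε < 1 / 2) :
    ∃ δ > 0, ∀ μ : Measure (Torus d), IsProbabilityMeasure μ →
      (∀ ξ, ‖fourierCoeff μ ξ - fnCoeff (fun x => (ρ x : ℂ)) ξ‖ ≤ δ) →
      ∃ v ∈ μ.support, dist v u ≤ ε := by
  set ν : Measure (Torus d) := volume.withDensity fun x => ENNReal.ofReal (ρ x) with hν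
  have hInt : Integrable ρ :=
    hρ.continuous.integrable_of_hasCompactSupport (HasCompactSupport.of_compactSpace _)
  have hνp : IsProbabilityMeasure ν := ⟨by
    rw [hν, withDensity_apply _ MeasurableSet.univ, Measure.restrict_univ,
      ← ofReal_integral_eq_lintegral_ofReal hInt (Eventually.of_forall hρ.nonneg),
      hρ.integral_eq_one, ENNReal.ofReal_one]⟩
  have hνc : ∀ ξ, fourierCoeff ν ξ = fnCoeff (fun x => (ρ x : ℂ)) ξ :=
    fourierCoeff_withDensity hρ.continuous.measurable hρ.nonneg
  set b : Torus d → ℝ := fun x => torusBump (ε / 2) ε (x - u) with hb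
  have hbc : Continuous b := (continuous_torusBump _ _).comp (continuous_id.sub continuous_const)
  have hbc' : Continuous fun x => (b x : ℂ) := Complex.continuous_ofReal.comp hbc
  obtain ⟨C, hC⟩ := exists_fnCoeff_torusBump_le (d := d) (by positivity : 0 ≤ ε / 2)
    (by linarith : ε / 2 < ε) hε' (d + 1)
  have hs : Summable fun ξ => ‖fnCoeff (fun x => (b x : ℂ)) ξ‖ := by
    refine Summable.of_nonneg_of_le (fun _ => norm_nonneg _) (fun ξ => ?_)
      ((summable_freqWeight_rpow (d := d) (s := -(d + 1 : ℝ)) (by linarith)).mul_left C)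
    have hw := freqWeight_pos ξ
    have h1 : freqWeight ξ ^ (-(d + 1 : ℝ)) = (freqWeight ξ ^ (d + 1))⁻¹ := by
      rw [Real.rpow_neg hw.le, ← Real.rpow_natCast]; push_cast; rfl
    rw [h1, ← div_eq_mul_inv, le_div_iff₀ (by positivity), mul_comm]
    exact hC u ξ
  have hpos : 0 < ∫ x, b x ∂ν := by
    have h1 : ∫ x, b x ∂ν = ∫ x, ρ x * b x := by
      rw [hν, integral_withDensity_eq_integral_toReal_smul
        hρ.continuous.measurable.ennreal_ofReal (by simp)]
      refine integral_congr_ae (Eventually.of_forall fun x => ?_)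
      simp only [ENNReal.toReal_ofReal (hρ.nonneg x), smul_eq_mul]
    rw [h1]
    refine (hρ.continuous.mul hbc).integral_pos_of_hasCompactSupport_nonneg_nonzero
      (HasCompactSupport.of_compactSpace _)
      (fun x => mul_nonneg (hρ.nonneg x) (torusBump_nonneg _ _ _)) (x := u) ?_
    have h2 : b u = 1 := torusBump_eq_one (by positivity) (by linarith) hε'.le (by
      simp; positivity)
    simp only [h2, mul_one]
    exact hu.ne'
  set T := ∑' ξ, ‖fnCoeff (fun x => (b x : ℂ)) ξ‖ with hT
  have hT0 : 0 ≤ T := tsum_nonneg fun _ => norm_nonneg _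
  -- The bump around u has absolutely summable coefficients with sum T, so closeness δ moves its
  -- integral by at most Tδ. This choice keeps the integral against μ positive.
  refine ⟨(∫ x, b x ∂ν) / (2 * (T + 1)), by positivity, fun μ hμ hclose => ?_⟩
  have h1 := norm_integral_sub_integral_le hbc' hs μ ν fun ξ => by rw [hνc]; exact hclose ξ
  rw [integral_complex_ofReal, integral_complex_ofReal, ← Complex.ofReal_sub, Complex.norm_real,
    Real.norm_eq_abs] at h1
  have h2 : T * ((∫ x, b x ∂ν) / (2 * (T + 1))) < ∫ x, b x ∂ν := by
    rw [mul_div_assoc', div_lt_iff₀ (by positivity)]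
    nlinarith
  have h3 : 0 < ∫ x, b x ∂μ := by
    have := (abs_le.1 (h1.trans h2.le)).1
    have := (abs_lt.1 (h1.trans_lt h2)).1
    linarith
  by_contra hno
  push Not at hno
  refine h3.ne' (integral_eq_zero_of_ae ?_)
  have h4 : ∀ᵐ x ∂μ, x ∈ μ.support := Measure.support_mem_ae
  filter_upwards [h4] with x hx
  exact torusBump_eq_zero (by positivity) (by linarith) hε'.le (by
    rw [← dist_eq_norm]; exact (hno x hx).le)

end SalemAvoid

end

open Set Filter Topology MeasureTheory
open scoped ENNReal ContDiff

noncomputable section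

namespace SalemAvoid

open UnitAddTorus TopologicalSpace

/-! ### Density in the space of pairs -/

/-- Sets with property `P` carry measures approximating every smooth density. -/
def ApproximatesDensities (d : ℕ) (β : ℝ) (P : Set (Torus d) → Prop) : Prop :=
  ∀ ρ : Torus d → ℝ, IsSmoothDensity ρ → ∀ s, 0 ≤ s → s < β → ∀ δ > 0,
    ∃ μ : Measure (Torus d), IsProbabilityMeasure μ ∧ (∀ t, 0 ≤ t → HasFourierDecay t μ) ∧
      (∀ ξ, freqWeight ξ ^ (s / 2) *
        ‖fourierCoeff μ ξ - fnCoeff (fun x => (ρ x : ℂ)) ξ‖ ≤ δ) ∧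
      μ.support ⊆ Metric.cthickening δ {x | ρ x ≠ 0} ∧ P μ.support

lemma HasFourierDecay.exists_freqWeight_le {d : ℕ} {μ : Measure (Torus d)}
    [IsProbabilityMeasure μ] {s : ℝ} (hs : 0 ≤ s) (h : HasFourierDecay s μ) :
    ∃ C, 0 < C ∧ ∀ ξ, freqWeight ξ ^ (s / 2) * ‖fourierCoeff μ ξ‖ ≤ C := by
  obtain ⟨C, hC⟩ := h
  refine ⟨max ((2 : ℝ) ^ (s / 2) * C) 1, by positivity, fun ξ => ?_⟩
  by_cases hξ : ξ = 0
  · refine le_trans ?_ (le_max_right _ _)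
    subst hξ
    have h1 : freqWeight (0 : Fin d → ℤ) = 1 := by simp [freqWeight]
    rw [h1, Real.one_rpow, one_mul]
    exact norm_fourierCoeff_le_one μ 0
  · refine le_trans ?_ (le_max_left _ _)
    have h1 : ‖weightedCoeff s μ ξ‖ ≤ C := hC (mem_range_self ξ)
    rw [norm_weightedCoeff] at h1
    calc freqWeight ξ ^ (s / 2) * ‖fourierCoeff μ ξ‖
        ≤ (2 ^ (s / 2) * freqNorm ξ ^ (s / 2)) * ‖fourierCoeff μ ξ‖ := by
          gcongr; exact freqWeight_rpow_le (by linarith) hξ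
      _ = 2 ^ (s / 2) * (freqNorm ξ ^ (s / 2) * ‖fourierCoeff μ ξ‖) := by ring
      _ ≤ _ := by gcongr

/-- Interpolates the trivial bound 2 with a linear one, so that smoothing loses only a small power θ
of the frequency. -/
lemma min_two_le_rpow {t θ : ℝ} (ht : 0 ≤ t) (hθ0 : 0 ≤ θ) (hθ1 : θ ≤ 1) :
    min 2 t ≤ 2 * t ^ θ := by
  rcases le_total t 1 with h | h
  · refine (min_le_right _ _).trans ?_
    have h1 : t ≤ t ^ θ := by
      rcases ht.eq_or_lt with h0 | h0
      · rw [← h0]; exact Real.rpow_nonneg le_rfl _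
      · calc t = t ^ (1 : ℝ) := (Real.rpow_one t).symm
          _ ≤ t ^ θ := Real.rpow_le_rpow_of_exponent_ge h0 h hθ1
    linarith [Real.rpow_nonneg ht θ]
  · refine (min_le_left _ _).trans ?_
    have := Real.one_le_rpow h hθ0
    linarith

/-- Smoothing at a small scale changes a measure with Fourier decay only slightly. -/
lemma exists_smoothing_scale {d : ℕ} {μ : Measure (Torus d)} [IsProbabilityMeasure μ] {s s' : ℝ}
    (hs : 0 ≤ s) (hss : s < s') (h : HasFourierDecay s' μ) {δ : ℝ} (hδ : 0 < δ) :
    ∃ ε, 0 < ε ∧ ε < 1 / 2 ∧ ε ≤ δ ∧ ∀ ξ, freqWeight ξ ^ (s / 2) *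
      (‖fnCoeff (fun x : Torus d => (unitBump ε x : ℂ)) ξ - 1‖ * ‖fourierCoeff μ ξ‖) ≤ δ := by
  obtain ⟨C, hC, hCμ⟩ := h.exists_freqWeight_le (hs.trans hss.le)
  -- The loss θ must fit into the spare decay between s/2 and s'/2.
  set θ : ℝ := min 1 ((s' - s) / 2) with hθ
  have hθ0 : 0 < θ := lt_min one_pos (by linarith)
  have hθ1 : θ ≤ 1 := min_le_left _ _
  have hθs : s / 2 + θ ≤ s' / 2 := by
    have := min_le_right 1 ((s' - s) / 2)
    linarith
  set A : ℝ := 2 * Real.pi * d with hA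
  have hA0 : 0 ≤ A := by positivity
  have hlim : Tendsto (fun ε : ℝ => 2 * (A * ε) ^ θ * C) (𝓝 0) (𝓝 (2 * (A * 0) ^ θ * C)) :=
    (((tendsto_id.const_mul A).rpow_const (Or.inr hθ0.le)).const_mul 2).mul_const C
  rw [mul_zero, Real.zero_rpow hθ0.ne', mul_zero, zero_mul] at hlim
  have hev : ∀ᶠ ε : ℝ in 𝓝[>] 0, 2 * (A * ε) ^ θ * C ≤ δ :=
    (hlim.eventually_le_const hδ).filter_mono nhdsWithin_le_nhds
  obtain ⟨ε, ⟨hε1, hε0⟩, hε2⟩ := ((hev.and self_mem_nhdsWithin).and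
    (Ioo_mem_nhdsGT (lt_min (by norm_num : (0 : ℝ) < 1 / 2) hδ))).exists
  have hε0 : 0 < ε := hε0
  have hε' : ε < 1 / 2 := hε2.2.trans_le (min_le_left _ _)
  refine ⟨ε, hε0, hε', (hε2.2.trans_le (min_le_right _ _)).le, fun ξ => le_trans ?_ hε1⟩
  have hw := freqWeight_pos ξ
  have hw1 := one_le_freqWeight ξ
  have h1 : ‖fnCoeff (fun x : Torus d => (unitBump ε x : ℂ)) ξ - 1‖ ≤
      2 * (A * freqWeight ξ * ε) ^ θ := by
    refine le_trans (le_min ?_ ?_) (min_two_le_rpow (by positivity) hθ0.le hθ1)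
    · refine (norm_sub_le _ _).trans ?_
      rw [norm_one]
      have h2 : ‖fnCoeff (fun x : Torus d => (unitBump ε x : ℂ)) ξ‖ ≤ 1 := by
        refine (norm_integral_le_integral_norm _).trans (le_of_eq ?_)
        refine Eq.trans ?_ (integral_unitBump (d := d) hε0 hε')
        refine integral_congr_ae (Eventually.of_forall fun x => ?_)
        simp only [norm_mul, norm_mFourier, one_mul, Complex.norm_real, Real.norm_eq_abs,
          abs_of_nonneg (unitBump_nonneg x)]
      linarith
    · refine (norm_fnCoeff_unitBump_sub_one_le hε0 hε' ξ).trans ?_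
      rw [← hA]
      have := norm_le_freqWeight ξ
      gcongr
  have h3 : (A * freqWeight ξ * ε) ^ θ = (A * ε) ^ θ * freqWeight ξ ^ θ := by
    rw [← Real.mul_rpow (by positivity) hw.le]; congr 1; ring
  have h4 : freqWeight ξ ^ (s / 2) * freqWeight ξ ^ θ ≤ freqWeight ξ ^ (s' / 2) := by
    rw [← Real.rpow_add hw]; exact Real.rpow_le_rpow_of_exponent_le hw1 hθs
  rw [h3] at h1
  calc freqWeight ξ ^ (s / 2) *
        (‖fnCoeff (fun x : Torus d => (unitBump ε x : ℂ)) ξ - 1‖ * ‖fourierCoeff μ ξ‖)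
      ≤ freqWeight ξ ^ (s / 2) * ((2 * ((A * ε) ^ θ * freqWeight ξ ^ θ)) *
          ‖fourierCoeff μ ξ‖) := by gcongr
    _ = 2 * (A * ε) ^ θ * ((freqWeight ξ ^ (s / 2) * freqWeight ξ ^ θ) *
          ‖fourierCoeff μ ξ‖) := by ring
    _ ≤ 2 * (A * ε) ^ θ * (freqWeight ξ ^ (s' / 2) * ‖fourierCoeff μ ξ‖) := by gcongr
    _ ≤ 2 * (A * ε) ^ θ * C := by gcongr; exact hCμ ξ

/-- The uniform probability measure on a finite set. -/
lemma exists_uniform_measure {d : ℕ} {F : Finset (Torus d)} (hF : F.Nonempty) :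
    ∃ τ : Measure (Torus d), IsProbabilityMeasure τ ∧ (∀ u ∈ F, 0 < τ {u}) ∧
      τ (F : Set (Torus d))ᶜ = 0 := by
  have hcard : (F.card : ℝ≥0∞) ≠ 0 := by exact_mod_cast hF.card_pos.ne'
  refine ⟨(F.card : ℝ≥0∞)⁻¹ • ∑ u ∈ F, Measure.dirac u, ⟨?_⟩, fun u hu => ?_, ?_⟩
  · simp [ENNReal.inv_mul_cancel hcard]
  · simp only [Measure.smul_apply, Measure.coe_finsetSum, Finset.sum_apply, smul_eq_mul]
    refine ENNReal.mul_pos (by simp) ?_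
    rw [← pos_iff_ne_zero]
    refine lt_of_lt_of_le ?_ (Finset.single_le_sum (f := fun v => Measure.dirac v {u})
      (fun _ _ => bot_le) hu)
    simp
  · simp only [Measure.smul_apply, Measure.coe_finsetSum, Finset.sum_apply, smul_eq_mul]
    rw [Finset.sum_eq_zero, mul_zero]
    intro u hu
    rw [Measure.dirac_apply, indicator_of_notMem]
    exact fun h => h hu

end SalemAvoid

end

open Set Filter Topology MeasureTheory
open scoped ENNReal ContDiff

noncomputable section

namespace SalemAvoid

open UnitAddTorus TopologicalSpace

/-- Mixing in a little of a second measure before smoothing. -/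
lemma norm_smoothing_mix_sub_le {d : ℕ} {μ τ : Measure (Torus d)} [IsProbabilityMeasure μ]
    [IsProbabilityMeasure τ] {l : ℝ} (hl : 0 ≤ l) (hl1 : l ≤ 1) (b : ℂ) (ξ : Fin d → ℤ) :
    ‖b * fourierCoeff (ENNReal.ofReal (1 - l) • μ + ENNReal.ofReal l • τ) ξ - fourierCoeff μ ξ‖ ≤
      ‖b - 1‖ * ‖fourierCoeff μ ξ‖ + 2 * l * ‖b‖ := by
  have h1 := Measure.smul_finite μ (ENNReal.ofReal_ne_top (r := 1 - l))
  have h2 := Measure.smul_finite τ (ENNReal.ofReal_ne_top (r := l))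
  rw [fourierCoeff_add, fourierCoeff_smul, fourierCoeff_smul, ENNReal.toReal_ofReal hl,
    ENNReal.toReal_ofReal (by linarith)]
  have h : b * (((1 - l : ℝ) : ℂ) * fourierCoeff μ ξ + (l : ℂ) * fourierCoeff τ ξ) -
      fourierCoeff μ ξ = (b - 1) * fourierCoeff μ ξ +
        (l : ℂ) * (b * (fourierCoeff τ ξ - fourierCoeff μ ξ)) := by push_cast; ring
  rw [h]
  refine (norm_add_le _ _).trans ?_
  rw [norm_mul, norm_mul, norm_mul, Complex.norm_real, Real.norm_eq_abs, abs_of_nonneg hl]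
  have h2 : ‖fourierCoeff τ ξ - fourierCoeff μ ξ‖ ≤ 2 := by
    refine (norm_sub_le _ _).trans ?_
    linarith [norm_fourierCoeff_le_one τ ξ, norm_fourierCoeff_le_one μ ξ]
  have h3 : l * (‖b‖ * ‖fourierCoeff τ ξ - fourierCoeff μ ξ‖) ≤ l * (‖b‖ * 2) := by gcongr
  linarith

/-- The measure may not charge all of E, so a small multiple of the uniform measure on a net of E is
mixed in before smoothing. The smoothed density is then positive at every net point, and any measure
close to it must have support near each of them. Its support stays near E because the approximation
also localises it. -/
theorem ApproximatesDensities.exists_close {d : ℕ} {β : ℝ} {P : Set (Torus d) → Prop}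
    (hP : ApproximatesDensities d β P) (p : PairSpace d β) {s δ : ℝ} (hs : s ∈ Ico (0 : ℝ) β)
    (hδ : 0 < δ) : ∃ q : PairSpace d β, P (q.1.1 : Set (Torus d)) ∧ dist q.1.1 p.1.1 ≤ δ ∧
      ∀ ξ, freqWeight ξ ^ (s / 2) *
        ‖fourierCoeff q.1.2.toMeasure ξ - fourierCoeff p.1.2.toMeasure ξ‖ ≤ δ := by
  obtain ⟨⟨E, μ⟩, hμp, hμE⟩ := p
  dsimp only at hμp hμE ⊢
  obtain ⟨s', hss, hs'β⟩ := exists_between hs.2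
  obtain ⟨ε, hε, hε', hεδ, hεμ⟩ := exists_smoothing_scale hs.1 hss
    (μ.decay s' ⟨hs.1.trans hss.le, hs'β⟩) (by positivity : 0 < δ / 4)
  obtain ⟨F, hFE, hFfin, hEF⟩ := E.isCompact.finite_cover_balls hε
  lift F to Finset (Torus d) using hFfin
  have hFne : F.Nonempty := by
    obtain ⟨e, he⟩ := E.nonempty
    obtain ⟨u, hu, -⟩ := mem_iUnion₂.1 (hEF he)
    exact ⟨u, hu⟩
  obtain ⟨τ, hτ, hτF, hτc⟩ := exists_uniform_measure hFne
  obtain ⟨A, hA⟩ := exists_fnCoeff_unitBump_le (d := d) hε hε' ⌈s / 2⌉₊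
  have hA0 : 0 ≤ A :=
    le_trans (mul_nonneg (pow_nonneg (freqWeight_pos 0).le _) (norm_nonneg _)) (hA 0)
  -- The net measure has no Fourier decay, but after smoothing at the fixed scale ε its weighted
  -- coefficients are at most A. The scale is chosen first, then l so small that 2lA ≤ δ/4.
  set l : ℝ := min (1 / 2) (δ / (8 * (A + 1))) with hl
  have hl0 : 0 < l := by positivity
  have hl1 : l ≤ 1 := (min_le_left _ _).trans (by norm_num)
  have hlA : 2 * l * A ≤ δ / 4 := by
    have h1 : l ≤ δ / (8 * (A + 1)) := min_le_right _ _
    rw [le_div_iff₀ (by positivity)] at h1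
    nlinarith
  set ν : Measure (Torus d) := ENNReal.ofReal (1 - l) • μ.toMeasure + ENNReal.ofReal l • τ with hν
  have hνp : IsProbabilityMeasure ν := ⟨by
    simp only [hν, Measure.add_apply, Measure.smul_apply, measure_univ, smul_eq_mul, mul_one]
    rw [← ENNReal.ofReal_add (by linarith) hl0.le]; simp⟩
  have hνE : ν (E : Set (Torus d))ᶜ = 0 := by
    have h1 : μ.toMeasure (E : Set (Torus d))ᶜ = 0 :=
      measure_mono_null (compl_subset_compl.2 hμE) Measure.measure_compl_support
    have h2 : τ (E : Set (Torus d))ᶜ = 0 := measure_mono_null (compl_subset_compl.2 hFE) hτc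
    simp [hν, h1, h2]
  have hρ := isSmoothDensity_smoothing ν hε hε'
  have hρF : ∀ u ∈ F, 0 < smoothing ε ν u := fun u hu => by
    refine smoothing_pos ν hε hε' ?_
    simp only [hν, Measure.add_apply, Measure.smul_apply, smul_eq_mul]
    exact lt_of_lt_of_le (ENNReal.mul_pos (by simpa using hl0) (hτF u hu).ne') le_add_self
  choose! g hg0 hg using fun u (hu : u ∈ F) => exists_mem_support_dist_le hρ (hρF u hu) hε hε'
  obtain ⟨u₀, hu₀, hmin⟩ := F.exists_min_image g hFne
  -- The smallest tolerance over the finite net forces the support to come near all net points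
  -- simultaneously.
  obtain ⟨μ', hμ', hdec, hclose, hsupp, hPμ'⟩ := hP _ hρ s hs.1 hs.2 (min (δ / 2) (g u₀))
    (lt_min (by positivity) (hg0 u₀ hu₀))
  have hne : μ'.support.Nonempty := Measure.nonempty_support (IsProbabilityMeasure.ne_zero μ')
  refine ⟨⟨⟨⟨⟨μ'.support, Measure.isClosed_support.isCompact⟩, hne⟩,
    ⟨μ', inferInstance, fun t ht => hdec t ht.1⟩⟩, hμ', subset_rfl⟩, hPμ', ?_, fun ξ => ?_⟩
  · rw [Metric.NonemptyCompacts.dist_eq]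
    refine Metric.hausdorffDist_le_of_mem_dist hδ.le (fun v hv => ?_) fun e he => ?_
    · have h1 : v ∈ Metric.cthickening (δ / 2 + ε) (E : Set (Torus d)) :=
        Metric.cthickening_thickening_subset (by positivity) ε _
          (Metric.cthickening_mono (min_le_left _ _) _
            (Metric.cthickening_subset_of_subset _ (smoothing_support_subset ν hε hε' hνE)
              (hsupp hv)))
      rw [E.isCompact.cthickening_eq_biUnion_closedBall (by positivity)] at h1
      obtain ⟨e, he, hve⟩ := mem_iUnion₂.1 h1
      exact ⟨e, he, (Metric.mem_closedBall.1 hve).trans (by linarith)⟩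
    · obtain ⟨u, hu, heu⟩ := mem_iUnion₂.1 (hEF he)
      obtain ⟨v, hv, hvu⟩ := hg u hu μ' hμ' fun ξ => by
        refine le_trans ?_ (((hclose ξ).trans (min_le_right _ _)).trans (hmin u hu))
        exact le_mul_of_one_le_left (norm_nonneg _)
          (Real.one_le_rpow (one_le_freqWeight ξ) (by linarith [hs.1]))
      refine ⟨v, hv, ?_⟩
      have := dist_triangle_right e v u
      rw [Metric.mem_ball] at heu
      linarith
  · change freqWeight ξ ^ (s / 2) * ‖fourierCoeff μ' ξ - fourierCoeff μ.toMeasure ξ‖ ≤ δ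
    have hw : 0 ≤ freqWeight ξ ^ (s / 2) := Real.rpow_nonneg (freqWeight_pos ξ).le _
    have h1 := (hclose ξ).trans (min_le_left _ _)
    have h2 := norm_smoothing_mix_sub_le (μ := μ.toMeasure) (τ := τ) hl0.le hl1
      (fnCoeff (fun x : Torus d => (unitBump ε x : ℂ)) ξ) ξ
    rw [← hν, ← fnCoeff_smoothing ν ξ] at h2
    have h3 : freqWeight ξ ^ (s / 2) * ‖fnCoeff (fun x : Torus d => (unitBump ε x : ℂ)) ξ‖ ≤ A := by
      refine le_trans (mul_le_mul_of_nonneg_right ?_ (norm_nonneg _)) (hA ξ)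
      rw [← Real.rpow_natCast]
      exact Real.rpow_le_rpow_of_exponent_le (one_le_freqWeight ξ) (Nat.le_ceil _)
    have h4 := norm_sub_le_norm_sub_add_norm_sub (fourierCoeff μ' ξ)
      (fnCoeff (fun x => (smoothing ε ν x : ℂ)) ξ) (fourierCoeff μ.toMeasure ξ)
    have h5 := mul_le_mul_of_nonneg_left (h4.trans (add_le_add_right h2 _)) hw
    have h6 := mul_le_mul_of_nonneg_left h3 (by positivity : 0 ≤ 2 * l)
    have h7 := hεμ ξ
    linarith

theorem ApproximatesDensities.dense {d : ℕ} {β : ℝ} (hβ : 0 < β) {P : Set (Torus d) → Prop}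
    (hP : ApproximatesDensities d β P) : Dense {p : PairSpace d β | P (p.1.1 : Set (Torus d))} := by
  intro p
  have hδ : ∀ j : ℕ, (0 : ℝ) < 1 / ((j : ℝ) + 1) := fun j => by positivity
  choose q hqP hqd hqξ using fun j : ℕ => hP.exists_close p (expSeq_mem hβ j) (hδ j)
  refine mem_closure_of_tendsto (f := q) (b := atTop) ?_ (Eventually.of_forall hqP)
  have hlim := tendsto_one_div_add_atTop_nhds_zero_nat (𝕜 := ℝ)
  refine tendsto_pairSpace_iff.2 ⟨?_, fun s hs ε hε => ?_⟩
  · rw [tendsto_iff_dist_tendsto_zero]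
    exact squeeze_zero (fun _ => dist_nonneg) hqd hlim
  · have hlim' := hlim.const_mul ((d : ℝ) ^ (s / 2))
    rw [mul_zero] at hlim'
    filter_upwards [exists_le_expSeq hs.2, hlim'.eventually_lt_const hε] with j hj hj' ξ
    rw [weightedCoeff_sub, norm_sub_rev]
    refine lt_of_le_of_lt ?_ hj'
    calc _ ≤ ((d : ℝ) ^ (s / 2) * freqWeight ξ ^ (s / 2)) * _ := by
          gcongr; exact freqNorm_rpow_le (by linarith [hs.1]) ξ
      _ ≤ ((d : ℝ) ^ (s / 2) * freqWeight ξ ^ (expSeq β j / 2)) * _ := by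
          gcongr; exact one_le_freqWeight ξ
      _ = (d : ℝ) ^ (s / 2) * (freqWeight ξ ^ (expSeq β j / 2) * _) := by rw [mul_assoc]
      _ ≤ _ := by gcongr; exact hqξ j ξ

end SalemAvoid

end

open Set Filter Topology MeasureTheory
open scoped ENNReal ContDiff

noncomputable section

namespace SalemAvoid

open UnitAddTorus TopologicalSpace

/-! ### Generic pairs -/

lemma continuous_pairSpace_fst {d : ℕ} {β : ℝ} : Continuous fun p : PairSpace d β => p.1.1 :=
  continuous_fst.comp continuous_subtype_val

lemma criticalDim_pos {d n : ℕ} (hd : 1 ≤ d) (hn : 2 ≤ n) : 0 < criticalDim d n := by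
  have hd0 : (1 : ℝ) ≤ d := by exact_mod_cast hd
  have hn2 : (2 : ℝ) ≤ n := by exact_mod_cast hn
  rw [criticalDim]
  split_ifs
  · linarith
  · exact div_pos (by linarith) (by linarith)

lemma criticalDim_le {d n : ℕ} (hn : 2 ≤ n) : criticalDim d n ≤ d := by
  have hn2 : (2 : ℝ) ≤ n := by exact_mod_cast hn
  rw [criticalDim]
  split_ifs
  · exact le_rfl
  · exact div_le_self (Nat.cast_nonneg d) (by linarith)

/-! ### Thin sets and the Salem property -/

/-- `E` is covered by finitely many balls of a common radius less than `δ` whose `β`-dimensional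
total size is less than `δ`. -/
def IsThin {d : ℕ} (β δ : ℝ) (E : Set (Torus d)) : Prop :=
  ∃ (S : Finset (Torus d)) (r : ℝ), 0 < r ∧ r < δ ∧ S.card * r ^ β < δ ∧
    E ⊆ ⋃ x ∈ S, Metric.ball x r

lemma isOpen_setOf_isThin {d : ℕ} {β δ : ℝ} :
    IsOpen {p : PairSpace d β | IsThin β δ (p.1.1 : Set (Torus d))} := by
  have h : {p : PairSpace d β | IsThin β δ (p.1.1 : Set (Torus d))} =
      ⋃ (S : Finset (Torus d)) (r : ℝ) (_ : 0 < r ∧ r < δ ∧ S.card * r ^ β < δ),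
        {p : PairSpace d β | (p.1.1 : Set (Torus d)) ⊆ ⋃ x ∈ S, Metric.ball x r} := by
    ext p
    simp only [mem_ofPred_eq, mem_iUnion, IsThin, exists_prop, and_assoc]
  rw [h]
  refine isOpen_iUnion fun S => isOpen_iUnion fun r => isOpen_iUnion fun _ => ?_
  exact (NonemptyCompacts.isOpen_subsets_of_isOpen
    (isOpen_biUnion fun _ _ => Metric.isOpen_ball)).preimage continuous_pairSpace_fst

lemma dense_setOf_isThin {d : ℕ} {β δ : ℝ} (hβ : 0 < β) (hβd : β ≤ d) (hδ : 0 < δ) :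
    Dense {p : PairSpace d β | IsThin β δ (p.1.1 : Set (Torus d))} := by
  refine ApproximatesDensities.dense hβ (P := IsThin β δ) fun ρ hρ s hs hsβ δ' hδ' => ?_
  obtain ⟨μ, h1, h2, h3, h4, S, r, hr, hrδ, hS, hSμ⟩ :=
    exists_thin_measure hρ hs hsβ hβd (lt_min hδ hδ')
  exact ⟨μ, h1, h2, fun ξ => (h3 ξ).trans (min_le_right _ _),
    h4.trans (Metric.cthickening_mono (min_le_right _ _) _), S, r, hr,
    hrδ.trans_le (min_le_left _ _), hS.trans_le (min_le_left _ _), hSμ⟩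

lemma dimH_le_of_isThin {d : ℕ} {β : ℝ} (hβ : 0 < β) {E : Set (Torus d)}
    (h : ∀ k : ℕ, IsThin β (1 / ((k : ℝ) + 1)) E) : dimH E ≤ ENNReal.ofReal β := by
  choose S r hr hrδ hS hSE using h
  have hlim := tendsto_one_div_add_atTop_nhds_zero_nat (𝕜 := ℝ)
  have hlimr : Tendsto (fun k => ENNReal.ofReal (2 * r k)) atTop (𝓝 0) := by
    have h0 : Tendsto r atTop (𝓝 0) :=
      squeeze_zero (fun k => (hr k).le) (fun k => (hrδ k).le) hlim
    have := ENNReal.tendsto_ofReal (h0.const_mul 2)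
    simpa using this
  have hdiam : ∀ k (x : Torus d), Metric.ediam (Metric.ball x (r k)) ≤ ENNReal.ofReal (2 * r k) :=
    fun k x => by
      refine Metric.ediam_le_of_forall_dist_le fun a ha b hb => ?_
      have := dist_triangle_right a b x
      rw [Metric.mem_ball] at ha hb
      linarith
  have hmeas : Measure.hausdorffMeasure β E ≤ ENNReal.ofReal (2 ^ β) := by
    refine (Measure.hausdorffMeasure_le_liminf_sum β E (l := atTop)
      (fun k => ENNReal.ofReal (2 * r k)) hlimr
      (fun k (x : S k) => Metric.ball (x : Torus d) (r k))
      (Eventually.of_forall fun k x => hdiam k x)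
      (Eventually.of_forall fun k => by simpa [iUnion_subtype] using hSE k)).trans ?_
    refine (liminf_le_liminf (v := fun _ => ENNReal.ofReal (2 ^ β))
      (Eventually.of_forall fun k => ?_)).trans (by simp)
    calc ∑ x : S k, Metric.ediam (Metric.ball (x : Torus d) (r k)) ^ β
        ≤ ∑ _x : S k, ENNReal.ofReal (2 * r k) ^ β :=
          Finset.sum_le_sum fun x _ => ENNReal.rpow_le_rpow (hdiam k x) hβ.le
      _ = ENNReal.ofReal ((S k).card * (2 * r k) ^ β) := by
          rw [Finset.sum_const, Finset.card_univ, Fintype.card_coe, nsmul_eq_mul,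
            ENNReal.ofReal_mul (Nat.cast_nonneg _), ENNReal.ofReal_natCast,
            ENNReal.ofReal_rpow_of_nonneg (by linarith [hr k]) hβ.le]
      _ ≤ ENNReal.ofReal (2 ^ β) := by
          refine ENNReal.ofReal_le_ofReal ?_
          rw [Real.mul_rpow (by norm_num) (hr k).le, mul_left_comm]
          refine mul_le_of_le_one_right (by positivity) ((hS k).le.trans ?_)
          rw [div_le_one (by positivity)]
          linarith [(Nat.cast_nonneg k : (0 : ℝ) ≤ k)]
  refine dimH_le_of_hausdorffMeasure_ne_top (d := β.toNNReal) ?_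
  rw [Real.coe_toNNReal β hβ.le]
  exact (hmeas.trans_lt ENNReal.ofReal_lt_top).ne

lemma le_fourierDim {d : ℕ} {β : ℝ} (hβd : β ≤ d) (p : PairSpace d β) :
    ENNReal.ofReal β ≤ fourierDim (p.1.1 : Set (Torus d)) := by
  refine le_trans ?_ (le_iSup₂ (f := fun (μ : ProbabilityMeasure (Torus d))
    (_ : μ ∈ {μ : ProbabilityMeasure (Torus d) |
      (μ : Measure (Torus d)).support ⊆ (p.1.1 : Set (Torus d))}) =>
        fourierDimMeasure (μ : Measure (Torus d))) ⟨p.1.2.toMeasure, p.2.1⟩ p.2.2)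
  -- Membership in M(β) gives decay only for exponents strictly below β, so β is reached as the
  -- supremum of the numbers aβ with a < 1.
  refine ENNReal.le_of_forall_lt_one_mul_le fun a ha => ?_
  lift a to NNReal using ha.ne_top
  rcases le_or_gt β 0 with hβ | hβ
  · simp [ENNReal.ofReal_of_nonpos hβ]
  have ha1 : (a : ℝ) < 1 := by exact_mod_cast ha
  have h0 : 0 ≤ (a : ℝ) * β := by positivity
  have h1 : (a : ℝ) * β < β := by nlinarith
  have h2 : (a : ℝ≥0∞) * ENNReal.ofReal β = ENNReal.ofReal (a * β) := by
    rw [ENNReal.ofReal_mul a.coe_nonneg, ENNReal.ofReal_coe_nnreal]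
  rw [h2]
  exact le_iSup₂ (f := fun (s : ℝ) (_ : s ∈ {s : ℝ | s ∈ Icc (0 : ℝ) d ∧
    HasFourierDecay s p.1.2.toMeasure}) => ENNReal.ofReal s) (a * β)
    ⟨⟨h0, h1.le.trans hβd⟩, p.1.2.decay _ ⟨h0, h1⟩⟩

theorem fourierDim_eq_of_isThin {d : ℕ} (hd : 1 ≤ d) {β : ℝ} (hβ : 0 < β) (hβd : β ≤ d)
    {p : PairSpace d β} (h : ∀ k : ℕ, IsThin β (1 / ((k : ℝ) + 1)) (p.1.1 : Set (Torus d))) :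
    fourierDim (p.1.1 : Set (Torus d)) = ENNReal.ofReal β ∧ IsSalem (p.1.1 : Set (Torus d)) := by
  have h1 := le_fourierDim hβd p
  have h2 := fourierDim_le_hausdorffDim hd (p.1.1 : Set (Torus d))
  have h3 : hausdorffDim (p.1.1 : Set (Torus d)) ≤ ENNReal.ofReal β :=
    (hausdorffDim_eq_dimH _).le.trans (dimH_le_of_isThin hβ h)
  exact ⟨le_antisymm (h2.trans h3) h1, le_antisymm h2 (h3.trans h1)⟩

/-! ### Avoidance as a generic property -/

/-- Avoiding a closed set of configurations is an open condition. -/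
lemma isOpen_setOf_avoids_closed {m d : ℕ} {K : Set ((Fin m → Torus d) × Torus d)}
    (hK : IsClosed K) : IsOpen {E : NonemptyCompacts (Torus d) |
      ∀ z y, (∀ k, z k ∈ E) → y ∈ E → (z, y) ∉ K} := by
  rw [Metric.isOpen_iff]
  intro E hE
  have hQ : IsCompact ((univ.pi fun _ : Fin m => (E : Set (Torus d))) ×ˢ (E : Set (Torus d))) :=
    (isCompact_univ_pi fun _ => E.isCompact).prod E.isCompact
  obtain ⟨δ, hδ, hsub⟩ := hQ.exists_thickening_subset_open hK.isOpen_compl fun q hq =>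
    hE q.1 q.2 (fun k => hq.1 k (mem_univ k)) hq.2
  refine ⟨δ, hδ, fun E' hE' z y hz hy => hsub ?_⟩
  have hnear : ∀ u ∈ E', ∃ v ∈ E, dist u v < δ := fun u hu =>
    Metric.exists_dist_lt_of_hausdorffDist_lt hu hE' (edist_ne_top E' E)
  choose z' hz' hzz' using fun k => hnear (z k) (hz k)
  obtain ⟨y', hy', hyy'⟩ := hnear y hy
  refine Metric.mem_thickening_iff.2 ⟨(z', y'), ⟨fun k _ => hz' k, hy'⟩, ?_⟩
  rw [Prod.dist_eq]
  exact max_lt ((dist_pi_lt_iff hδ).2 hzz') hyy'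

/-- Near a configuration of distinct points, avoidance holds on a dense open set of pairs. -/
lemma exists_dense_open_avoiding {m d : ℕ} (hm : 0 < m) {V : Set (Fin m → Torus d)}
    (hV : IsOpen V) {f : (Fin m → Torus d) → Torus d} (hf : IsSmoothOn f V)
    (hJ : PartialJacobiansInvertibleOn f V) {β : ℝ} (hβ : 0 < β)
    (hβc : β ≤ criticalDim d (m + 1)) {x : Fin m → Torus d} {y : Torus d} (hx : x ∈ V)
    (hinj : Function.Injective x) (hxy : ∀ k, x k ≠ y) :
    ∃ η > 0, {p : PairSpace d β | ∀ z ∈ Metric.closedBall x η, ∀ y' ∈ Metric.closedBall y η,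
      (∀ k, z k ∈ p.1.1) → y' ∈ p.1.1 → y' ≠ f z} ∈ residual (PairSpace d β) := by
  obtain ⟨R₀, Λ, c, hR₀, hR₀', hΛ, hc, hlip, hexp, hdec⟩ := exists_local_control hm hV hf hJ hx hinj
  obtain ⟨η, hη, hηR, hsep, hsepy⟩ : ∃ η : ℝ, 0 < η ∧ 2 * η < R₀ ∧
      (∀ i j, i ≠ j → 8 * η < dist (x i) (x j)) ∧ ∀ k, 8 * η < dist (x k) y := by
    have hev : ∀ a b : ℝ, 0 < b → ∀ᶠ η : ℝ in 𝓝[>] 0, a * η < b := fun a b hb => by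
      have h : Tendsto (fun η : ℝ => a * η) (𝓝[>] 0) (𝓝 (a * 0)) :=
        (tendsto_id.const_mul a).mono_left nhdsWithin_le_nhds
      rw [mul_zero] at h
      exact h.eventually_lt_const hb
    have h1 : ∀ᶠ η : ℝ in 𝓝[>] 0, ∀ i j, i ≠ j → 8 * η < dist (x i) (x j) := by
      rw [eventually_all]; intro i
      rw [eventually_all]; intro j
      by_cases hij : i = j
      · exact Eventually.of_forall fun _ h => absurd hij h
      · exact (hev 8 _ (dist_pos.2 (hinj.ne hij))).mono fun _ h _ => h
    have h2 : ∀ᶠ η : ℝ in 𝓝[>] 0, ∀ k, 8 * η < dist (x k) y :=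
      eventually_all.2 fun k => hev 8 _ (dist_pos.2 (hxy k))
    have h0 : ∀ᶠ η : ℝ in 𝓝[>] 0, 0 < η := self_mem_nhdsWithin
    obtain ⟨η, ⟨⟨h0, hR⟩, h1⟩, h2⟩ := (((h0.and (hev 2 _ hR₀)).and h1).and h2).exists
    exact ⟨η, h0, hR, h1, h2⟩
  refine ⟨η, hη, residual_of_dense_open ?_ ?_⟩
  · have hfc : ContinuousOn f (Metric.closedBall x η) :=
      ((LipschitzOnWith.of_dist_le_mul (K := Λ.toNNReal) fun Z hZ Z' hZ' => by
        rw [Real.coe_toNNReal _ hΛ.le]; exact hlip Z hZ Z' hZ').continuousOn).mono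
        (Metric.closedBall_subset_closedBall (by linarith))
    -- The graph of f over a closed product of balls on which f is continuous. Since the balls are
    -- closed, excluding these solutions is an open condition on the compact set.
    have hK : IsClosed {q : (Fin m → Torus d) × Torus d |
        q ∈ Metric.closedBall x η ×ˢ Metric.closedBall y η ∧ q.2 = f q.1} := by
      have hcl : IsClosed (Metric.closedBall x η ×ˢ Metric.closedBall y η) :=
        Metric.isClosed_closedBall.prod Metric.isClosed_closedBall
      have hg : ContinuousOn (fun q : (Fin m → Torus d) × Torus d => (q.2, f q.1))
          (Metric.closedBall x η ×ˢ Metric.closedBall y η) :=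
        continuousOn_snd.prodMk (hfc.comp continuousOn_fst fun q hq => hq.1)
      exact hg.preimage_isClosed_of_isClosed hcl isClosed_diagonal
    convert (isOpen_setOf_avoids_closed hK).preimage (continuous_pairSpace_fst (β := β)) using 1
    ext p
    constructor
    · intro h z y' hz hy' hq
      exact h z hq.1.1 y' hq.1.2 hz hy' hq.2
    · intro h z hz y' hy' hzE hy'E hq
      exact h z y' hzE hy'E ⟨⟨hz, hy'⟩, hq⟩
  · exact ApproximatesDensities.dense hβ (P := fun E => ∀ z ∈ Metric.closedBall x η,
      ∀ y' ∈ Metric.closedBall y η, (∀ k, z k ∈ E) → y' ∈ E → y' ≠ f z) fun ρ hρ s hs hsβ δ hδ =>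
      exists_avoiding_measure hm hR₀' hΛ hc hlip hexp hdec hη hηR hsep hsepy hρ hs hsβ hβc hδ

/-- The configuration space is second countable, so countably many of the local neighbourhoods cover
all configurations of distinct points over V, and a countable intersection of residual sets is
residual. -/
theorem eventually_residual_avoids {m d : ℕ} (hm : 0 < m) {V : Set (Fin m → Torus d)}
    (hV : IsOpen V) {f : (Fin m → Torus d) → Torus d} (hf : IsSmoothOn f V)
    (hJ : PartialJacobiansInvertibleOn f V) {β : ℝ} (hβ : 0 < β)
    (hβc : β ≤ criticalDim d (m + 1)) :
    ∀ᶠ p in residual (PairSpace d β), Avoids f V (p.1.1 : Set (Torus d)) := by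
  set Ω : Set ((Fin m → Torus d) × Torus d) :=
    {q | q.1 ∈ V ∧ Function.Injective q.1 ∧ ∀ k, q.1 k ≠ q.2} with hΩ
  choose! η hη hres using fun (q : (Fin m → Torus d) × Torus d) (hq : q ∈ Ω) =>
    exists_dense_open_avoiding hm hV hf hJ hβ hβc hq.1 hq.2.1 hq.2.2
  obtain ⟨T, hTΩ, hT, hcov⟩ := countable_cover_nhdsWithin (s := Ω)
    (f := fun q => Metric.closedBall q.1 (η q) ×ˢ Metric.closedBall q.2 (η q)) fun q hq =>
      nhdsWithin_le_nhds (prod_mem_nhds (Metric.closedBall_mem_nhds _ (hη q hq))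
        (Metric.closedBall_mem_nhds _ (hη q hq)))
  have h : ∀ᶠ p in residual (PairSpace d β), ∀ q ∈ T, ∀ z ∈ Metric.closedBall q.1 (η q),
      ∀ y' ∈ Metric.closedBall q.2 (η q), (∀ k, z k ∈ p.1.1) → y' ∈ p.1.1 → y' ≠ f z :=
    (eventually_countable_ball hT).2 fun q hq => hres q (hTΩ hq)
  filter_upwards [h] with p hp x y hxE hyE hinj hxy hxV
  obtain ⟨q, hq, hxq, hyq⟩ := mem_iUnion₂.1 (hcov (show (x, y) ∈ Ω from ⟨hxV, hinj, hxy⟩))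
  exact hp q hq x hxq y hyq hxE hyE

theorem eventually_residual_isThin {d : ℕ} {β : ℝ} (hβ : 0 < β) (hβd : β ≤ d) :
    ∀ᶠ p in residual (PairSpace d β), ∀ k : ℕ,
      IsThin β (1 / ((k : ℝ) + 1)) (p.1.1 : Set (Torus d)) :=
  eventually_countable_forall.2 fun _ => residual_of_dense_open isOpen_setOf_isThin
    (dense_setOf_isThin hβ hβd (by positivity))

/-- Needed because the Baire property yields a dense set, which exhibits an element only in a
nonempty space. The approximants have decay of every order, so one of them, paired with the whole
torus, works for any β. -/
lemma nonempty_pairSpace {d : ℕ} (hd : 1 ≤ d) {β : ℝ} : Nonempty (PairSpace d β) := by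
  obtain ⟨μ, hμ, hdec, -⟩ := exists_thin_measure (isSmoothDensity_smoothing
    (Measure.dirac (0 : Torus d)) (by norm_num : (0 : ℝ) < 1 / 4) (by norm_num)) le_rfl
    (by exact_mod_cast hd : (0 : ℝ) < d) le_rfl one_pos
  exact ⟨⟨⟨⟨⟨univ, isCompact_univ⟩, univ_nonempty⟩, ⟨μ, inferInstance, fun s hs => hdec s hs.1⟩⟩,
    hμ, subset_univ _⟩⟩

theorem eventually_residual_isSalem_avoids {m d : ℕ} (hd : 1 ≤ d) (hm : 0 < m)
    {V : Set (Fin m → Torus d)} (hV : IsOpen V) {f : (Fin m → Torus d) → Torus d}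
    (hf : IsSmoothOn f V) (hJ : PartialJacobiansInvertibleOn f V) {β : ℝ} (hβ : 0 < β)
    (hβc : β ≤ criticalDim d (m + 1)) :
    ∀ᶠ p in residual (PairSpace d β), fourierDim (p.1.1 : Set (Torus d)) = ENNReal.ofReal β ∧
      IsSalem (p.1.1 : Set (Torus d)) ∧ Avoids f V (p.1.1 : Set (Torus d)) := by
  have hβd : β ≤ d := hβc.trans (criticalDim_le (by omega))
  filter_upwards [eventually_residual_isThin hβ hβd,
    eventually_residual_avoids hm hV hf hJ hβ hβc] with p hp hp'
  obtain ⟨h1, h2⟩ := fourierDim_eq_of_isThin hd hβ hβd hp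
  exact ⟨h1, h2, hp'⟩

theorem exists_isSalem_avoids {m d : ℕ} (hd : 1 ≤ d) (hm : 0 < m)
    {V : Set (Fin m → Torus d)} (hV : IsOpen V) {f : (Fin m → Torus d) → Torus d}
    (hf : IsSmoothOn f V) (hJ : PartialJacobiansInvertibleOn f V) :
    ∃ E : Set (Torus d), IsCompact E ∧ IsSalem E ∧
      fourierDim E = ENNReal.ofReal (criticalDim d (m + 1)) ∧ Avoids f V E := by
  have hβ : 0 < criticalDim d (m + 1) := criticalDim_pos hd (by omega)
  have hB := baireSpace_pairSpace (d := d) hβ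
  have hne := nonempty_pairSpace hd (β := criticalDim d (m + 1))
  obtain ⟨p, h1, h2, h3⟩ := (dense_of_mem_residual
    (eventually_residual_isSalem_avoids hd hm hV hf hJ hβ le_rfl)).nonempty
  exact ⟨p.1.1, p.1.1.isCompact, h2, h1, h3⟩

end SalemAvoid

end

theorem theorem2 (d n : ℕ) (hd : 1 ≤ d) (hn : 2 ≤ n)
    (V : Set (Fin (n - 1) → SalemAvoid.Torus d)) (hV : IsOpen V)
    (f : (Fin (n - 1) → SalemAvoid.Torus d) → SalemAvoid.Torus d)
    (hf : SalemAvoid.IsSmoothOn f V)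
    (hJ : SalemAvoid.PartialJacobiansInvertibleOn f V) :
    (∃ E : Set (SalemAvoid.Torus d), IsCompact E ∧ SalemAvoid.IsSalem E ∧
      SalemAvoid.fourierDim E = ENNReal.ofReal (SalemAvoid.criticalDim d n) ∧
      SalemAvoid.Avoids f V E) ∧
    ∀ β : ℝ, 0 < β → β ≤ SalemAvoid.criticalDim d n →
      {p : SalemAvoid.PairSpace d β |
        SalemAvoid.IsSalem (p.1.1 : Set (SalemAvoid.Torus d)) ∧
        SalemAvoid.Avoids f V (p.1.1 : Set (SalemAvoid.Torus d))} ∈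
        residual (SalemAvoid.PairSpace d β) := by
  obtain ⟨m, rfl⟩ : ∃ m, n = m + 1 := ⟨n - 1, by omega⟩
  have hm : 0 < m := by omega
  exact ⟨SalemAvoid.exists_isSalem_avoids (m := m) hd hm hV hf hJ, fun β hβ hβc =>
    (SalemAvoid.eventually_residual_isSalem_avoids (m := m) hd hm hV hf hJ hβ hβc).mono
      fun _ h => h.2⟩
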